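/- **Setting.** Let $\mathbb R^+=(0,\infty)$ and let $f_0:(0,1)\to\mathbb R^+$ be $C^2$ with: - (A1) $f_0(x)\to0$ as $x\to0^+$ and $f_0(x)\to+\infty$ as $x\to1^-$; (A2) $f_0'>1$; (A3) $f_0'(x)\to1$ as $x\to0^+$; (A4) $f_0''>0$; (A5) $f_0''/(f_0')^2$ is (weakly) decreasing; (A6) $\sup_{(0,1)} f_0''/(f_0')^2<\infty$. Let $g_0=f_0^{-1}:\mathbb R^+\to(0,1)$ and assume - (B) there are decreasing sequences $(\omega^{(i)}_n)_{n\ge1}$ in $(0,1)$ tending to $0$, constants $C^{(i)}>0$ and $\sigma_i\in(0,1)$ $(i=1,2)$ with $\sum_{n\ge 1}(\omega_n^{(i)})^{1-\sigma_i}<\infty$, $g_0'(n-1)\le C^{(1)}\omega^{(1)}_n$ for $n\ge2$, and $\prod_{j=1}^{n-1}g_0'(g_0^j(1))\le C^{(2)}\omega^{(2)}_n$ for $n\ge1$. Let $f(x)=f_0(x)$, $g_x(y)=g_0(y)$ for $0<x<1$; $f(x)=x-1$, $g_x(y)=y+1$ for $x>1$; and $\mathcal P(x,y)=(f(x),g_x(y))$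 on $\mathbb R^+\times\mathbb R^+$ (defined off the null set $x=1$). Assume - (C) $m$ is a nonzero ergodic $\mathcal P$-invariant measure on $\mathbb R^+\times\mathbb R^+$, $m\ll\mathrm{Leb}$, and $m((a,b)\times\mathbb R^+)<\infty$ for all $0<a<b<\infty$; - (D) $\int\rho\,dm<\infty$, where $\rho(x,y)=\rho_0\ln\Big[\frac xy\cdot\frac{g_x(y)}{f(x)}\cdot\frac{f'(x)}{\partial_yg_x(y)}\Big]$ and $\rho_0>0$. **Induced system.** Let $\tau(x)=\min\{n\ge1:f^n(x)\in(0,1)\}$, $F=f^{\tau}$, $P=\mathcal P^{\tau}$; $\kappa(x)=\min\{n\ge1:F^n(x)\in(g_0(1),1)\}$, $\widehat F=F^{\kappa}$, $\widehat P=P^{\kappa}$; and $\widetilde F=\widehat F^2$, $\widetilde P=\widehat P^2$, $\widetilde P(x,y)=(\widetilde F(x),\widetilde G_x(y))$. For $s\ge2$, $q\ge1$ let $J_s^q$ be the set of $x\in(g_0(s-1),g_0(s))$ with $F(x)\in(g_0^q(1),g_0^{q-1}(1))$; let $\widetilde\Delta=\bigcup_{s_0,s_1\ge2,\;q_0,q_1\ge1}J_{s_0}^{q_0}\cap\widehat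 F^{-1}(J_{s_1}^{q_1})$ and $\Sigma=\widetilde\Delta\times\mathbb R^+$. Let $\nu=m|_\Sigma/m(\Sigma)$ (a $\widetilde P$-invariant probability measure), let $\widehat\mu$ be its image under $(x,y)\mapsto x$, and let $(\nu_x)$ be a disintegration of $\nu$ over $\widehat\mu$: a measurable family of probability measures with $\int h\,d\nu=\int\!\int h(x,y)\,d\nu_x(y)\,d\widehat\mu(x)$ for bounded measurable $h$. Fix $y_*>0$ and let $r(x)=\rho_0\ln\big[\widetilde F'(x)/\widetilde G_x'(y_*)\big]$ and $r^{(n)}=\sum_{i<n}r\circ\widetilde F^i$. Let $\Sigma_r=\{[(x,y),s]:(x,y)\in\Sigma,\ 0\le s<r(x)\}$, which represents the space $\{0\le s\le r(x)\}$ with $[(x,y),r(x)]$ and $[\widetilde P(x,y),0]$ identified, and let $\widetilde\Delta_r=\{(x,s):x\in\widetilde\Delta,\ 0\le s<r(x)\}$. For $t\ge0$ put $$\widetilde P_t[(x,y),s]=[\widetilde P^n(x,y),\,s+t-r^{(n)}(x)],\qquad \widetilde F_t(x,s)=(\widetilde F^n(x),\,s+t-r^{(n)}(x)),$$ where $n\ge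 0$ is determined by $r^{(n)}(x)\le s+t<r^{(n+1)}(x)$ (defined almost everywhere). Let $\pi_r[(x,y),a]=(x,a)$, $\nu_r=(\nu\otimes\mathrm{Leb})|_{\Sigma_r}/\int r\,d\nu$, and, for $V:\Sigma_r\to\mathbb R$, $$V_t(x,a)=\int_{\mathbb R^+}V\circ\widetilde P_t[(x,y),a]\,d\nu_x(y).$$ Let $C^1_{b,*}(\Sigma_r)$ be the set of bounded functions $U:\Sigma_r\to\mathbb R$ that are $C^1$ on $\{0\le s<r(x)\}$ (one-sided in $s$ at $s=0$), with bounded derivative, and such that for each $s$ the derivative $D_{(x,y)}U(\cdot,s)$ is uniformly continuous in $(x,y)$; nothing is required across the identified points. **Proposition.** There exists $\delta>0$ such that for all $U,V\in C^1_{b,*}(\Sigma_r)$ with $\int_{\Sigma_r}U\,d\nu_r=0$ there exists $C>0$ (which may depend on $U,V$) such that, for every $t\ge0$, the two integrands below are $\nu_r$-integrable and $$\left|\int_{\Sigma_r}U\cdot V\circ\widetilde P_{2t}\,d\nu_r-\int_{\Sigma_r}U\cdot V_t\circ\widetilde F_t\circ\pi_r\,d\nu_r\right|\le C\,e^{-\delta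 t}.$$ -/

import Mathlib

open Set Filter Topology MeasureTheory ProbabilityTheory

noncomputable section

namespace InducedFlow

/-- Assumptions (A1)--(A6) on the map `f₀ : (0,1) → ℝ⁺`. Values of `f₀` outside `(0,1)` play no role. -/
structure AssumptionA (f₀ : ℝ → ℝ) : Prop where
  contDiffOn : ContDiffOn ℝ 2 f₀ (Ioo 0 1)
  tendsto_zero : Tendsto f₀ (𝓝[>] 0) (𝓝 0)
  tendsto_one : Tendsto f₀ (𝓝[<] 1) atTop
  one_lt_deriv : ∀ x ∈ Ioo (0 : ℝ) 1, 1 < deriv f₀ x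
  deriv_tendsto : Tendsto (deriv f₀) (𝓝[>] 0) (𝓝 1)
  deriv2_pos : ∀ x ∈ Ioo (0 : ℝ) 1, 0 < deriv (deriv f₀) x
  ratio_decreasing : AntitoneOn (fun x => deriv (deriv f₀) x / (deriv f₀ x) ^ 2) (Ioo 0 1)
  adler : BddAbove ((fun x => deriv (deriv f₀) x / (deriv f₀ x) ^ 2) '' Ioo 0 1)

/-- The inverse `g₀ : ℝ⁺ → (0,1)` of the bijection `f₀ : (0,1) → ℝ⁺`. -/
def g0 (f₀ : ℝ → ℝ) : ℝ → ℝ := Function.invFunOn f₀ (Ioo 0 1)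

/-- Assumption (B). The sequences are indexed by `n ≥ 1`. -/
def AssumptionB (f₀ : ℝ → ℝ) : Prop :=
  ∃ (ω₁ ω₂ : ℕ → ℝ) (C₁ C₂ σ₁ σ₂ : ℝ),
    AntitoneOn ω₁ (Ici 1) ∧ AntitoneOn ω₂ (Ici 1) ∧
    (∀ n, 1 ≤ n → ω₁ n ∈ Ioo (0 : ℝ) 1) ∧ (∀ n, 1 ≤ n → ω₂ n ∈ Ioo (0 : ℝ) 1) ∧
    Tendsto ω₁ atTop (𝓝 0) ∧ Tendsto ω₂ atTop (𝓝 0) ∧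
    0 < C₁ ∧ 0 < C₂ ∧ σ₁ ∈ Ioo (0 : ℝ) 1 ∧ σ₂ ∈ Ioo (0 : ℝ) 1 ∧
    Summable (fun n : ℕ => ω₁ (n + 1) ^ (1 - σ₁)) ∧
    Summable (fun n : ℕ => ω₂ (n + 1) ^ (1 - σ₂)) ∧
    (∀ n : ℕ, 2 ≤ n → deriv (g0 f₀) ((n : ℝ) - 1) ≤ C₁ * ω₁ n) ∧
    (∀ n : ℕ, 1 ≤ n → ∏ j ∈ Finset.Ico 1 n, deriv (g0 f₀) ((g0 f₀)^[j] 1) ≤ C₂ * ω₂ n)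

/-- The map `f` on `ℝ⁺`: `f₀` on `(0,1)` and `x ↦ x - 1` on `(1,∞)`; it is `0` elsewhere. -/
def baseF (f₀ : ℝ → ℝ) (x : ℝ) : ℝ :=
  open Classical in if x ∈ Ioo (0 : ℝ) 1 then f₀ x else if 1 < x then x - 1 else 0

/-- The fibre maps: `g₀` for `x ∈ (0,1)`, `y ↦ y + 1` for `x > 1`. On the null set of the remaining
`x` (where the fibre map is only formally defined, with value `+∞` at `x = 1`) it is set to `0`. -/
def fibreG (f₀ : ℝ → ℝ) (x y : ℝ) : ℝ :=
  open Classical in if x ∈ Ioo (0 : ℝ) 1 then g0 f₀ y else if 1 < x then y + 1 else 0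

/-- The base map `𝒫(x,y) = (f(x), g_x(y))`. -/
def baseP (f₀ : ℝ → ℝ) (z : ℝ × ℝ) : ℝ × ℝ := (baseF f₀ z.1, fibreG f₀ z.1 z.2)

/-- Assumption (C), for a nonzero measure `m` on `ℝ⁺ × ℝ⁺`: it is absolutely continuous with respect
to Lebesgue measure, invariant and ergodic for `𝒫`, and finite on `(a,b) × ℝ⁺` for `0 < a < b`. -/
structure AssumptionC (f₀ : ℝ → ℝ) (m : Measure (ℝ × ℝ)) : Prop where
  ne_zero : m ≠ 0
  supported : m (Ioi (0 : ℝ) ×ˢ Ioi (0 : ℝ))ᶜ = 0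
  absolutelyContinuous : m ≪ (volume : Measure (ℝ × ℝ))
  ergodic : Ergodic (baseP f₀) m
  finite_strip : ∀ a b : ℝ, 0 < a → a < b → m (Ioo a b ×ˢ Ioi (0 : ℝ)) < ⊤

/-- The roof function `ρ(x,y) = ρ₀ log [ (x/y) (g_x(y)/f(x)) (f'(x)/∂_y g_x(y)) ]` of the original
flow. -/
def rho (f₀ : ℝ → ℝ) (ρ₀ : ℝ) (z : ℝ × ℝ) : ℝ :=
  ρ₀ * Real.log (z.1 / z.2 * (fibreG f₀ z.1 z.2 / baseF f₀ z.1) *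
    (deriv (baseF f₀) z.1 / deriv (fibreG f₀ z.1) z.2))

/-- Assumption (D). -/
def AssumptionD (f₀ : ℝ → ℝ) (ρ₀ : ℝ) (m : Measure (ℝ × ℝ)) : Prop := Integrable (rho f₀ ρ₀) m

/-! ### The inducing scheme -/

/-- First return time of `f` to `(0,1)`. -/
def tau (f₀ : ℝ → ℝ) (x : ℝ) : ℕ := sInf {n : ℕ | 1 ≤ n ∧ (baseF f₀)^[n] x ∈ Ioo (0 : ℝ) 1}

/-- First induced map `F = f^τ`. -/
def indF (f₀ : ℝ → ℝ) (x : ℝ) : ℝ := (baseF f₀)^[tau f₀ x] x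

/-- First induced skew product `P = 𝒫^τ`. -/
def indP (f₀ : ℝ → ℝ) (z : ℝ × ℝ) : ℝ × ℝ := (baseP f₀)^[tau f₀ z.1] z

/-- First return time of `F` to `(g₀(1),1)`. -/
def kappa (f₀ : ℝ → ℝ) (x : ℝ) : ℕ := sInf {n : ℕ | 1 ≤ n ∧ (indF f₀)^[n] x ∈ Ioo (g0 f₀ 1) 1}

/-- Second induced map `F̂ = F^κ`. -/
def hatF (f₀ : ℝ → ℝ) (x : ℝ) : ℝ := (indF f₀)^[kappa f₀ x] x

/-- Second induced skew product `P̂ = P^κ`. -/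
def hatP (f₀ : ℝ → ℝ) (z : ℝ × ℝ) : ℝ × ℝ := (indP f₀)^[kappa f₀ z.1] z

/-- `F̃ = F̂²`. -/
def tildeF (f₀ : ℝ → ℝ) (x : ℝ) : ℝ := hatF f₀ (hatF f₀ x)

/-- `P̃ = P̂²`; its second component is `G̃_x(y)`. -/
def tildeP (f₀ : ℝ → ℝ) (z : ℝ × ℝ) : ℝ × ℝ := hatP f₀ (hatP f₀ z)

/-- The interval `I_s = (g₀(s-1), g₀(s))` (used for `s ≥ 2`). -/
def intervalI (f₀ : ℝ → ℝ) (s : ℕ) : Set ℝ := Ioo (g0 f₀ ((s : ℝ) - 1)) (g0 f₀ s)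

/-- The interval `J_s^q`, consisting of the points of `I_s` that `F` maps into
`(g₀^q(1), g₀^{q-1}(1))` (used for `s ≥ 2` and `q ≥ 1`). -/
def intervalJ (f₀ : ℝ → ℝ) (s q : ℕ) : Set ℝ :=
  intervalI f₀ s ∩ indF f₀ ⁻¹' Ioo ((g0 f₀)^[q] 1) ((g0 f₀)^[q - 1] 1)

/-- `Δ̃`, the union of the sets `J_{s₀}^{q₀} ∩ F̂⁻¹(J_{s₁}^{q₁})` over `s₀, s₁ ≥ 2`, `q₀, q₁ ≥ 1`. -/
def tildeDelta (f₀ : ℝ → ℝ) : Set ℝ :=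
  {x | ∃ s₀ s₁ q₀ q₁ : ℕ, 2 ≤ s₀ ∧ 2 ≤ s₁ ∧ 1 ≤ q₀ ∧ 1 ≤ q₁ ∧
    x ∈ intervalJ f₀ s₀ q₀ ∩ hatF f₀ ⁻¹' intervalJ f₀ s₁ q₁}

/-- The base `Σ = Δ̃ × ℝ⁺`. -/
def baseSigma (f₀ : ℝ → ℝ) : Set (ℝ × ℝ) := tildeDelta f₀ ×ˢ Ioi (0 : ℝ)

/-- The `P̃`-invariant probability measure `ν`, the normalized restriction of `m` to `Σ`. -/
def nu (f₀ : ℝ → ℝ) (m : Measure (ℝ × ℝ)) : Measure (ℝ × ℝ) := ProbabilityTheory.cond m (baseSigma f₀)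

/-- The `F̃`-invariant probability measure `μ̂ = π_* ν`. -/
def muHat (f₀ : ℝ → ℝ) (m : Measure (ℝ × ℝ)) : Measure ℝ := (nu f₀ m).map Prod.fst

/-! ### The suspension flow with the induced roof function -/

/-- The induced roof function `r(x) = ρ₀ log [ F̃'(x) / G̃_x'(y₀) ]`, where `y₀ > 0` is a fixed
reference height. -/
def roof (f₀ : ℝ → ℝ) (ρ₀ y₀ x : ℝ) : ℝ :=
  ρ₀ * Real.log (deriv (tildeF f₀) x / deriv (fun y => (tildeP f₀ (x, y)).2) y₀)

/-- The phase space `Σ_r`, where each point is represented by its unique representative with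
`0 ≤ s < r(x)`. -/
def sigmaR (f₀ : ℝ → ℝ) (ρ₀ y₀ : ℝ) : Set ((ℝ × ℝ) × ℝ) :=
  {p | p.1 ∈ baseSigma f₀ ∧ 0 ≤ p.2 ∧ p.2 < roof f₀ ρ₀ y₀ p.1.1}

/-- The Birkhoff sums `r^{(n)}(x) = ∑_{i < n} r(F̃^i(x))`. -/
def roofSum (f₀ : ℝ → ℝ) (ρ₀ y₀ : ℝ) (n : ℕ) (x : ℝ) : ℝ :=
  birkhoffSum (tildeF f₀) (roof f₀ ρ₀ y₀) n x

/-- The number `n` with `r^{(n)}(x) ≤ u < r^{(n+1)}(x)`, given as the least `n` with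
`u < r^{(n+1)}(x)` (for `u ≥ 0`, and `x` with a full `F̃`-orbit in `Δ̃`, these agree as `r > 0`). -/
def lapNumber (f₀ : ℝ → ℝ) (ρ₀ y₀ x u : ℝ) : ℕ := sInf {n : ℕ | u < roofSum f₀ ρ₀ y₀ (n + 1) x}

/-- The suspension flow `P̃_t` on `Σ_r`. -/
def flow (f₀ : ℝ → ℝ) (ρ₀ y₀ t : ℝ) (p : (ℝ × ℝ) × ℝ) : (ℝ × ℝ) × ℝ :=
  ((tildeP f₀)^[lapNumber f₀ ρ₀ y₀ p.1.1 (p.2 + t)] p.1,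
    p.2 + t - roofSum f₀ ρ₀ y₀ (lapNumber f₀ ρ₀ y₀ p.1.1 (p.2 + t)) p.1.1)

/-- The suspension semiflow `F̃_t` on `Δ̃_r`, the space of `(x,s)` with `x ∈ Δ̃`, `0 ≤ s < r(x)`. -/
def semiflow (f₀ : ℝ → ℝ) (ρ₀ y₀ t : ℝ) (p : ℝ × ℝ) : ℝ × ℝ :=
  ((tildeF f₀)^[lapNumber f₀ ρ₀ y₀ p.1 (p.2 + t)] p.1,
    p.2 + t - roofSum f₀ ρ₀ y₀ (lapNumber f₀ ρ₀ y₀ p.1 (p.2 + t)) p.1)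

/-- The projection `π_r[(x,y),a] = (x,a)`. -/
def projR (p : (ℝ × ℝ) × ℝ) : ℝ × ℝ := (p.1.1, p.2)

/-- The probability measure `ν_r = (ν ⊗ Leb) / ∫ r dν` on `Σ_r`. -/
def nuR (f₀ : ℝ → ℝ) (ρ₀ y₀ : ℝ) (m : Measure (ℝ × ℝ)) : Measure ((ℝ × ℝ) × ℝ) :=
  (∫⁻ z, ENNReal.ofReal (roof f₀ ρ₀ y₀ z.1) ∂(nu f₀ m))⁻¹ •
    ((nu f₀ m).prod volume).restrict (sigmaR f₀ ρ₀ y₀)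

/-- The class `C¹_{b,*}(S)`, for `S = Σ_r`: bounded `C¹` functions with bounded derivative, whose
derivative in the base variable `(x,y)` is uniformly continuous in `(x,y)`. No matching condition at
the identified points `[(x,y), r(x)] ∼ [P̃(x,y), 0]` is imposed. -/
structure IsC1bStar (S : Set ((ℝ × ℝ) × ℝ)) (U : (ℝ × ℝ) × ℝ → ℝ) : Prop where
  contDiffOn : ContDiffOn ℝ 1 U S
  bounded : ∃ M : ℝ, ∀ p ∈ S, |U p| ≤ M
  bounded_deriv : ∃ M : ℝ, ∀ p ∈ S, ‖fderivWithin ℝ U S p‖ ≤ M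
  uniform : ∀ s : ℝ, UniformContinuousOn
    (fun z : ℝ × ℝ => (fderivWithin ℝ U S (z, s)).comp (ContinuousLinearMap.inl ℝ (ℝ × ℝ) ℝ))
    {z | (z, s) ∈ S}

/-- `V_t(x,a) = ∫_{ℝ⁺} V(P̃_t[(x,y),a]) dν_x(y)`, where `κ x = ν_x`. -/
def fibreAverage (f₀ : ℝ → ℝ) (ρ₀ y₀ : ℝ) (κ : Kernel ℝ ℝ) (V : (ℝ × ℝ) × ℝ → ℝ) (t : ℝ)
    (p : ℝ × ℝ) : ℝ :=
  ∫ y in Ioi (0 : ℝ), V (flow f₀ ρ₀ y₀ t ((p.1, y), p.2)) ∂(κ p.1)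

end InducedFlow

end

noncomputable section

open scoped ENNReal

namespace InducedFlow

variable {f₀ : ℝ → ℝ}

namespace AssumptionA

/-! ### The inverse branch `g₀` -/

/-! The flow property splits P̃_{2t} as P̃_t ∘ P̃_t. The point P̃_t p lies on the fibre over
F̃_t(π_r p), and V_t averages V ∘ P̃_t over exactly that fibre. So the two integrands differ by at
most sup|U| times the oscillation of V ∘ P̃_t along one fibre. The lap count depends on x only,
hence two points of a fibre keep a common x and a common height. Their y-distance shrinks by λ =
g₀'(1) < 1 at every return (`fibreDeriv_mul_le`), and the first return already brings any two points
of the unbounded fibre within distance 1. The oscillation is therefore at most C λ^n, with n the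
number of returns between times t and 2t (`exists_abs_flowInd_sub_le`).

It remains to see that λ^n is exponentially small on average (`exists_lintegral_pow_laterLaps_le`).
As r is bounded below, only O(1 + t) returns occur before time t; fewer than N returns afterwards
means that r^{(N)}, started at one of these O(1 + t) orbit points, exceeds t. Invariance of μ̂,
Markov's inequality and a moment bound ∫ exp(η r^{(N)}) dμ̂ ≤ C K^N control this event, with N a
small multiple of t.

The moment bound is first proved for Lebesgue measure. On a pair of branches let M be the product of
the two bounds on the inverse derivatives. The fibre derivative at the reference height is at least
a constant times M², so inverse derivative times exp(ηr) is at most a constant times M^{1-σ} for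
small η. This is summable by (B), so the squared transfer operator maps exp(ηr) to a bounded
function (`exists_transfer_exp_le`), and this iterates. The passage to μ̂ uses a bounded density
(`exists_muHat_le`): iterating the transfer operator makes functions uniformly log-Lipschitz, and μ̂
is invariant because P̂ is a first return map of 𝒫 (`measurePreserving_hatP`). -/

lemma contDiffAt (hA : AssumptionA f₀) {x : ℝ} (hx : x ∈ Ioo (0 : ℝ) 1) : ContDiffAt ℝ 2 f₀ x :=
  hA.contDiffOn.contDiffAt (isOpen_Ioo.mem_nhds hx)

lemma strictMonoOn (hA : AssumptionA f₀) : StrictMonoOn f₀ (Ioo 0 1) := by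
  refine strictMonoOn_of_deriv_pos (convex_Ioo 0 1) hA.contDiffOn.continuousOn fun x hx => ?_
  rw [interior_Ioo] at hx
  linarith [hA.one_lt_deriv x hx]

lemma f_pos (hA : AssumptionA f₀) {x : ℝ} (hx : x ∈ Ioo (0 : ℝ) 1) : 0 < f₀ x := by
  have hx2 : x / 2 ∈ Ioo (0 : ℝ) 1 := ⟨by linarith [hx.1], by linarith [hx.1, hx.2]⟩
  have h1 : f₀ (x / 2) < f₀ x := hA.strictMonoOn hx2 hx (by linarith [hx.1])
  have h2 : 0 ≤ f₀ (x / 2) := by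
    refine le_of_tendsto hA.tendsto_zero ?_
    filter_upwards [Ioo_mem_nhdsGT hx2.1] with y hy
    exact (hA.strictMonoOn ⟨hy.1, hy.2.trans hx2.2⟩ hx2 hy.2).le
  linarith

lemma exists_f_eq (hA : AssumptionA f₀) {u : ℝ} (hu : 0 < u) : ∃ x ∈ Ioo (0 : ℝ) 1, f₀ x = u := by
  obtain ⟨a, ha, hau⟩ := ((hA.tendsto_zero.eventually (gt_mem_nhds hu)).and
    (Ioo_mem_nhdsGT (zero_lt_one' ℝ))).exists.imp fun a h => And.intro h.2 h.1
  obtain ⟨b, hb, hbu⟩ := ((hA.tendsto_one.eventually (eventually_gt_atTop u)).and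
    (Ioo_mem_nhdsLT (zero_lt_one' ℝ))).exists.imp fun a h => And.intro h.2 h.1
  exact isPreconnected_Ioo.intermediate_value ha hb hA.contDiffOn.continuousOn ⟨hau.le, hbu.le⟩

lemma g0_mem (hA : AssumptionA f₀) {u : ℝ} (hu : 0 < u) : g0 f₀ u ∈ Ioo (0 : ℝ) 1 :=
  Function.invFunOn_mem (hA.exists_f_eq hu)

lemma g0_pos (hA : AssumptionA f₀) {u : ℝ} (hu : 0 < u) : 0 < g0 f₀ u := (hA.g0_mem hu).1

lemma g0_lt_one (hA : AssumptionA f₀) {u : ℝ} (hu : 0 < u) : g0 f₀ u < 1 := (hA.g0_mem hu).2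

lemma f_g0 (hA : AssumptionA f₀) {u : ℝ} (hu : 0 < u) : f₀ (g0 f₀ u) = u :=
  Function.invFunOn_eq (hA.exists_f_eq hu)

lemma g0_f (hA : AssumptionA f₀) {x : ℝ} (hx : x ∈ Ioo (0 : ℝ) 1) : g0 f₀ (f₀ x) = x :=
  hA.strictMonoOn.injOn (hA.g0_mem (hA.f_pos hx)) hx (hA.f_g0 (hA.f_pos hx))

lemma g0_strictMonoOn (hA : AssumptionA f₀) : StrictMonoOn (g0 f₀) (Ioi 0) := by
  intro u hu v hv huv
  rw [← hA.strictMonoOn.lt_iff_lt (hA.g0_mem hu) (hA.g0_mem hv), hA.f_g0 hu, hA.f_g0 hv]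
  exact huv

lemma hasStrictDerivAt_g0_inv (hA : AssumptionA f₀) {u : ℝ} (hu : 0 < u) :
    HasStrictDerivAt (g0 f₀) (deriv f₀ (g0 f₀ u))⁻¹ u := by
  have hx := hA.g0_mem hu
  have h := ((hA.contDiffAt hx).hasStrictDerivAt two_ne_zero).to_local_left_inverse
    (by linarith [hA.one_lt_deriv _ hx]) (g := g0 f₀)
    (by filter_upwards [isOpen_Ioo.mem_nhds hx] with y hy using hA.g0_f hy)
  rwa [hA.f_g0 hu] at h

lemma deriv_g0 (hA : AssumptionA f₀) {u : ℝ} (hu : 0 < u) :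
    deriv (g0 f₀) u = (deriv f₀ (g0 f₀ u))⁻¹ := (hA.hasStrictDerivAt_g0_inv hu).hasDerivAt.deriv

lemma hasStrictDerivAt_g0 (hA : AssumptionA f₀) {u : ℝ} (hu : 0 < u) :
    HasStrictDerivAt (g0 f₀) (deriv (g0 f₀) u) u := by
  rw [hA.deriv_g0 hu]; exact hA.hasStrictDerivAt_g0_inv hu

lemma deriv_g0_pos (hA : AssumptionA f₀) {u : ℝ} (hu : 0 < u) : 0 < deriv (g0 f₀) u := by
  rw [hA.deriv_g0 hu]
  exact inv_pos.2 (by linarith [hA.one_lt_deriv _ (hA.g0_mem hu)])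

lemma deriv_g0_lt_one (hA : AssumptionA f₀) {u : ℝ} (hu : 0 < u) : deriv (g0 f₀) u < 1 := by
  rw [hA.deriv_g0 hu]
  exact inv_lt_one_of_one_lt₀ (hA.one_lt_deriv _ (hA.g0_mem hu))

lemma differentiableAt_deriv (hA : AssumptionA f₀) {x : ℝ} (hx : x ∈ Ioo (0 : ℝ) 1) :
    DifferentiableAt ℝ (deriv f₀) x := by
  have h : ContDiffOn ℝ 1 (deriv f₀) (Ioo 0 1) :=
    (contDiffOn_succ_iff_deriv_of_isOpen (n := 1) isOpen_Ioo).1 hA.contDiffOn |>.2.2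
  exact (h.differentiableOn one_ne_zero).differentiableAt (isOpen_Ioo.mem_nhds hx)

lemma deriv_strictMonoOn (hA : AssumptionA f₀) : StrictMonoOn (deriv f₀) (Ioo 0 1) := by
  refine strictMonoOn_of_deriv_pos (convex_Ioo 0 1)
    (fun x hx => (hA.differentiableAt_deriv hx).continuousAt.continuousWithinAt) fun x hx => ?_
  rw [interior_Ioo] at hx
  exact hA.deriv2_pos x hx

lemma deriv_g0_anti (hA : AssumptionA f₀) {u v : ℝ} (hu : 0 < u) (huv : u ≤ v) :
    deriv (g0 f₀) v ≤ deriv (g0 f₀) u := by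
  have hv : 0 < v := hu.trans_le huv
  rw [hA.deriv_g0 hu, hA.deriv_g0 hv]
  have h1 := hA.one_lt_deriv _ (hA.g0_mem hu)
  exact inv_anti₀ (by linarith) (hA.deriv_strictMonoOn.monotoneOn (hA.g0_mem hu) (hA.g0_mem hv)
    (hA.g0_strictMonoOn.monotoneOn hu hv huv))

/-- Adler's condition gives bounded distortion of `g₀`. -/
lemma exists_distortion (hA : AssumptionA f₀) : ∃ K : ℝ, 0 < K ∧ ∀ u v : ℝ, 0 < u → 0 < v →
    deriv (g0 f₀) v ≤ Real.exp (K * |u - v|) * deriv (g0 f₀) u := by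
  obtain ⟨K, hK⟩ := hA.adler
  -- The derivative of log f₀'(g₀(w)) is f₀''/(f₀')² at g₀(w), the quantity bounded in (A6), and log
  -- g₀' = -log f₀' ∘ g₀. The maximum with 1 only ensures a positive constant.
  refine ⟨max K 1, by positivity, fun u v hu hv => ?_⟩
  have hd : ∀ w ∈ Ioi (0 : ℝ), HasDerivWithinAt (fun w => Real.log (deriv f₀ (g0 f₀ w)))
      (deriv (deriv f₀) (g0 f₀ w) * (deriv f₀ (g0 f₀ w))⁻¹ / deriv f₀ (g0 f₀ w)) (Ioi 0) w := by
    intro w hw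
    have hx := hA.g0_mem hw
    have h1 := hA.one_lt_deriv _ hx
    exact (((hA.differentiableAt_deriv hx).hasDerivAt.comp w
      (hA.hasStrictDerivAt_g0_inv hw).hasDerivAt).log (by simp only [Function.comp]; linarith)).hasDerivWithinAt
  have hb : ∀ w ∈ Ioi (0 : ℝ), ‖deriv (deriv f₀) (g0 f₀ w) * (deriv f₀ (g0 f₀ w))⁻¹ /
      deriv f₀ (g0 f₀ w)‖ ≤ max K 1 := by
    intro w hw
    have hx := hA.g0_mem hw
    have h1 := hA.one_lt_deriv _ hx
    have h2 := hA.deriv2_pos _ hx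
    have h3 : deriv (deriv f₀) (g0 f₀ w) / (deriv f₀ (g0 f₀ w)) ^ 2 ≤ K :=
      hK (mem_image_of_mem _ hx)
    have h4 : deriv (deriv f₀) (g0 f₀ w) * (deriv f₀ (g0 f₀ w))⁻¹ / deriv f₀ (g0 f₀ w) =
      deriv (deriv f₀) (g0 f₀ w) / (deriv f₀ (g0 f₀ w)) ^ 2 := by field_simp
    rw [h4, Real.norm_of_nonneg (by positivity)]
    exact h3.trans (le_max_left _ _)
  have h := (convex_Ioi (0 : ℝ)).norm_image_sub_le_of_norm_hasDerivWithin_le hd hb hv hu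
  have h1 := hA.one_lt_deriv _ (hA.g0_mem hu)
  have h2 := hA.one_lt_deriv _ (hA.g0_mem hv)
  rw [hA.deriv_g0 hu, hA.deriv_g0 hv, ← Real.exp_log (show 0 < (deriv f₀ (g0 f₀ u))⁻¹ by positivity),
    ← Real.exp_log (show 0 < (deriv f₀ (g0 f₀ v))⁻¹ by positivity), ← Real.exp_add,
    Real.exp_le_exp, Real.log_inv, Real.log_inv]
  rw [Real.norm_eq_abs, Real.norm_eq_abs] at h
  linarith [le_abs_self (Real.log (deriv f₀ (g0 f₀ u)) - Real.log (deriv f₀ (g0 f₀ v)))]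

lemma g0_one_lt_one (hA : AssumptionA f₀) : g0 f₀ 1 < 1 := hA.g0_lt_one one_pos

/-! ### Iterates of `g₀` -/

lemma iter_pos (hA : AssumptionA f₀) (n : ℕ) {u : ℝ} (hu : 0 < u) : 0 < (g0 f₀)^[n] u := by
  induction n with
  | zero => exact hu
  | succ n ih => rw [Function.iterate_succ_apply']; exact hA.g0_pos ih

lemma iter_strictMonoOn (hA : AssumptionA f₀) (n : ℕ) : StrictMonoOn ((g0 f₀)^[n]) (Ioi 0) := by
  induction n with
  | zero => exact strictMono_id.strictMonoOn _
  | succ n ih =>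
    intro u hu v hv huv
    rw [Function.iterate_succ_apply', Function.iterate_succ_apply']
    exact hA.g0_strictMonoOn (hA.iter_pos n hu) (hA.iter_pos n hv) (ih hu hv huv)

lemma iter_lt_one (hA : AssumptionA f₀) (n : ℕ) {u : ℝ} (hu : 0 < u) : (g0 f₀)^[n + 1] u < 1 := by
  rw [Function.iterate_succ_apply']; exact hA.g0_lt_one (hA.iter_pos n hu)

lemma hasStrictDerivAt_iter (hA : AssumptionA f₀) (n : ℕ) {u : ℝ} (hu : 0 < u) :
    HasStrictDerivAt ((g0 f₀)^[n]) (∏ i ∈ Finset.range n, deriv (g0 f₀) ((g0 f₀)^[i] u)) u := by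
  induction n with
  | zero => simpa using hasStrictDerivAt_id u
  | succ n ih =>
    rw [Finset.prod_range_succ, mul_comm, Function.iterate_succ']
    exact (hA.hasStrictDerivAt_g0 (hA.iter_pos n hu)).comp u ih

/-- The orbit of `1` under `g₀` decreases to `0`. -/
lemma iter_one_anti (hA : AssumptionA f₀) (n : ℕ) : (g0 f₀)^[n + 1] 1 < (g0 f₀)^[n] 1 := by
  rw [Function.iterate_succ_apply]
  exact hA.iter_strictMonoOn n (hA.g0_pos one_pos) (mem_Ioi.2 one_pos) hA.g0_one_lt_one

/-- Since f₀' > 1, the function f₀(y) - y is strictly increasing, and it tends to 0 at 0. Comparing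
with the point x/2 makes the inequality strict. -/
lemma f_gt (hA : AssumptionA f₀) {x : ℝ} (hx : x ∈ Ioo (0 : ℝ) 1) : x < f₀ x := by
  by_contra! hcon
  have hx2 : x / 2 ∈ Ioo (0 : ℝ) 1 := ⟨by linarith [hx.1], by linarith [hx.1, hx.2]⟩
  have hmono : StrictMonoOn (fun y => f₀ y - y) (Ioo 0 1) := by
    refine strictMonoOn_of_deriv_pos (convex_Ioo 0 1)
      (hA.contDiffOn.continuousOn.sub continuousOn_id) fun y hy => ?_
    rw [interior_Ioo] at hy
    have h1 := ((hA.contDiffAt hy).differentiableAt two_ne_zero).hasDerivAt.sub (hasDerivAt_id y)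
    have h2 := h1.deriv
    have h3 := hA.one_lt_deriv y hy
    have h4 : deriv (fun y => f₀ y - y) y = deriv f₀ y - 1 := h2
    linarith
  have h1 : f₀ (x / 2) - x / 2 < f₀ x - x := hmono hx2 hx (by linarith [hx.1])
  have h2 : 0 ≤ f₀ (x / 2) - x / 2 := by
    refine le_of_tendsto (hA.tendsto_zero.sub
      (tendsto_id.mono_left nhdsWithin_le_nhds : Tendsto id (𝓝[>] (0 : ℝ)) (𝓝 0)) |>.congr
        (fun _ => rfl) |>.trans (by simp)) ?_
    filter_upwards [Ioo_mem_nhdsGT hx2.1] with y hy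
    exact (hmono ⟨hy.1, hy.2.trans hx2.2⟩ hx2 hy.2).le
  linarith

/-- A positive limit of the decreasing orbit would be a fixed point of g₀, which `f_gt` excludes. -/
lemma tendsto_iter_one (hA : AssumptionA f₀) : Tendsto (fun n => (g0 f₀)^[n] 1) atTop (𝓝 0) := by
  have hanti : Antitone (fun n => (g0 f₀)^[n] 1) := antitone_nat_of_succ_le fun n => (hA.iter_one_anti n).le
  have hbdd : BddBelow (range fun n => (g0 f₀)^[n] 1) :=
    ⟨0, by rintro _ ⟨n, rfl⟩; exact (hA.iter_pos n one_pos).le⟩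
  have hlim := tendsto_atTop_ciInf hanti hbdd
  set c := ⨅ n, (g0 f₀)^[n] 1
  have hc0 : 0 ≤ c := le_ciInf fun n => (hA.iter_pos n one_pos).le
  rcases hc0.eq_or_lt with h | h
  · rwa [← h] at hlim
  · exfalso
    have h1 : Tendsto (fun n => (g0 f₀)^[n + 1] 1) atTop (𝓝 (g0 f₀ c)) := by
      simp_rw [Function.iterate_succ_apply']
      exact (hA.hasStrictDerivAt_g0 h).hasDerivAt.continuousAt.tendsto.comp hlim
    have h2 := tendsto_nhds_unique h1 (hlim.comp (tendsto_add_atTop_nat 1))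
    have h3 := hA.f_gt (hA.g0_mem h)
    rw [hA.f_g0 h] at h3
    linarith

lemma exists_iter_one_le (hA : AssumptionA f₀) {v : ℝ} (hv : 0 < v) : ∃ n, (g0 f₀)^[n] 1 ≤ v :=
  ((hA.tendsto_iter_one.eventually (gt_mem_nhds hv)).exists).imp fun _ h => le_of_lt h

end AssumptionA

/-! ### Branches of the induced maps -/

/-- The interval `(g₀(1), 1)` on which the induced map `F̂` acts. -/
def baseI (f₀ : ℝ → ℝ) : Set ℝ := Ioo (g0 f₀ 1) 1

/-- The inverse branch of `F̂` with image `J_{k+2}^{j+1}`, for `i = (k, j)`. -/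
def invBranch (f₀ : ℝ → ℝ) (i : ℕ × ℕ) (z : ℝ) : ℝ := g0 f₀ (i.1 + 1 + (g0 f₀)^[i.2] z)

/-- The derivative of `invBranch`. -/
def invBranchDeriv (f₀ : ℝ → ℝ) (i : ℕ × ℕ) (z : ℝ) : ℝ :=
  deriv (g0 f₀) (i.1 + 1 + (g0 f₀)^[i.2] z) * ∏ j ∈ Finset.range i.2, deriv (g0 f₀) ((g0 f₀)^[j] z)

/-- The fibre map of `P̂` over `J_{k+2}^{j+1}`, for `i = (k, j)`. -/
def fibreBranch (f₀ : ℝ → ℝ) (i : ℕ × ℕ) (y : ℝ) : ℝ := (g0 f₀)^[i.2] (i.1 + 1 + g0 f₀ y)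

lemma fst_baseP_iterate (n : ℕ) (p : ℝ × ℝ) : ((baseP f₀)^[n] p).1 = (baseF f₀)^[n] p.1 :=
  (Function.Semiconj.iterate_right (f := Prod.fst) (ga := baseP f₀) (gb := baseF f₀)
    (fun _ => rfl) n) p

lemma fst_indP (p : ℝ × ℝ) : (indP f₀ p).1 = indF f₀ p.1 := fst_baseP_iterate _ _

lemma fst_indP_iterate (n : ℕ) (p : ℝ × ℝ) : ((indP f₀)^[n] p).1 = (indF f₀)^[n] p.1 :=
  (Function.Semiconj.iterate_right (f := Prod.fst) (ga := indP f₀) (gb := indF f₀)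
    fst_indP n) p

lemma fst_hatP (p : ℝ × ℝ) : (hatP f₀ p).1 = hatF f₀ p.1 := fst_indP_iterate _ _

lemma fst_tildeP (p : ℝ × ℝ) : (tildeP f₀ p).1 = tildeF f₀ p.1 := by
  rw [tildeP, fst_hatP, fst_hatP, tildeF]

lemma fst_tildeP_iterate (n : ℕ) (p : ℝ × ℝ) : ((tildeP f₀)^[n] p).1 = (tildeF f₀)^[n] p.1 :=
  (Function.Semiconj.iterate_right (f := Prod.fst) (ga := tildeP f₀) (gb := tildeF f₀)
    fst_tildeP n) p

lemma sInf_eq_of_mem_of_le {s : Set ℕ} {k : ℕ} (hk : k ∈ s) (h : ∀ j ∈ s, k ≤ j) : sInf s = k :=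
  IsLeast.csInf_eq ⟨hk, h⟩

namespace AssumptionA

lemma baseP_of_lt_one (hA : AssumptionA f₀) {u : ℝ} (hu : 0 < u) (y : ℝ) :
    baseP f₀ (g0 f₀ u, y) = (u, g0 f₀ y) := by
  have hx := hA.g0_mem hu
  simp only [baseP, baseF, fibreG, if_pos hx, hA.f_g0 hu]

lemma baseP_of_one_lt {u : ℝ} (hu : 1 < u) (y : ℝ) : baseP f₀ (u, y) = (u - 1, y + 1) := by
  have hx : u ∉ Ioo (0 : ℝ) 1 := fun h => absurd h.2 hu.not_gt
  simp only [baseP, baseF, fibreG, if_neg hx, if_pos hu]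

/-- The first step applies f₀ to x and g₀ to y; each later one lowers x by 1 and raises y by 1 until
x falls below 1. -/
lemma baseP_iterate (hA : AssumptionA f₀) {n : ℕ} {v : ℝ} (hv : 0 < v) (y : ℝ) {i : ℕ}
    (hi : i ≤ n) : (baseP f₀)^[i + 1] (g0 f₀ (n + v), y) = ((n - i : ℕ) + v, g0 f₀ y + i) := by
  induction i with
  | zero => simp [hA.baseP_of_lt_one (show 0 < (n : ℝ) + v by positivity)]
  | succ i ih =>
    rw [Function.iterate_succ_apply', ih (by omega)]
    have h1 : ((n - i : ℕ) : ℝ) = (n - (i + 1) : ℕ) + 1 := by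
      rw [← Nat.cast_succ]; congr 1; omega
    rw [baseP_of_one_lt]
    · rw [h1]; push_cast; ext <;> ring
    · rw [h1]; linarith [Nat.cast_nonneg (α := ℝ) (n - (i + 1))]

lemma tau_eq (hA : AssumptionA f₀) (n : ℕ) {v : ℝ} (hv : v ∈ Ioo (0 : ℝ) 1) :
    tau f₀ (g0 f₀ (n + v)) = n + 1 := by
  refine sInf_eq_of_mem_of_le ⟨by omega, ?_⟩ ?_
  · rw [← fst_baseP_iterate _ (g0 f₀ (n + v), 0), hA.baseP_iterate hv.1 0 le_rfl]
    simpa using hv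
  · rintro j ⟨hj, hmem⟩
    by_contra! hlt
    obtain ⟨i, rfl⟩ : ∃ i, j = i + 1 := ⟨j - 1, by omega⟩
    rw [← fst_baseP_iterate _ (g0 f₀ (n + v), 0), hA.baseP_iterate hv.1 0 (by omega)] at hmem
    have h1 : (1 : ℝ) ≤ (n - i : ℕ) := by exact_mod_cast (by omega : 1 ≤ n - i)
    linarith [hmem.2, hv.1]

lemma indP_eq (hA : AssumptionA f₀) (n : ℕ) {v : ℝ} (hv : v ∈ Ioo (0 : ℝ) 1) (y : ℝ) :
    indP f₀ (g0 f₀ (n + v), y) = (v, g0 f₀ y + n) := by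
  rw [indP, hA.tau_eq n hv, hA.baseP_iterate hv.1 y le_rfl]; simp

lemma indP_g0 (hA : AssumptionA f₀) {v : ℝ} (hv : v ∈ Ioo (0 : ℝ) 1) (y : ℝ) :
    indP f₀ (g0 f₀ v, y) = (v, g0 f₀ y) := by
  have h := hA.indP_eq 0 hv y
  simpa using h

lemma pos_of_mem_baseI (hA : AssumptionA f₀) {z : ℝ} (hz : z ∈ baseI f₀) : 0 < z :=
  (hA.g0_pos one_pos).trans hz.1

lemma iter_mem (hA : AssumptionA f₀) {z : ℝ} (hz : z ∈ baseI f₀) (j : ℕ) :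
    (g0 f₀)^[j] z ∈ Ioo (0 : ℝ) 1 := by
  refine ⟨hA.iter_pos j (hA.pos_of_mem_baseI hz), ?_⟩
  cases j with
  | zero => exact hz.2
  | succ j => exact hA.iter_lt_one j (hA.pos_of_mem_baseI hz)

lemma iter_succ_notMem (hA : AssumptionA f₀) {z : ℝ} (hz : z ∈ baseI f₀) (j : ℕ) :
    (g0 f₀)^[j + 1] z ∉ baseI f₀ := by
  intro h
  rw [Function.iterate_succ_apply'] at h
  have h1 := hA.iter_mem hz j
  exact absurd h.1 (hA.g0_strictMonoOn h1.1 (mem_Ioi.2 one_pos) h1.2).not_gt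

/-- The first application of P removes the translation block. Every later one stays in (0,1): it
undoes one g₀ in x and adds one g₀ in y, which is why the fibre map carries the iterates of g₀
outside. -/
lemma indP_iterate (hA : AssumptionA f₀) (i : ℕ × ℕ) {z : ℝ} (hz : z ∈ baseI f₀) (y : ℝ) {n : ℕ}
    (hn : n ≤ i.2) : (indP f₀)^[n + 1] (invBranch f₀ i z, y) =
      ((g0 f₀)^[i.2 - n] z, (g0 f₀)^[n] (i.1 + 1 + g0 f₀ y)) := by
  induction n with
  | zero =>
    have h := hA.indP_eq (i.1 + 1) (hA.iter_mem hz i.2) y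
    push_cast at h
    change indP f₀ (g0 f₀ _, y) = _
    rw [h]; ext <;> simp [add_comm]
  | succ n ih =>
    rw [Function.iterate_succ_apply', ih (by omega)]
    have h1 : i.2 - n = (i.2 - (n + 1)) + 1 := by omega
    rw [h1, Function.iterate_succ_apply', hA.indP_g0 (hA.iter_mem hz _),
      Function.iterate_succ_apply']

lemma kappa_eq (hA : AssumptionA f₀) (i : ℕ × ℕ) {z : ℝ} (hz : z ∈ baseI f₀) :
    kappa f₀ (invBranch f₀ i z) = i.2 + 1 := by
  refine sInf_eq_of_mem_of_le ⟨by omega, ?_⟩ ?_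
  · rw [← fst_indP_iterate _ (invBranch f₀ i z, 0), hA.indP_iterate i hz 0 le_rfl]
    simpa [baseI] using hz
  · rintro j ⟨hj, hmem⟩
    by_contra! hlt
    obtain ⟨n, rfl⟩ : ∃ i, j = i + 1 := ⟨j - 1, by omega⟩
    rw [← fst_indP_iterate _ (invBranch f₀ i z, 0), hA.indP_iterate i hz 0 (by omega)] at hmem
    have h1 : i.2 - n = (i.2 - (n + 1)) + 1 := by omega
    rw [h1] at hmem
    exact hA.iter_succ_notMem hz _ hmem

lemma hatP_eq (hA : AssumptionA f₀) (i : ℕ × ℕ) {z : ℝ} (hz : z ∈ baseI f₀) (y : ℝ) :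
    hatP f₀ (invBranch f₀ i z, y) = (z, fibreBranch f₀ i y) := by
  rw [hatP, hA.kappa_eq i hz, hA.indP_iterate i hz y le_rfl]; simp [fibreBranch]

lemma hatF_eq (hA : AssumptionA f₀) (i : ℕ × ℕ) {z : ℝ} (hz : z ∈ baseI f₀) :
    hatF f₀ (invBranch f₀ i z) = z := by
  rw [← fst_hatP (invBranch f₀ i z, 0), hA.hatP_eq i hz]

lemma baseP_iterate_late (hA : AssumptionA f₀) (i : ℕ × ℕ) {z : ℝ} (hz : z ∈ baseI f₀) (y : ℝ)
    {n : ℕ} (hn : n ≤ i.2) : (baseP f₀)^[i.1 + 2 + n] (invBranch f₀ i z, y) =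
      ((g0 f₀)^[i.2 - n] z, (g0 f₀)^[n] (i.1 + 1 + g0 f₀ y)) := by
  induction n with
  | zero =>
    have h := hA.baseP_iterate (n := i.1 + 1) (hA.iter_mem hz i.2).1 y le_rfl
    push_cast at h
    change (baseP f₀)^[i.1 + 1 + 1] (g0 f₀ _, y) = _
    rw [h]; ext <;> simp [add_comm]
  | succ n ih =>
    rw [← add_assoc, Function.iterate_succ_apply', ih (by omega)]
    have h1 : i.2 - n = (i.2 - (n + 1)) + 1 := by omega
    rw [h1, Function.iterate_succ_apply', hA.baseP_of_lt_one (hA.iter_mem hz _).1,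
      Function.iterate_succ_apply']

/-- `P̂` is the first return map of `𝒫` to `(g₀(1),1) × ℝ⁺`. -/
lemma baseP_return (hA : AssumptionA f₀) (i : ℕ × ℕ) {z : ℝ} (hz : z ∈ baseI f₀) (y : ℝ) :
    (baseP f₀)^[i.1 + 2 + i.2] (invBranch f₀ i z, y) = hatP f₀ (invBranch f₀ i z, y) := by
  rw [hA.baseP_iterate_late i hz y le_rfl, hA.hatP_eq i hz]; simp [fibreBranch]

/-- Intermediate points miss (g₀(1),1) for two reasons: in the translation block x exceeds 1, and
afterwards x is g₀ of a point of (0,1), hence below g₀(1). -/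
lemma baseP_no_return (hA : AssumptionA f₀) (i : ℕ × ℕ) {z : ℝ} (hz : z ∈ baseI f₀) (y : ℝ)
    {n : ℕ} (h1 : 1 ≤ n) (h2 : n < i.1 + 2 + i.2) :
    ((baseP f₀)^[n] (invBranch f₀ i z, y)).1 ∉ baseI f₀ := by
  rcases Nat.lt_or_ge n (i.1 + 2) with h | h
  · obtain ⟨m, rfl⟩ : ∃ m, n = m + 1 := ⟨n - 1, by omega⟩
    have h3 := hA.baseP_iterate (n := i.1 + 1) (i := m) (hA.iter_mem hz i.2).1 y (by omega)
    push_cast at h3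
    rw [invBranch, h3]
    intro hmem
    have h4 : (1 : ℝ) ≤ (i.1 + 1 - m : ℕ) := by exact_mod_cast (by omega : 1 ≤ i.1 + 1 - m)
    have h5 := hmem.2
    simp only at h5
    linarith [(hA.iter_mem hz i.2).1]
  · obtain ⟨m, rfl⟩ : ∃ m, n = i.1 + 2 + m := ⟨n - (i.1 + 2), by omega⟩
    rw [hA.baseP_iterate_late i hz y (by omega)]
    have h1 : i.2 - m = (i.2 - (m + 1)) + 1 := by omega
    rw [h1]
    exact hA.iter_succ_notMem hz _

/-! ### Geometry of the branches -/

lemma arg_pos (hA : AssumptionA f₀) (i : ℕ × ℕ) {z : ℝ} (hz : 0 < z) :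
    1 < (i.1 : ℝ) + 1 + (g0 f₀)^[i.2] z := by
  linarith [Nat.cast_nonneg (α := ℝ) i.1, hA.iter_pos i.2 hz]

lemma invBranch_mem (hA : AssumptionA f₀) (i : ℕ × ℕ) {z : ℝ} (hz : z ∈ baseI f₀) :
    invBranch f₀ i z ∈ baseI f₀ := by
  have h := hA.arg_pos i (hA.pos_of_mem_baseI hz)
  exact ⟨hA.g0_strictMonoOn (mem_Ioi.2 one_pos) (mem_Ioi.2 (one_pos.trans h)) h,
    hA.g0_lt_one (one_pos.trans h)⟩

lemma hasStrictDerivAt_invBranch (hA : AssumptionA f₀) (i : ℕ × ℕ) {z : ℝ} (hz : 0 < z) :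
    HasStrictDerivAt (invBranch f₀ i) (invBranchDeriv f₀ i z) z :=
  (hA.hasStrictDerivAt_g0 (one_pos.trans (hA.arg_pos i hz))).comp z
    ((hA.hasStrictDerivAt_iter i.2 hz).const_add _)

lemma invBranchDeriv_pos (hA : AssumptionA f₀) (i : ℕ × ℕ) {z : ℝ} (hz : 0 < z) :
    0 < invBranchDeriv f₀ i z :=
  mul_pos (hA.deriv_g0_pos (one_pos.trans (hA.arg_pos i hz)))
    (Finset.prod_pos fun j _ => hA.deriv_g0_pos (hA.iter_pos j hz))

lemma injOn_invBranch (hA : AssumptionA f₀) (i : ℕ × ℕ) : InjOn (invBranch f₀ i) (baseI f₀) := by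
  intro z hz w hw h
  rw [← hA.hatF_eq i hz, ← hA.hatF_eq i hw, h]

/-- The return times recover the branch: κ gives the second index and τ the first. -/
lemma invBranch_index (hA : AssumptionA f₀) {i i' : ℕ × ℕ} {z z' : ℝ} (hz : z ∈ baseI f₀)
    (hz' : z' ∈ baseI f₀) (h : invBranch f₀ i z = invBranch f₀ i' z') : i = i' := by
  have h1 := hA.kappa_eq i hz
  rw [h, hA.kappa_eq i' hz'] at h1
  have h2 := hA.tau_eq (i.1 + 1) (hA.iter_mem hz i.2)
  have h3 := hA.tau_eq (i'.1 + 1) (hA.iter_mem hz' i'.2)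
  push_cast at h2 h3
  rw [invBranch, invBranch] at h
  rw [h, h3] at h2
  ext <;> omega

lemma pairwise_disjoint_image (hA : AssumptionA f₀) :
    Pairwise (Function.onFun Disjoint fun i => invBranch f₀ i '' baseI f₀) := by
  intro i i' hne
  rw [Function.onFun, Set.disjoint_left]
  rintro _ ⟨z, hz, rfl⟩ ⟨z', hz', h⟩
  exact hne (hA.invBranch_index hz hz' h.symm)

lemma isOpen_baseI : IsOpen (baseI f₀) := isOpen_Ioo

lemma exists_iter_eq (hA : AssumptionA f₀) (j : ℕ) {v : ℝ}
    (hv : v ∈ Ioo ((g0 f₀)^[j + 1] 1) ((g0 f₀)^[j] 1)) : ∃ z ∈ baseI f₀, (g0 f₀)^[j] z = v := by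
  have hc : ContinuousOn ((g0 f₀)^[j]) (Icc (g0 f₀ 1) 1) := fun z hz =>
    (hA.hasStrictDerivAt_iter j ((hA.g0_pos one_pos).trans_le hz.1)).hasDerivAt.continuousAt.continuousWithinAt
  rw [Function.iterate_succ_apply] at hv
  exact intermediate_value_Ioo hA.g0_one_lt_one.le hc hv

lemma intervalJ_eq (hA : AssumptionA f₀) (k j : ℕ) :
    intervalJ f₀ (k + 2) (j + 1) = invBranch f₀ (k, j) '' baseI f₀ := by
  have hk : (0 : ℝ) ≤ k := k.cast_nonneg
  ext x
  constructor
  · rintro ⟨hxI, hxF⟩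
    obtain ⟨h1, h2⟩ := hxI
    have e1 : ((k + 2 : ℕ) : ℝ) - 1 = k + 1 := by push_cast; ring
    have e2 : ((k + 2 : ℕ) : ℝ) = k + 2 := by push_cast; ring
    rw [e1] at h1
    rw [e2] at h2
    have hx : x ∈ Ioo (0 : ℝ) 1 := ⟨(hA.g0_pos (by positivity)).trans h1,
      h2.trans (hA.g0_lt_one (by positivity))⟩
    have h3 := hA.strictMonoOn (hA.g0_mem (by positivity)) hx h1
    have h4 := hA.strictMonoOn hx (hA.g0_mem (by positivity)) h2
    rw [hA.f_g0 (by positivity)] at h3 h4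
    have hv : f₀ x - (k + 1) ∈ Ioo (0 : ℝ) 1 := ⟨by linarith, by linarith⟩
    have hxe : g0 f₀ ((k + 1 : ℕ) + (f₀ x - (k + 1))) = x := by
      rw [show ((k + 1 : ℕ) : ℝ) + (f₀ x - (k + 1)) = f₀ x by push_cast; ring, hA.g0_f hx]
    have hind : indF f₀ x = f₀ x - (k + 1) := by
      have := congrArg Prod.fst (hA.indP_eq (k + 1) hv 0)
      rwa [fst_indP, hxe] at this
    rw [mem_preimage, hind, Nat.add_sub_cancel] at hxF
    obtain ⟨z, hz, hzv⟩ := hA.exists_iter_eq j hxF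
    refine ⟨z, hz, ?_⟩
    rw [invBranch, hzv, show (k : ℝ) + 1 + (f₀ x - (k + 1)) = f₀ x by ring, hA.g0_f hx]
  · rintro ⟨z, hz, rfl⟩
    have hv := hA.iter_mem hz j
    refine ⟨⟨?_, ?_⟩, ?_⟩
    · refine hA.g0_strictMonoOn (mem_Ioi.2 ?_) (mem_Ioi.2 ?_) ?_ <;> push_cast <;> linarith [hv.1]
    · refine hA.g0_strictMonoOn (mem_Ioi.2 ?_) (mem_Ioi.2 ?_) ?_ <;> push_cast <;> linarith [hv.1, hv.2]
    · have hind := congrArg Prod.fst (hA.indP_eq (k + 1) hv 0)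
      push_cast at hind
      rw [fst_indP] at hind
      rw [mem_preimage, invBranch, hind, Nat.add_sub_cancel]
      refine ⟨?_, hA.iter_strictMonoOn j (hA.pos_of_mem_baseI hz) (mem_Ioi.2 one_pos) hz.2⟩
      rw [Function.iterate_succ_apply]
      exact hA.iter_strictMonoOn j (hA.g0_pos one_pos) (hA.pos_of_mem_baseI hz) hz.1

lemma tildeDelta_eq (hA : AssumptionA f₀) : tildeDelta f₀ =
    {x | ∃ i i' : ℕ × ℕ, ∃ z ∈ baseI f₀, invBranch f₀ i (invBranch f₀ i' z) = x} := by
  ext x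
  constructor
  · rintro ⟨s₀, s₁, q₀, q₁, h1, h2, h3, h4, h5, h6⟩
    obtain ⟨k, rfl⟩ : ∃ k, s₀ = k + 2 := ⟨s₀ - 2, by omega⟩
    obtain ⟨k', rfl⟩ : ∃ k, s₁ = k + 2 := ⟨s₁ - 2, by omega⟩
    obtain ⟨j, rfl⟩ : ∃ k, q₀ = k + 1 := ⟨q₀ - 1, by omega⟩
    obtain ⟨j', rfl⟩ : ∃ k, q₁ = k + 1 := ⟨q₁ - 1, by omega⟩
    rw [hA.intervalJ_eq] at h5
    rw [hA.intervalJ_eq] at h6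
    obtain ⟨z, hz, rfl⟩ := h5
    rw [mem_preimage, hA.hatF_eq _ hz] at h6
    obtain ⟨w, hw, rfl⟩ := h6
    exact ⟨(k, j), (k', j'), w, hw, rfl⟩
  · rintro ⟨⟨k, j⟩, ⟨k', j'⟩, z, hz, rfl⟩
    refine ⟨k + 2, k' + 2, j + 1, j' + 1, by omega, by omega, by omega, by omega, ?_, ?_⟩
    · rw [hA.intervalJ_eq]; exact mem_image_of_mem _ (hA.invBranch_mem _ hz)
    · rw [mem_preimage, hA.hatF_eq _ (hA.invBranch_mem _ hz), hA.intervalJ_eq]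
      exact mem_image_of_mem _ hz

lemma exists_iter_eq' (hA : AssumptionA f₀) {v : ℝ} (hv : v ∈ Ioo (0 : ℝ) 1) :
    ∃ j, ∃ z ∈ Ico (g0 f₀ 1) 1, (g0 f₀)^[j] z = v := by
  classical
  have hex := hA.exists_iter_one_le hv.1
  have hne : Nat.find hex ≠ 0 := by
    intro h
    have := Nat.find_spec hex
    rw [h] at this
    exact absurd hv.2 (not_lt.2 this)
  obtain ⟨j, hj⟩ := Nat.exists_eq_succ_of_ne_zero hne
  have h1 := Nat.find_spec hex
  have h2 := not_le.1 (Nat.find_min hex (m := j) (by omega))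
  rw [hj] at h1
  rcases h1.eq_or_lt with h | h
  · exact ⟨j, g0 f₀ 1, ⟨le_rfl, hA.g0_one_lt_one⟩, by rw [← h, Nat.succ_eq_add_one, Function.iterate_succ_apply]⟩
  · obtain ⟨z, hz, h3⟩ := hA.exists_iter_eq j ⟨h, h2⟩
    exact ⟨j, z, ⟨hz.1.le, hz.2⟩, h3⟩

/-- The branch images cover `(g₀(1), 1)` up to a countable set. -/
lemma exists_countable_cover (hA : AssumptionA f₀) : ∃ N : Set ℝ, N.Countable ∧
    baseI f₀ ⊆ (⋃ i, invBranch f₀ i '' baseI f₀) ∪ N := by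
  -- The exceptional points are those where f₀(x) is an integer, and the branch images of the left
  -- endpoint g₀(1).
  refine ⟨(range fun k : ℕ => g0 f₀ (k + 1)) ∪ range (fun i : ℕ × ℕ => invBranch f₀ i (g0 f₀ 1)),
    (countable_range _).union (countable_range _), fun x hx => ?_⟩
  have hx01 : x ∈ Ioo (0 : ℝ) 1 := ⟨hA.pos_of_mem_baseI hx, hx.2⟩
  have h1 := hA.strictMonoOn (hA.g0_mem one_pos) hx01 hx.1
  rw [hA.f_g0 one_pos] at h1
  obtain ⟨k, hk⟩ : ∃ k : ℕ, ⌊f₀ x⌋₊ = k + 1 :=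
    Nat.exists_eq_succ_of_ne_zero (Nat.floor_pos.2 h1.le).ne'
  have h2 := Nat.floor_le (zero_le_one.trans h1.le)
  have h3 := Nat.lt_floor_add_one (f₀ x)
  rw [hk] at h2 h3
  push_cast at h2 h3
  rcases h2.eq_or_lt with h | h
  · right; left
    exact ⟨k, by simp only; rw [h, hA.g0_f hx01]⟩
  · obtain ⟨j, z, hz, hzv⟩ := hA.exists_iter_eq' (v := f₀ x - (k + 1)) ⟨by linarith, by linarith⟩
    have h4 : invBranch f₀ (k, j) z = x := by
      simp only [invBranch]
      rw [hzv, show (k : ℝ) + 1 + (f₀ x - (k + 1)) = f₀ x by ring, hA.g0_f hx01]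
    rcases hz.1.eq_or_lt with h5 | h5
    · right; right; exact ⟨(k, j), by simp only; rw [h5, h4]⟩
    · left; exact mem_iUnion.2 ⟨(k, j), z, ⟨h5, hz.2⟩, h4⟩

lemma tildeP_eq (hA : AssumptionA f₀) (i i' : ℕ × ℕ) {z : ℝ} (hz : z ∈ baseI f₀) (y : ℝ) :
    tildeP f₀ (invBranch f₀ i (invBranch f₀ i' z), y) =
      (z, fibreBranch f₀ i' (fibreBranch f₀ i y)) := by
  rw [tildeP, hA.hatP_eq i (hA.invBranch_mem i' hz), hA.hatP_eq i' hz]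

lemma tildeF_eq (hA : AssumptionA f₀) (i i' : ℕ × ℕ) {z : ℝ} (hz : z ∈ baseI f₀) :
    tildeF f₀ (invBranch f₀ i (invBranch f₀ i' z)) = z := by
  rw [tildeF, hA.hatF_eq i (hA.invBranch_mem i' hz), hA.hatF_eq i' hz]

end AssumptionA

/-! ### Estimates on the branches -/

/-- The bound `g₀'(k+1)` for the contraction along the translation part of a branch. -/
def transBound (f₀ : ℝ → ℝ) (k : ℕ) : ℝ := deriv (g0 f₀) (k + 1)

/-- The bound `∏_{i=1}^{j} g₀'(g₀^i(1))` for the contraction near the neutral fixed point. -/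
def neutralBound (f₀ : ℝ → ℝ) (j : ℕ) : ℝ := ∏ i ∈ Finset.range j, deriv (g0 f₀) ((g0 f₀)^[i + 1] 1)

/-- The bound on the derivative of an inverse branch of `F̂`. -/
def branchBound (f₀ : ℝ → ℝ) (i : ℕ × ℕ) : ℝ := transBound f₀ i.1 * neutralBound f₀ i.2

/-- The derivative of `fibreBranch`. -/
def fibreDeriv (f₀ : ℝ → ℝ) (i : ℕ × ℕ) (y : ℝ) : ℝ :=
  (∏ n ∈ Finset.range i.2, deriv (g0 f₀) ((g0 f₀)^[n] (i.1 + 1 + g0 f₀ y))) * deriv (g0 f₀) y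

namespace AssumptionA

lemma transBound_pos (hA : AssumptionA f₀) (k : ℕ) : 0 < transBound f₀ k :=
  hA.deriv_g0_pos (by positivity)

lemma transBound_le_one (hA : AssumptionA f₀) (k : ℕ) : transBound f₀ k ≤ 1 :=
  (hA.deriv_g0_lt_one (by positivity)).le

lemma neutralBound_pos (hA : AssumptionA f₀) (j : ℕ) : 0 < neutralBound f₀ j :=
  Finset.prod_pos fun _ _ => hA.deriv_g0_pos (hA.iter_pos _ one_pos)

lemma neutralBound_succ_le (hA : AssumptionA f₀) (j : ℕ) :
    neutralBound f₀ (j + 1) ≤ neutralBound f₀ j := by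
  rw [neutralBound, Finset.prod_range_succ]
  exact mul_le_of_le_one_right (hA.neutralBound_pos j).le (hA.deriv_g0_lt_one (hA.iter_pos _ one_pos)).le

lemma neutralBound_le_one (hA : AssumptionA f₀) (j : ℕ) : neutralBound f₀ j ≤ 1 :=
  Finset.prod_le_one (fun _ _ => (hA.deriv_g0_pos (hA.iter_pos _ one_pos)).le)
    fun _ _ => (hA.deriv_g0_lt_one (hA.iter_pos _ one_pos)).le

lemma branchBound_pos (hA : AssumptionA f₀) (i : ℕ × ℕ) : 0 < branchBound f₀ i :=
  mul_pos (hA.transBound_pos _) (hA.neutralBound_pos _)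

lemma branchBound_le_one (hA : AssumptionA f₀) (i : ℕ × ℕ) : branchBound f₀ i ≤ 1 :=
  mul_le_one₀ (hA.transBound_le_one _) (hA.neutralBound_pos _).le (hA.neutralBound_le_one _)

lemma summable_rpow_of_le {a ω : ℕ → ℝ} {C σ σ' : ℝ} (ha : ∀ n, 0 < a n) (ha1 : ∀ n, a n ≤ 1)
    (hC : 0 < C) (hω : ∀ n, 0 < ω n) (hle : ∀ n, a n ≤ C * ω n) (hσ : σ' ≤ σ) (hσ1 : σ < 1)
    (hs : Summable fun n => ω n ^ (1 - σ)) : Summable fun n => a n ^ (1 - σ') := by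
  refine Summable.of_nonneg_of_le (fun n => Real.rpow_nonneg (ha n).le _) (fun n => ?_)
    (hs.mul_left (C ^ (1 - σ)))
  calc a n ^ (1 - σ') ≤ a n ^ (1 - σ) :=
        Real.rpow_le_rpow_of_exponent_ge (ha n) (ha1 n) (by linarith)
    _ ≤ (C * ω n) ^ (1 - σ) := Real.rpow_le_rpow (ha n).le (hle n) (by linarith)
    _ = C ^ (1 - σ) * ω n ^ (1 - σ) := Real.mul_rpow hC.le (hω n).le

lemma exists_summable (hA : AssumptionA f₀) (hB : AssumptionB f₀) : ∃ σ ∈ Ioo (0 : ℝ) 1,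
    Summable (fun k => transBound f₀ k ^ (1 - σ)) ∧ Summable (fun j => neutralBound f₀ j ^ (1 - σ)) := by
  obtain ⟨ω₁, ω₂, C₁, C₂, σ₁, σ₂, -, -, h1, h2, -, -, hC₁, hC₂, hσ₁, hσ₂, s1, s2, e1, e2⟩ := hB
  -- Both bounds are at most 1, so passing to the smaller σ raises the exponent 1 - σ and preserves
  -- summability.
  refine ⟨min σ₁ σ₂, ⟨lt_min hσ₁.1 hσ₂.1, (min_le_left _ _).trans_lt hσ₁.2⟩, ?_, ?_⟩
  · refine summable_rpow_of_le (ω := fun k => ω₁ (k + 2)) hA.transBound_pos hA.transBound_le_one hC₁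
      (fun n => (h1 _ (by omega)).1) (fun n => ?_) (min_le_left _ _) hσ₁.2
      ((summable_nat_add_iff 1).2 s1)
    have := e1 (n + 2) (by omega)
    rwa [show ((n + 2 : ℕ) : ℝ) - 1 = n + 1 by push_cast; ring] at this
  · refine summable_rpow_of_le (ω := fun j => ω₂ (j + 1)) hA.neutralBound_pos hA.neutralBound_le_one
      hC₂ (fun n => (h2 _ (by omega)).1) (fun n => ?_) (min_le_right _ _) hσ₂.2 s2
    have := e2 (n + 1) (by omega)
    rw [Finset.prod_Ico_eq_prod_range] at this
    simpa [neutralBound, add_comm] using this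

lemma summable_neutralBound (hA : AssumptionA f₀) (hB : AssumptionB f₀) :
    Summable (neutralBound f₀) := by
  obtain ⟨σ, hσ, -, h⟩ := hA.exists_summable hB
  refine Summable.of_nonneg_of_le (fun n => (hA.neutralBound_pos n).le) (fun n => ?_) h
  calc neutralBound f₀ n = neutralBound f₀ n ^ (1 : ℝ) := (Real.rpow_one _).symm
    _ ≤ _ := Real.rpow_le_rpow_of_exponent_ge (hA.neutralBound_pos n) (hA.neutralBound_le_one n)
      (by linarith [hσ.1])

/-- As g₀' is decreasing, the worst case is the left endpoint g₀(1); this is the origin of the shift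
by one in `neutralBound`. -/
lemma prod_deriv_le_neutralBound (hA : AssumptionA f₀) (j : ℕ) {z : ℝ} (hz : z ∈ baseI f₀) :
    ∏ i ∈ Finset.range j, deriv (g0 f₀) ((g0 f₀)^[i] z) ≤ neutralBound f₀ j := by
  refine Finset.prod_le_prod (fun i _ => (hA.deriv_g0_pos (hA.iter_pos _ (hA.pos_of_mem_baseI hz))).le)
    fun i _ => hA.deriv_g0_anti (hA.iter_pos _ one_pos) ?_
  rw [Function.iterate_succ_apply]
  exact (hA.iter_strictMonoOn i (hA.g0_pos one_pos) (hA.pos_of_mem_baseI hz) hz.1).le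

lemma invBranchDeriv_le (hA : AssumptionA f₀) (i : ℕ × ℕ) {z : ℝ} (hz : z ∈ baseI f₀) :
    invBranchDeriv f₀ i z ≤ branchBound f₀ i := by
  have hz0 := hA.pos_of_mem_baseI hz
  refine mul_le_mul (hA.deriv_g0_anti (by positivity) (by linarith [hA.iter_pos i.2 hz0]))
    (hA.prod_deriv_le_neutralBound i.2 hz)
    (Finset.prod_nonneg fun j _ => (hA.deriv_g0_pos (hA.iter_pos j hz0)).le) (hA.transBound_pos _).le

lemma invBranchDeriv_le_deriv_one (hA : AssumptionA f₀) (i : ℕ × ℕ) {z : ℝ} (hz : z ∈ baseI f₀) :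
    invBranchDeriv f₀ i z ≤ deriv (g0 f₀) 1 := by
  refine (hA.invBranchDeriv_le i hz).trans ?_
  refine (mul_le_of_le_one_right (hA.transBound_pos _).le (hA.neutralBound_le_one _)).trans ?_
  exact hA.deriv_g0_anti one_pos (by linarith [Nat.cast_nonneg (α := ℝ) i.1])

lemma abs_iter_sub_le (hA : AssumptionA f₀) (j : ℕ) {z w : ℝ} (hz : z ∈ baseI f₀) (hw : w ∈ baseI f₀) :
    |(g0 f₀)^[j] z - (g0 f₀)^[j] w| ≤ neutralBound f₀ j * |z - w| := by
  refine (convex_Ioo (g0 f₀ 1) 1).norm_image_sub_le_of_norm_hasDerivWithin_le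
    (fun x hx => (hA.hasStrictDerivAt_iter j (hA.pos_of_mem_baseI hx)).hasDerivAt.hasDerivWithinAt)
    (fun x hx => ?_) hw hz
  rw [Real.norm_of_nonneg (Finset.prod_nonneg fun i _ =>
    (hA.deriv_g0_pos (hA.iter_pos i (hA.pos_of_mem_baseI hx))).le)]
  exact hA.prod_deriv_le_neutralBound j hx

lemma abs_invBranch_sub_le (hA : AssumptionA f₀) (i : ℕ × ℕ) {z w : ℝ} (hz : z ∈ baseI f₀)
    (hw : w ∈ baseI f₀) : |invBranch f₀ i z - invBranch f₀ i w| ≤ deriv (g0 f₀) 1 * |z - w| := by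
  refine (convex_Ioo (g0 f₀ 1) 1).norm_image_sub_le_of_norm_hasDerivWithin_le
    (fun x hx => (hA.hasStrictDerivAt_invBranch i (hA.pos_of_mem_baseI hx)).hasDerivAt.hasDerivWithinAt)
    (fun x hx => ?_) hw hz
  rw [Real.norm_of_nonneg (hA.invBranchDeriv_pos i (hA.pos_of_mem_baseI hx)).le]
  exact hA.invBranchDeriv_le_deriv_one i hx

/-- Bounded distortion of the inverse branches of `F̂`. -/
lemma exists_branch_distortion (hA : AssumptionA f₀) (hB : AssumptionB f₀) : ∃ D : ℝ, 0 < D ∧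
    ∀ i : ℕ × ℕ, ∀ z ∈ baseI f₀, ∀ w ∈ baseI f₀,
      invBranchDeriv f₀ i z ≤ Real.exp (D * |z - w|) * invBranchDeriv f₀ i w := by
  obtain ⟨K, hK, hdist⟩ := hA.exists_distortion
  have hs := hA.summable_neutralBound hB
  -- The j-th iterates of z and w are within `neutralBound` j times |z - w|, so the logarithmic
  -- errors of all factors add up to at most K|z - w| times this convergent series. The factors of
  -- the product use j < `i.2`, and the outer factor uses j = `i.2`.
  refine ⟨K * ∑' j, neutralBound f₀ j, mul_pos hK (hs.tsum_pos (fun j => (hA.neutralBound_pos j).le) 0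
    (hA.neutralBound_pos 0)), fun i z hz w hw => ?_⟩
  have hz0 := hA.pos_of_mem_baseI hz
  have hw0 := hA.pos_of_mem_baseI hw
  have key : ∀ j, K * |(g0 f₀)^[j] w - (g0 f₀)^[j] z| ≤ K * (neutralBound f₀ j * |z - w|) := fun j => by
    rw [abs_sub_comm z w]
    exact mul_le_mul_of_nonneg_left (hA.abs_iter_sub_le j hw hz) hK.le
  have h1 : ∏ j ∈ Finset.range i.2, deriv (g0 f₀) ((g0 f₀)^[j] z) ≤
      Real.exp (∑ j ∈ Finset.range i.2, K * (neutralBound f₀ j * |z - w|)) *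
        ∏ j ∈ Finset.range i.2, deriv (g0 f₀) ((g0 f₀)^[j] w) := by
    rw [Real.exp_sum, ← Finset.prod_mul_distrib]
    refine Finset.prod_le_prod (fun j _ => (hA.deriv_g0_pos (hA.iter_pos j hz0)).le) fun j _ => ?_
    refine (hdist _ _ (hA.iter_pos j hw0) (hA.iter_pos j hz0)).trans ?_
    exact mul_le_mul_of_nonneg_right (Real.exp_le_exp.2 (key j)) (hA.deriv_g0_pos (hA.iter_pos j hw0)).le
  have h2 : deriv (g0 f₀) (i.1 + 1 + (g0 f₀)^[i.2] z) ≤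
      Real.exp (K * (neutralBound f₀ i.2 * |z - w|)) * deriv (g0 f₀) (i.1 + 1 + (g0 f₀)^[i.2] w) := by
    refine (hdist _ _ (one_pos.trans (hA.arg_pos i hw0)) (one_pos.trans (hA.arg_pos i hz0))).trans ?_
    refine mul_le_mul_of_nonneg_right (Real.exp_le_exp.2 ?_)
      (hA.deriv_g0_pos (one_pos.trans (hA.arg_pos i hw0))).le
    rw [add_sub_add_left_eq_sub]
    exact key i.2
  have h3 : Real.exp (K * (neutralBound f₀ i.2 * |z - w|)) *
      Real.exp (∑ j ∈ Finset.range i.2, K * (neutralBound f₀ j * |z - w|)) ≤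
      Real.exp (K * (∑' j, neutralBound f₀ j) * |z - w|) := by
    rw [← Real.exp_add, Real.exp_le_exp, add_comm, ← Finset.sum_range_succ
      (fun j => K * (neutralBound f₀ j * |z - w|)), ← Finset.mul_sum, ← Finset.sum_mul, mul_assoc]
    gcongr
    exact hs.sum_le_tsum _ fun j _ => (hA.neutralBound_pos j).le
  have hprod : 0 < ∏ j ∈ Finset.range i.2, deriv (g0 f₀) ((g0 f₀)^[j] w) :=
    Finset.prod_pos fun j _ => hA.deriv_g0_pos (hA.iter_pos j hw0)
  have hd0 := hA.deriv_g0_pos (one_pos.trans (hA.arg_pos i hw0))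
  calc invBranchDeriv f₀ i z ≤ _ := mul_le_mul h2 h1
        (Finset.prod_nonneg fun j _ => (hA.deriv_g0_pos (hA.iter_pos j hz0)).le) (by positivity)
    _ = (Real.exp (K * (neutralBound f₀ i.2 * |z - w|)) *
      Real.exp (∑ j ∈ Finset.range i.2, K * (neutralBound f₀ j * |z - w|))) *
        invBranchDeriv f₀ i w := by rw [invBranchDeriv]; ring
    _ ≤ _ := mul_le_mul_of_nonneg_right h3 (hA.invBranchDeriv_pos i hw0).le

/-! ### Estimates on the fibre maps -/

lemma fibreBranch_pos (hA : AssumptionA f₀) (i : ℕ × ℕ) {y : ℝ} (hy : 0 < y) :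
    0 < fibreBranch f₀ i y := hA.iter_pos _ (by linarith [Nat.cast_nonneg (α := ℝ) i.1, hA.g0_pos hy])

lemma hasDerivAt_fibreBranch (hA : AssumptionA f₀) (i : ℕ × ℕ) {y : ℝ} (hy : 0 < y) :
    HasDerivAt (fibreBranch f₀ i) (fibreDeriv f₀ i y) y := by
  have h : 0 < (i.1 : ℝ) + 1 + g0 f₀ y := by linarith [Nat.cast_nonneg (α := ℝ) i.1, hA.g0_pos hy]
  exact HasDerivAt.comp y (hA.hasStrictDerivAt_iter i.2 h).hasDerivAt
    ((hA.hasStrictDerivAt_g0 hy).hasDerivAt.const_add _)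

lemma fibreDeriv_pos (hA : AssumptionA f₀) (i : ℕ × ℕ) {y : ℝ} (hy : 0 < y) :
    0 < fibreDeriv f₀ i y := by
  have h : 0 < (i.1 : ℝ) + 1 + g0 f₀ y := by linarith [Nat.cast_nonneg (α := ℝ) i.1, hA.g0_pos hy]
  exact mul_pos (Finset.prod_pos fun n _ => hA.deriv_g0_pos (hA.iter_pos n h)) (hA.deriv_g0_pos hy)

lemma fibreDeriv_le_one (hA : AssumptionA f₀) (i : ℕ × ℕ) {y : ℝ} (hy : 0 < y) :
    fibreDeriv f₀ i y ≤ 1 := by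
  have h : 0 < (i.1 : ℝ) + 1 + g0 f₀ y := by linarith [Nat.cast_nonneg (α := ℝ) i.1, hA.g0_pos hy]
  exact mul_le_one₀ (Finset.prod_le_one (fun n _ => (hA.deriv_g0_pos (hA.iter_pos n h)).le)
    fun n _ => (hA.deriv_g0_lt_one (hA.iter_pos n h)).le) (hA.deriv_g0_pos hy).le
    (hA.deriv_g0_lt_one hy).le

lemma fibreDeriv_le_of_one_le (hA : AssumptionA f₀) (i : ℕ × ℕ) {y : ℝ} (hy : 1 ≤ y) :
    fibreDeriv f₀ i y ≤ deriv (g0 f₀) 1 := by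
  have hy0 := one_pos.trans_le hy
  have h : 0 < (i.1 : ℝ) + 1 + g0 f₀ y := by linarith [Nat.cast_nonneg (α := ℝ) i.1, hA.g0_pos hy0]
  refine (mul_le_of_le_one_left (hA.deriv_g0_pos hy0).le (Finset.prod_le_one
    (fun n _ => (hA.deriv_g0_pos (hA.iter_pos n h)).le)
    fun n _ => (hA.deriv_g0_lt_one (hA.iter_pos n h)).le)).trans (hA.deriv_g0_anti one_pos hy)

/-- The two-step fibre maps contract uniformly. -/
lemma fibreDeriv_mul_le (hA : AssumptionA f₀) (i i' : ℕ × ℕ) {y : ℝ} (hy : 0 < y) :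
    fibreDeriv f₀ i' (fibreBranch f₀ i y) * fibreDeriv f₀ i y ≤ deriv (g0 f₀) 1 := by
  have hpos := hA.fibreBranch_pos i hy
  have h1 : 1 ≤ (i.1 : ℝ) + 1 + g0 f₀ y := by linarith [Nat.cast_nonneg (α := ℝ) i.1, hA.g0_pos hy]
  have h := zero_lt_one.trans_le h1
  -- One factor is always g₀' at a point at least 1. With no iterate of g₀ in the first branch, its
  -- image is at least 1 and the second step supplies the factor; otherwise it is the innermost
  -- factor of the first branch. A single step need not contract uniformly, since y may be near 0.
  rcases Nat.eq_zero_or_pos i.2 with h0 | h0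
  · have h2 : 1 ≤ fibreBranch f₀ i y := by rw [fibreBranch, h0]; exact h1
    exact (mul_le_of_le_one_right (hA.fibreDeriv_pos i' hpos).le (hA.fibreDeriv_le_one i hy)).trans
      (hA.fibreDeriv_le_of_one_le i' h2)
  · refine (mul_le_of_le_one_left (hA.fibreDeriv_pos i hy).le (hA.fibreDeriv_le_one i' hpos)).trans ?_
    refine (mul_le_of_le_one_right (Finset.prod_nonneg fun n _ => (hA.deriv_g0_pos (hA.iter_pos n h)).le)
      (hA.deriv_g0_lt_one hy).le).trans ?_
    obtain ⟨m, hm⟩ := Nat.exists_eq_succ_of_ne_zero h0.ne'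
    rw [hm, Finset.prod_range_succ']
    refine (mul_le_of_le_one_left (hA.deriv_g0_pos h).le (Finset.prod_le_one
      (fun n _ => (hA.deriv_g0_pos (hA.iter_pos _ h)).le)
      fun n _ => (hA.deriv_g0_lt_one (hA.iter_pos _ h)).le)).trans (hA.deriv_g0_anti one_pos h1)

lemma iter_le_self (hA : AssumptionA f₀) (n : ℕ) {u : ℝ} (hu : 0 < u) : (g0 f₀)^[n] u ≤ u := by
  induction n with
  | zero => exact le_rfl
  | succ n ih =>
    rw [Function.iterate_succ_apply']
    have h1 := hA.iter_pos n hu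
    have h2 := hA.f_gt (hA.g0_mem h1)
    rw [hA.f_g0 h1] at h2
    linarith

lemma neutralBound_le_prod (hA : AssumptionA f₀) (m : ℕ) :
    deriv (g0 f₀) 1 * neutralBound f₀ m ≤ ∏ n ∈ Finset.range m, deriv (g0 f₀) ((g0 f₀)^[n] 1) := by
  cases m with
  | zero => simpa [neutralBound] using (hA.deriv_g0_lt_one one_pos).le
  | succ m =>
    rw [Finset.prod_range_succ', mul_comm]
    exact mul_le_mul_of_nonneg_right (hA.neutralBound_succ_le m) (hA.deriv_g0_pos one_pos).le

/-- Lower bounds matching the upper bounds on inverse branches. The innermost argument lies within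
distance 1 of k + 1, so distortion compares its g₀' with `transBound`. The later arguments lie below
the orbit of 1, where g₀' is larger. The second estimate handles the factor g₀'(y) of the next fibre
map, which would otherwise be uncontrolled for large y. -/
lemma exists_fibreDeriv_ge (hA : AssumptionA f₀) : ∃ c : ℝ, 0 < c ∧ (∀ i : ℕ × ℕ, ∀ y : ℝ, 0 < y →
    c * branchBound f₀ i * deriv (g0 f₀) y ≤ fibreDeriv f₀ i y ∧
    c * transBound f₀ i.1 ≤ deriv (g0 f₀) (fibreBranch f₀ i y)) := by
  obtain ⟨K, hK, hdist⟩ := hA.exists_distortion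
  have hl := hA.deriv_g0_pos one_pos
  have hl1 := hA.deriv_g0_lt_one one_pos
  have hexp : Real.exp (-K) ≤ 1 := Real.exp_le_one_iff.2 (by linarith)
  have hnear : ∀ k : ℕ, ∀ u : ℝ, (k : ℝ) + 1 ≤ u → u ≤ k + 2 →
      Real.exp (-K) * transBound f₀ k ≤ deriv (g0 f₀) u := by
    intro k u h1 h2
    have h3 := hdist u (k + 1) (by linarith [Nat.cast_nonneg (α := ℝ) k]) (by positivity)
    have h4 : Real.exp (K * |u - (k + 1)|) ≤ Real.exp K := by
      rw [Real.exp_le_exp, abs_of_nonneg (by linarith)]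
      nlinarith
    have h5 := hA.deriv_g0_pos (show 0 < u by linarith [Nat.cast_nonneg (α := ℝ) k])
    calc Real.exp (-K) * transBound f₀ k ≤ Real.exp (-K) * (Real.exp K * deriv (g0 f₀) u) :=
          mul_le_mul_of_nonneg_left (h3.trans (mul_le_mul_of_nonneg_right h4 h5.le)) (Real.exp_pos _).le
      _ = deriv (g0 f₀) u := by rw [← mul_assoc, ← Real.exp_add]; simp
  refine ⟨Real.exp (-K) * deriv (g0 f₀) 1, by positivity, fun i y hy => ?_⟩
  have hg := hA.g0_mem hy
  have hw1 : (i.1 : ℝ) + 1 ≤ i.1 + 1 + g0 f₀ y := by linarith [hg.1]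
  have hw2 : (i.1 : ℝ) + 1 + g0 f₀ y ≤ i.1 + 2 := by linarith [hg.2]
  have hw0 : 0 < (i.1 : ℝ) + 1 + g0 f₀ y := by linarith [Nat.cast_nonneg (α := ℝ) i.1, hg.1]
  have ha := hA.transBound_pos i.1
  have hb := hA.neutralBound_pos i.2
  constructor
  · refine mul_le_mul_of_nonneg_right ?_ (hA.deriv_g0_pos hy).le
    rcases Nat.eq_zero_or_pos i.2 with h0 | h0
    · rw [h0, Finset.prod_range_zero]
      exact mul_le_one₀ (mul_le_one₀ hexp hl.le hl1.le) (hA.branchBound_pos i).le (hA.branchBound_le_one i)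
    · obtain ⟨m, hm⟩ := Nat.exists_eq_succ_of_ne_zero h0.ne'
      rw [branchBound, hm, Finset.prod_range_succ']
      have h1 := hnear i.1 _ hw1 hw2
      have h2 : deriv (g0 f₀) 1 * neutralBound f₀ (m + 1) ≤
          ∏ n ∈ Finset.range m, deriv (g0 f₀) ((g0 f₀)^[n + 1] (i.1 + 1 + g0 f₀ y)) := by
        refine (mul_le_mul_of_nonneg_left (hA.neutralBound_succ_le m) hl.le).trans
          ((hA.neutralBound_le_prod m).trans ?_)
        refine Finset.prod_le_prod (fun n _ => (hA.deriv_g0_pos (hA.iter_pos n one_pos)).le) fun n _ => ?_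
        refine hA.deriv_g0_anti (hA.iter_pos _ hw0) ?_
        rw [Function.iterate_succ_apply]
        exact (hA.iter_strictMonoOn n).monotoneOn (hA.g0_pos hw0) (mem_Ioi.2 one_pos) (hA.g0_lt_one hw0).le
      have h3 := mul_le_mul h2 h1 (by positivity) (Finset.prod_nonneg fun n _ =>
        (hA.deriv_g0_pos (hA.iter_pos _ hw0)).le)
      refine le_trans (le_of_eq ?_) h3
      simp only [Nat.succ_eq_add_one]
      ring
  · have h1 : fibreBranch f₀ i y ≤ i.1 + 2 := (hA.iter_le_self _ hw0).trans hw2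
    have h2 := hA.deriv_g0_anti (hA.fibreBranch_pos i hy) h1
    refine le_trans ?_ ((hnear i.1 (i.1 + 2) (by linarith) le_rfl).trans h2)
    rw [mul_assoc]
    exact mul_le_mul_of_nonneg_left (mul_le_of_le_one_left ha.le hl1.le) (Real.exp_pos _).le

end AssumptionA

/-! ### Measurability of the induced maps -/

lemma measurable_sInf_nat {α : Type*} [MeasurableSpace α] {p : ℕ → α → Prop}
    (hp : ∀ n, MeasurableSet {x | p n x}) : Measurable fun x => sInf {n : ℕ | p n x} := by
  refine measurable_to_countable' fun k => ?_
  -- The second piece accounts for the convention sInf ∅ = 0.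
  have h : (fun x => sInf {n : ℕ | p n x}) ⁻¹' {k} =
      ({x | p k x} ∩ ⋂ j, ⋂ _ : j < k, {x | p j x}ᶜ) ∪ ({_x | k = 0} ∩ ⋂ j, {x | p j x}ᶜ) := by
    ext x
    simp only [mem_preimage, mem_singleton_iff, mem_union, mem_inter_iff, mem_iInter,
      mem_compl_iff, mem_ofPred_eq]
    constructor
    · intro h
      rcases eq_empty_or_nonempty {n : ℕ | p n x} with he | hne
      · right
        refine ⟨by rw [← h, he, Nat.sInf_empty], fun j hj => ?_⟩
        have : j ∈ {n : ℕ | p n x} := hj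
        rw [he] at this; exact this
      · left
        exact ⟨h ▸ Nat.sInf_mem hne, fun j hj => Nat.notMem_of_lt_sInf (h ▸ hj)⟩
    · rintro (⟨h1, h2⟩ | ⟨rfl, h2⟩)
      · exact sInf_eq_of_mem_of_le h1 fun j hj => not_lt.1 fun hlt => h2 j hlt hj
      · have : {n : ℕ | p n x} = ∅ := eq_empty_of_forall_notMem h2
        rw [this, Nat.sInf_empty]
  rw [h]
  exact ((hp k).inter (MeasurableSet.iInter fun j => MeasurableSet.iInter fun _ => (hp j).compl)).union
    ((MeasurableSet.const _).inter (MeasurableSet.iInter fun j => (hp j).compl))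

lemma measurable_iterate_comp {α β : Type*} [MeasurableSpace α] [MeasurableSpace β] {T : α → α}
    (hT : Measurable T) {N : β → ℕ} (hN : Measurable N) {g : β → α} (hg : Measurable g) :
    Measurable fun x => T^[N x] (g x) := by
  have h : Measurable fun q : ℕ × α => T^[q.1] q.2 :=
    measurable_from_prod_countable_right fun n => hT.iterate n
  exact h.comp (hN.prodMk hg)

lemma measurable_iterate_nat {α : Type*} [MeasurableSpace α] {T : α → α} (hT : Measurable T)
    {N : α → ℕ} (hN : Measurable N) : Measurable fun x => T^[N x] x :=
  measurable_iterate_comp hT hN measurable_id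

lemma measurable_baseF (hm : Measurable (baseP f₀)) : Measurable (baseF f₀) := by
  have h : baseF f₀ = fun x => (baseP f₀ (x, 0)).1 := rfl
  rw [h]
  exact (hm.comp (measurable_id.prodMk measurable_const)).fst

lemma measurable_tau (hm : Measurable (baseP f₀)) : Measurable (tau f₀) :=
  measurable_sInf_nat fun n => (MeasurableSet.const _).inter
    ((measurable_baseF hm).iterate n measurableSet_Ioo)

lemma measurable_indF (hm : Measurable (baseP f₀)) : Measurable (indF f₀) :=
  measurable_iterate_nat (measurable_baseF hm) (measurable_tau hm)

lemma measurable_indP (hm : Measurable (baseP f₀)) : Measurable (indP f₀) :=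
  measurable_iterate_nat hm ((measurable_tau hm).comp measurable_fst)

lemma measurable_kappa (hm : Measurable (baseP f₀)) : Measurable (kappa f₀) :=
  measurable_sInf_nat fun n => (MeasurableSet.const _).inter
    ((measurable_indF hm).iterate n measurableSet_Ioo)

lemma measurable_hatF (hm : Measurable (baseP f₀)) : Measurable (hatF f₀) :=
  measurable_iterate_nat (measurable_indF hm) (measurable_kappa hm)

lemma measurable_hatP (hm : Measurable (baseP f₀)) : Measurable (hatP f₀) :=
  measurable_iterate_nat (measurable_indP hm) ((measurable_kappa hm).comp measurable_fst)

lemma measurable_tildeF (hm : Measurable (baseP f₀)) : Measurable (tildeF f₀) :=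
  (measurable_hatF hm).comp (measurable_hatF hm)

lemma measurable_tildeP (hm : Measurable (baseP f₀)) : Measurable (tildeP f₀) :=
  (measurable_hatP hm).comp (measurable_hatP hm)

lemma measurableSet_baseI : MeasurableSet (baseI f₀) := measurableSet_Ioo

/-! ### The transfer operator of `F̂` -/

/-- The transfer operator of `F̂` with respect to Lebesgue measure. -/
def transfer (f₀ : ℝ → ℝ) (u : ℝ → ℝ≥0∞) (z : ℝ) : ℝ≥0∞ :=
  ∑' i : ℕ × ℕ, ENNReal.ofReal (invBranchDeriv f₀ i z) * u (invBranch f₀ i z)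

namespace AssumptionA

lemma measurable_g0 (hA : AssumptionA f₀) : Measurable (g0 f₀) := by
  -- Off (0,∞) no preimage exists, so g₀ takes the same default value everywhere.
  have h : g0 f₀ = (Ioi (0 : ℝ)).piecewise (g0 f₀) fun _ => g0 f₀ 0 := by
    ext u
    by_cases hu : u ∈ Ioi (0 : ℝ)
    · rw [piecewise_eq_of_mem _ _ _ hu]
    · rw [piecewise_eq_of_notMem _ _ _ hu]
      have hne : ∀ v : ℝ, v ≤ 0 → ¬ ∃ a ∈ Ioo (0 : ℝ) 1, f₀ a = v := by
        rintro v hv ⟨a, ha, rfl⟩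
        exact absurd (hA.f_pos ha) hv.not_gt
      rw [g0, Function.invFunOn_neg (hne u (not_lt.1 hu)), Function.invFunOn_neg (hne 0 le_rfl)]
  rw [h]
  exact ContinuousOn.measurable_piecewise (fun u hu =>
    (hA.hasStrictDerivAt_g0 hu).hasDerivAt.continuousAt.continuousWithinAt) continuousOn_const
    measurableSet_Ioi

lemma measurable_invBranch (hA : AssumptionA f₀) (i : ℕ × ℕ) : Measurable (invBranch f₀ i) :=
  hA.measurable_g0.comp ((hA.measurable_g0.iterate i.2).const_add _)

lemma measurable_invBranchDeriv (hA : AssumptionA f₀) (i : ℕ × ℕ) :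
    Measurable (invBranchDeriv f₀ i) :=
  ((measurable_deriv _).comp ((hA.measurable_g0.iterate i.2).const_add _)).mul
    (Finset.measurable_fun_prod _ fun j _ => (measurable_deriv _).comp (hA.measurable_g0.iterate j))

lemma measurable_transfer (hA : AssumptionA f₀) {u : ℝ → ℝ≥0∞} (hu : Measurable u) :
    Measurable (transfer f₀ u) :=
  Measurable.tsum fun i =>
    (hA.measurable_invBranchDeriv i).ennreal_ofReal.mul (hu.comp (hA.measurable_invBranch i))

lemma measurable_iterate_transfer (hA : AssumptionA f₀) {u : ℝ → ℝ≥0∞} (hu : Measurable u) (n : ℕ) :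
    Measurable ((transfer f₀)^[n] u) := by
  induction n with
  | zero => exact hu
  | succ n ih => rw [Function.iterate_succ_apply']; exact hA.measurable_transfer ih

lemma measurableSet_image (hA : AssumptionA f₀) (i : ℕ × ℕ) :
    MeasurableSet (invBranch f₀ i '' baseI f₀) :=
  measurableSet_baseI.image_of_continuousOn_injOn (fun _ hz =>
    (hA.hasStrictDerivAt_invBranch i
      (hA.pos_of_mem_baseI hz)).hasDerivAt.continuousAt.continuousWithinAt) (hA.injOn_invBranch i)

lemma iUnion_image_subset (hA : AssumptionA f₀) : (⋃ i, invBranch f₀ i '' baseI f₀) ⊆ baseI f₀ := by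
  refine iUnion_subset fun i => ?_
  rintro _ ⟨z, hz, rfl⟩
  exact hA.invBranch_mem i hz

lemma volume_baseI_diff (hA : AssumptionA f₀) :
    volume (baseI f₀ \ ⋃ i, invBranch f₀ i '' baseI f₀) = 0 := by
  obtain ⟨N, hN, hsub⟩ := hA.exists_countable_cover
  exact measure_mono_null (sdiff_subset_iff.2 hsub) (hN.measure_zero _)

/-- Duality between composition with F̂ and the transfer operator: a change of variables on each
branch, the branch images filling the interval up to a null set. -/
lemma lintegral_mul_comp_hatF (hA : AssumptionA f₀) {u v : ℝ → ℝ≥0∞} (hu : Measurable u)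
    (hv : Measurable v) : ∫⁻ x in baseI f₀, u x * v (hatF f₀ x) =
      ∫⁻ z in baseI f₀, transfer f₀ u z * v z := by
  have hae : (baseI f₀ : Set ℝ) =ᵐ[volume] ⋃ i, invBranch f₀ i '' baseI f₀ :=
    (ae_le_set.2 hA.volume_baseI_diff).antisymm hA.iUnion_image_subset.eventuallyLE
  rw [setLIntegral_congr hae, lintegral_iUnion hA.measurableSet_image hA.pairwise_disjoint_image]
  have h : ∀ i : ℕ × ℕ, ∫⁻ x in invBranch f₀ i '' baseI f₀, u x * v (hatF f₀ x) =
      ∫⁻ z in baseI f₀, ENNReal.ofReal (invBranchDeriv f₀ i z) * u (invBranch f₀ i z) * v z := by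
    intro i
    rw [lintegral_image_eq_lintegral_abs_deriv_mul measurableSet_baseI (fun z hz =>
      (hA.hasStrictDerivAt_invBranch i (hA.pos_of_mem_baseI hz)).hasDerivAt.hasDerivWithinAt)
      (hA.injOn_invBranch i)]
    refine setLIntegral_congr_fun measurableSet_baseI fun z hz => ?_
    rw [hA.hatF_eq i hz, abs_of_pos (hA.invBranchDeriv_pos i (hA.pos_of_mem_baseI hz)), mul_assoc]
  simp_rw [h]
  have hmeas : ∀ i : ℕ × ℕ, AEMeasurable (fun z => ENNReal.ofReal (invBranchDeriv f₀ i z) *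
      u (invBranch f₀ i z) * v z) (volume.restrict (baseI f₀)) := fun i =>
    (((hA.measurable_invBranchDeriv i).ennreal_ofReal.mul
      (hu.comp (hA.measurable_invBranch i))).mul hv).aemeasurable
  rw [← lintegral_tsum hmeas]
  simp_rw [ENNReal.tsum_mul_right]
  rfl

lemma lintegral_transfer (hA : AssumptionA f₀) {u : ℝ → ℝ≥0∞} (hu : Measurable u) :
    ∫⁻ z in baseI f₀, transfer f₀ u z = ∫⁻ x in baseI f₀, u x := by
  simpa using (hA.lintegral_mul_comp_hatF hu (v := fun _ => 1) measurable_const).symm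

lemma lintegral_iterate_transfer (hA : AssumptionA f₀) {u : ℝ → ℝ≥0∞} (hu : Measurable u) (n : ℕ) :
    ∫⁻ z in baseI f₀, (transfer f₀)^[n] u z = ∫⁻ x in baseI f₀, u x := by
  induction n with
  | zero => rfl
  | succ n ih =>
    rw [Function.iterate_succ_apply', hA.lintegral_transfer (hA.measurable_iterate_transfer hu n), ih]

lemma lintegral_mul_comp_iterate_hatF (hA : AssumptionA f₀) (hm : Measurable (baseP f₀))
    {u v : ℝ → ℝ≥0∞} (hu : Measurable u) (hv : Measurable v) (n : ℕ) :
    ∫⁻ x in baseI f₀, u x * v ((hatF f₀)^[n] x) =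
      ∫⁻ z in baseI f₀, (transfer f₀)^[n] u z * v z := by
  induction n generalizing u with
  | zero => rfl
  | succ n ih =>
    rw [Function.iterate_succ_apply, ← ih (hA.measurable_transfer hu)]
    exact hA.lintegral_mul_comp_hatF hu (hv.comp ((measurable_hatF hm).iterate n))

lemma lintegral_mul_comp_tildeF (hA : AssumptionA f₀) (hm : Measurable (baseP f₀))
    {u v : ℝ → ℝ≥0∞} (hu : Measurable u) (hv : Measurable v) :
    ∫⁻ x in baseI f₀, u x * v (tildeF f₀ x) =
      ∫⁻ z in baseI f₀, transfer f₀ (transfer f₀ u) z * v z :=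
  hA.lintegral_mul_comp_iterate_hatF hm hu hv 2

end AssumptionA

/-- Positive functions on `(g₀(1), 1)` whose logarithm is `θ`-Lipschitz. -/
def LogLip (f₀ : ℝ → ℝ) (θ : ℝ) (u : ℝ → ℝ≥0∞) : Prop :=
  ∀ z ∈ baseI f₀, ∀ w ∈ baseI f₀, u z ≤ ENNReal.ofReal (Real.exp (θ * |z - w|)) * u w

/-! ### Regularization by the transfer operator -/

namespace AssumptionA

/-- Inverse branches contract by g₀'(1), which shrinks the log-Lipschitz constant of u, while the
weights contribute their distortion D. Both bounds are uniform over branches and so survive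
summation. -/
lemma logLip_transfer (hA : AssumptionA f₀) {D θ : ℝ} (hθ : 0 ≤ θ)
    (hD : ∀ i : ℕ × ℕ, ∀ z ∈ baseI f₀, ∀ w ∈ baseI f₀,
      invBranchDeriv f₀ i z ≤ Real.exp (D * |z - w|) * invBranchDeriv f₀ i w)
    {u : ℝ → ℝ≥0∞} (hu : LogLip f₀ θ u) :
    LogLip f₀ (deriv (g0 f₀) 1 * θ + D) (transfer f₀ u) := by
  intro z hz w hw
  rw [transfer, transfer, ← ENNReal.tsum_mul_left]
  refine ENNReal.tsum_le_tsum fun i => ?_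
  have h1 := hu _ (hA.invBranch_mem i hz) _ (hA.invBranch_mem i hw)
  have h2 : Real.exp (θ * |invBranch f₀ i z - invBranch f₀ i w|) ≤
      Real.exp (deriv (g0 f₀) 1 * θ * |z - w|) := by
    rw [Real.exp_le_exp, mul_comm _ θ, mul_assoc]
    exact mul_le_mul_of_nonneg_left (hA.abs_invBranch_sub_le i hz hw) hθ
  calc ENNReal.ofReal (invBranchDeriv f₀ i z) * u (invBranch f₀ i z)
      ≤ ENNReal.ofReal (Real.exp (D * |z - w|) * invBranchDeriv f₀ i w) *
        (ENNReal.ofReal (Real.exp (deriv (g0 f₀) 1 * θ * |z - w|)) * u (invBranch f₀ i w)) :=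
        mul_le_mul' (ENNReal.ofReal_le_ofReal (hD i z hz w hw))
          (h1.trans (mul_le_mul' (ENNReal.ofReal_le_ofReal h2) le_rfl))
    _ = _ := by
        rw [add_mul, Real.exp_add, ENNReal.ofReal_mul (Real.exp_pos _).le,
          ENNReal.ofReal_mul (Real.exp_pos _).le]
        ring

/-- The constants obey θ ↦ λθ + D with λ = g₀'(1), whose fixed point is D/(1 - λ). -/
lemma logLip_iterate_transfer (hA : AssumptionA f₀) {D θ : ℝ} (hθ : 0 ≤ θ) (hD0 : 0 < D)
    (hD : ∀ i : ℕ × ℕ, ∀ z ∈ baseI f₀, ∀ w ∈ baseI f₀,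
      invBranchDeriv f₀ i z ≤ Real.exp (D * |z - w|) * invBranchDeriv f₀ i w)
    {u : ℝ → ℝ≥0∞} (hu : LogLip f₀ θ u) (n : ℕ) :
    LogLip f₀ (deriv (g0 f₀) 1 ^ n * θ + D / (1 - deriv (g0 f₀) 1)) ((transfer f₀)^[n] u) := by
  have hl := hA.deriv_g0_pos one_pos
  have hl1 : 0 < 1 - deriv (g0 f₀) 1 := sub_pos.2 (hA.deriv_g0_lt_one one_pos)
  induction n with
  | zero =>
    intro z hz w hw
    refine (hu z hz w hw).trans (mul_le_mul' (ENNReal.ofReal_le_ofReal (Real.exp_le_exp.2 ?_)) le_rfl)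
    have : 0 ≤ D / (1 - deriv (g0 f₀) 1) := by positivity
    exact mul_le_mul_of_nonneg_right (by simpa) (abs_nonneg _)
  | succ n ih =>
    rw [Function.iterate_succ_apply']
    have h := hA.logLip_transfer (by positivity) hD ih
    have e : deriv (g0 f₀) 1 * (deriv (g0 f₀) 1 ^ n * θ + D / (1 - deriv (g0 f₀) 1)) + D =
        deriv (g0 f₀) 1 ^ (n + 1) * θ + D / (1 - deriv (g0 f₀) 1) := by field_simp; ring
    rwa [e] at h

/-- The interval is shorter than 1, so u varies by a factor at most exp θ and is comparable to its
mean. -/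
lemma logLip_le_lintegral (hA : AssumptionA f₀) {θ : ℝ} (hθ : 0 ≤ θ) {u : ℝ → ℝ≥0∞}
    (hu : LogLip f₀ θ u) {z : ℝ} (hz : z ∈ baseI f₀) :
    u z ≤ ENNReal.ofReal (Real.exp θ / (1 - g0 f₀ 1)) * ∫⁻ w in baseI f₀, u w := by
  have hlen : 0 < 1 - g0 f₀ 1 := sub_pos.2 hA.g0_one_lt_one
  have h1 : u z * ENNReal.ofReal (1 - g0 f₀ 1) ≤ ENNReal.ofReal (Real.exp θ) * ∫⁻ w in baseI f₀, u w := by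
    have hvol : volume (baseI f₀) = ENNReal.ofReal (1 - g0 f₀ 1) := Real.volume_Ioo
    rw [← hvol, ← setLIntegral_const, ← lintegral_const_mul' _ _ ENNReal.ofReal_ne_top]
    refine setLIntegral_mono' measurableSet_baseI fun w hw => (hu z hz w hw).trans ?_
    refine mul_le_mul' (ENNReal.ofReal_le_ofReal (Real.exp_le_exp.2 ?_)) le_rfl
    refine mul_le_of_le_one_right hθ ?_
    have := hA.pos_of_mem_baseI hz
    have := hA.pos_of_mem_baseI hw
    exact abs_le.2 ⟨by linarith [hw.2], by linarith [hz.2]⟩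
  rw [ENNReal.ofReal_div_of_pos hlen, ENNReal.div_eq_inv_mul, mul_assoc, ← ENNReal.div_eq_inv_mul]
  rw [ENNReal.le_div_iff_mul_le (Or.inl (by simpa using hlen)) (Or.inl ENNReal.ofReal_ne_top)]
  exact h1

/-- Iterates of the transfer operator are bounded by the integral, uniformly. -/
lemma exists_iterate_transfer_le (hA : AssumptionA f₀) (hB : AssumptionB f₀) :
    ∃ C : ℝ≥0∞, C ≠ ⊤ ∧ ∀ θ : ℝ, 0 ≤ θ → ∀ u : ℝ → ℝ≥0∞, Measurable u → LogLip f₀ θ u →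
      ∃ n, ∀ z ∈ baseI f₀, (transfer f₀)^[n] u z ≤ C * ∫⁻ w in baseI f₀, u w := by
  obtain ⟨D, hD0, hD⟩ := hA.exists_branch_distortion hB
  have hl := hA.deriv_g0_pos one_pos
  have hl1 : 0 < 1 - deriv (g0 f₀) 1 := sub_pos.2 (hA.deriv_g0_lt_one one_pos)
  refine ⟨ENNReal.ofReal (Real.exp (1 + D / (1 - deriv (g0 f₀) 1)) / (1 - g0 f₀ 1)),
    ENNReal.ofReal_ne_top, fun θ hθ u hum hu => ?_⟩
  -- Only the number of iterations depends on θ: once λⁿθ < 1, the log-Lipschitz constant is at most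
  -- 1 + D/(1 - λ).
  have hlim : Tendsto (fun n : ℕ => deriv (g0 f₀) 1 ^ n * θ) atTop (𝓝 0) := by
    simpa using (tendsto_pow_atTop_nhds_zero_of_lt_one hl.le (hA.deriv_g0_lt_one one_pos)).mul_const θ
  obtain ⟨n, hn⟩ := (hlim.eventually (gt_mem_nhds one_pos)).exists
  refine ⟨n, fun z hz => ?_⟩
  have h1 : LogLip f₀ (1 + D / (1 - deriv (g0 f₀) 1)) ((transfer f₀)^[n] u) := by
    intro z hz w hw
    refine (hA.logLip_iterate_transfer hθ hD0 hD hu n z hz w hw).trans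
      (mul_le_mul' (ENNReal.ofReal_le_ofReal (Real.exp_le_exp.2 ?_)) le_rfl)
    exact mul_le_mul_of_nonneg_right (by linarith) (abs_nonneg _)
  have h2 := hA.logLip_le_lintegral (by positivity) h1 hz
  rwa [hA.lintegral_iterate_transfer hum] at h2

end AssumptionA

/-! ### The roof function -/

variable {ρ₀ y₀ : ℝ}

namespace AssumptionA

lemma deriv_tildeF (hA : AssumptionA f₀) (i i' : ℕ × ℕ) {z : ℝ} (hz : z ∈ baseI f₀) :
    deriv (tildeF f₀) (invBranch f₀ i (invBranch f₀ i' z)) =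
      (invBranchDeriv f₀ i (invBranch f₀ i' z) * invBranchDeriv f₀ i' z)⁻¹ := by
  have hz' := hA.invBranch_mem i' hz
  have h1 := hA.invBranchDeriv_pos i (hA.pos_of_mem_baseI hz')
  have h2 := hA.invBranchDeriv_pos i' (hA.pos_of_mem_baseI hz)
  exact (HasStrictDerivAt.to_local_left_inverse
    ((hA.hasStrictDerivAt_invBranch i (hA.pos_of_mem_baseI hz')).comp z
      (hA.hasStrictDerivAt_invBranch i' (hA.pos_of_mem_baseI hz))) (mul_pos h1 h2).ne'
    (g := tildeF f₀) (by
      filter_upwards [isOpen_baseI.mem_nhds hz] with w hw using hA.tildeF_eq i i' hw)).hasDerivAt.deriv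

lemma deriv_tildeP (hA : AssumptionA f₀) (hy₀ : 0 < y₀) (i i' : ℕ × ℕ) {z : ℝ} (hz : z ∈ baseI f₀) :
    deriv (fun y => (tildeP f₀ (invBranch f₀ i (invBranch f₀ i' z), y)).2) y₀ =
      fibreDeriv f₀ i' (fibreBranch f₀ i y₀) * fibreDeriv f₀ i y₀ := by
  simp_rw [hA.tildeP_eq i i' hz]
  exact ((hA.hasDerivAt_fibreBranch i' (hA.fibreBranch_pos i hy₀)).comp y₀
    (hA.hasDerivAt_fibreBranch i hy₀)).deriv

lemma roof_eq (hA : AssumptionA f₀) (hy₀ : 0 < y₀) (i i' : ℕ × ℕ) {z : ℝ} (hz : z ∈ baseI f₀) :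
    roof f₀ ρ₀ y₀ (invBranch f₀ i (invBranch f₀ i' z)) = ρ₀ * Real.log
      ((invBranchDeriv f₀ i (invBranch f₀ i' z) * invBranchDeriv f₀ i' z)⁻¹ /
        (fibreDeriv f₀ i' (fibreBranch f₀ i y₀) * fibreDeriv f₀ i y₀)) := by
  rw [roof, hA.deriv_tildeF i i' hz, hA.deriv_tildeP hy₀ i i' hz]

/-- The roof function is bounded away from zero. -/
lemma roof_ge (hA : AssumptionA f₀) (hρ₀ : 0 < ρ₀) (hy₀ : 0 < y₀) {x : ℝ} (hx : x ∈ tildeDelta f₀) :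
    ρ₀ * Real.log (deriv (g0 f₀) 1)⁻¹ ≤ roof f₀ ρ₀ y₀ x := by
  rw [hA.tildeDelta_eq] at hx
  obtain ⟨i, i', z, hz, rfl⟩ := hx
  rw [hA.roof_eq hy₀ i i' hz]
  have hz' := hA.invBranch_mem i' hz
  have h1 := hA.invBranchDeriv_pos i (hA.pos_of_mem_baseI hz')
  have h2 := hA.invBranchDeriv_pos i' (hA.pos_of_mem_baseI hz)
  have h3 := (hA.invBranchDeriv_le i hz').trans (hA.branchBound_le_one i)
  have h4 := (hA.invBranchDeriv_le i' hz).trans (hA.branchBound_le_one i')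
  have h5 := hA.fibreDeriv_mul_le i i' hy₀
  have h6 := mul_pos (hA.fibreDeriv_pos i' (hA.fibreBranch_pos i hy₀)) (hA.fibreDeriv_pos i hy₀)
  have h7 := hA.deriv_g0_pos one_pos
  -- The base is expanded at least by the factor 1, and the fibre is contracted by g₀'(1).
  refine mul_le_mul_of_nonneg_left (Real.log_le_log (by positivity) ?_) hρ₀.le
  rw [div_eq_mul_inv]
  calc (deriv (g0 f₀) 1)⁻¹ = 1 * (deriv (g0 f₀) 1)⁻¹ := (one_mul _).symm
    _ ≤ _ := mul_le_mul ((one_le_inv₀ (mul_pos h1 h2)).2 (mul_le_one₀ h3 h2.le h4))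
      (inv_anti₀ h6 h5) (by positivity) (by positivity)

lemma roof_lower_pos (hA : AssumptionA f₀) (hρ₀ : 0 < ρ₀) :
    0 < ρ₀ * Real.log (deriv (g0 f₀) 1)⁻¹ :=
  mul_pos hρ₀ (Real.log_pos ((one_lt_inv₀ (hA.deriv_g0_pos one_pos)).2 (hA.deriv_g0_lt_one one_pos)))

lemma tildeDelta_eq_iUnion (hA : AssumptionA f₀) : tildeDelta f₀ =
    ⋃ q : (ℕ × ℕ) × (ℕ × ℕ), invBranch f₀ q.1 '' (invBranch f₀ q.2 '' baseI f₀) := by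
  rw [hA.tildeDelta_eq]
  ext x
  simp only [mem_ofPred_eq, mem_iUnion, image_image, mem_image, Prod.exists]

lemma measurableSet_image_image (hA : AssumptionA f₀) (i i' : ℕ × ℕ) :
    MeasurableSet (invBranch f₀ i '' (invBranch f₀ i' '' baseI f₀)) := by
  have hsub : invBranch f₀ i' '' baseI f₀ ⊆ baseI f₀ := by
    rintro _ ⟨z, hz, rfl⟩; exact hA.invBranch_mem i' hz
  exact (hA.measurableSet_image i').image_of_continuousOn_injOn (fun _ hz =>
    (hA.hasStrictDerivAt_invBranch i
      (hA.pos_of_mem_baseI (hsub hz))).hasDerivAt.continuousAt.continuousWithinAt)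
      ((hA.injOn_invBranch i).mono hsub)

lemma measurableSet_tildeDelta (hA : AssumptionA f₀) : MeasurableSet (tildeDelta f₀) := by
  rw [hA.tildeDelta_eq_iUnion]
  exact MeasurableSet.iUnion fun q => hA.measurableSet_image_image q.1 q.2

lemma tildeDelta_subset (hA : AssumptionA f₀) : tildeDelta f₀ ⊆ baseI f₀ := by
  rw [hA.tildeDelta_eq]
  rintro _ ⟨i, i', z, hz, rfl⟩
  exact hA.invBranch_mem i (hA.invBranch_mem i' hz)

/-- On each pair of branches the fibre derivative at the reference height is constant in x. Only the
derivative of F̃ varies, and countably many measurable pieces are glued. -/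
lemma measurable_indicator_roof (hA : AssumptionA f₀) (hy₀ : 0 < y₀) :
    Measurable ((tildeDelta f₀).indicator (roof f₀ ρ₀ y₀)) := by
  have key : ∀ q : (ℕ × ℕ) × (ℕ × ℕ), EqOn (roof f₀ ρ₀ y₀) (fun x => ρ₀ * Real.log
      (deriv (tildeF f₀) x / (fibreDeriv f₀ q.2 (fibreBranch f₀ q.1 y₀) * fibreDeriv f₀ q.1 y₀)))
      (invBranch f₀ q.1 '' (invBranch f₀ q.2 '' baseI f₀)) := by
    rintro q _ ⟨_, ⟨z, hz, rfl⟩, rfl⟩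
    rw [roof, hA.deriv_tildeP hy₀ q.1 q.2 hz]
  obtain ⟨F, hF, hFe⟩ := exists_measurable_piecewise
    (fun q : (ℕ × ℕ) × (ℕ × ℕ) => invBranch f₀ q.1 '' (invBranch f₀ q.2 '' baseI f₀))
    (fun q => hA.measurableSet_image_image q.1 q.2)
    (fun q x => ρ₀ * Real.log (deriv (tildeF f₀) x /
      (fibreDeriv f₀ q.2 (fibreBranch f₀ q.1 y₀) * fibreDeriv f₀ q.1 y₀)))
    (fun q => (((measurable_deriv _).div_const _).log.const_mul _))
    (fun q q' _ x hx => by rw [← key q hx.1, ← key q' hx.2])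
  have : (tildeDelta f₀).indicator (roof f₀ ρ₀ y₀) = (tildeDelta f₀).indicator F := by
    refine indicator_congr fun x hx => ?_
    rw [hA.tildeDelta_eq_iUnion] at hx
    obtain ⟨q, hq⟩ := mem_iUnion.1 hx
    rw [key q hq, hFe q hq]
  rw [this]
  exact hF.indicator hA.measurableSet_tildeDelta

/-! ### Exponential moments with respect to Lebesgue measure -/

/-- With d the inverse derivative of F̃, G the fibre derivative and M ≥ d the product of branch
bounds, the weight of a branch pair is d · (1/(dG))^e. From G ≥ c'M² it is at most c'^{-e} M^{1-3e},
a summable family by (B). -/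
lemma exists_transfer_exp_le (hA : AssumptionA f₀) (hB : AssumptionB f₀) (hρ₀ : 0 < ρ₀)
    (hy₀ : 0 < y₀) : ∃ η : ℝ, 0 < η ∧ ∃ K : ℝ≥0∞, K ≠ ⊤ ∧ ∀ z ∈ baseI f₀,
      transfer f₀ (transfer f₀ fun x =>
        ENNReal.ofReal (Real.exp (η * (tildeDelta f₀).indicator (roof f₀ ρ₀ y₀) x))) z ≤ K := by
  obtain ⟨σ, hσ, hs1, hs2⟩ := hA.exists_summable hB
  obtain ⟨c, hc, hfib⟩ := hA.exists_fibreDeriv_ge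
  have hDy := hA.deriv_g0_pos hy₀
  set c' := c * c * c * deriv (g0 f₀) y₀ with hc'
  have hc'0 : 0 < c' := by positivity
  -- One e is spent on d and two on G ≥ c'M², so that 1 - 3e = 1 - σ.
  set e := σ / 3 with he
  have he0 : 0 < e := by have := hσ.1; positivity
  set W : ℝ≥0∞ := ∑' i : ℕ × ℕ, ENNReal.ofReal (branchBound f₀ i ^ (1 - σ)) with hW
  have hWtop : W ≠ ⊤ := by
    have : W = (∑' k, ENNReal.ofReal (transBound f₀ k ^ (1 - σ))) *
        ∑' j, ENNReal.ofReal (neutralBound f₀ j ^ (1 - σ)) := by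
      rw [hW, ENNReal.tsum_prod', ← ENNReal.tsum_mul_right]
      refine tsum_congr fun k => ?_
      rw [← ENNReal.tsum_mul_left]
      refine tsum_congr fun j => ?_
      rw [branchBound, Real.mul_rpow (hA.transBound_pos k).le (hA.neutralBound_pos j).le,
        ENNReal.ofReal_mul (Real.rpow_nonneg (hA.transBound_pos k).le _)]
    rw [this]
    exact ENNReal.mul_ne_top hs1.tsum_ofReal_ne_top hs2.tsum_ofReal_ne_top
  refine ⟨e / ρ₀, by positivity, ENNReal.ofReal (c' ^ (-e)) * (W * W),
    ENNReal.mul_ne_top ENNReal.ofReal_ne_top (ENNReal.mul_ne_top hWtop hWtop), fun z hz => ?_⟩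
  have hterm : ∀ i i' : ℕ × ℕ, ENNReal.ofReal (invBranchDeriv f₀ i' z) *
      (ENNReal.ofReal (invBranchDeriv f₀ i (invBranch f₀ i' z)) *
        ENNReal.ofReal (Real.exp (e / ρ₀ * (tildeDelta f₀).indicator (roof f₀ ρ₀ y₀)
          (invBranch f₀ i (invBranch f₀ i' z))))) ≤
      ENNReal.ofReal (c' ^ (-e)) * (ENNReal.ofReal (branchBound f₀ i' ^ (1 - σ)) *
        ENNReal.ofReal (branchBound f₀ i ^ (1 - σ))) := by
    intro i i'
    have hz' := hA.invBranch_mem i' hz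
    have hmem : invBranch f₀ i (invBranch f₀ i' z) ∈ tildeDelta f₀ := by
      rw [hA.tildeDelta_eq]; exact ⟨i, i', z, hz, rfl⟩
    rw [indicator_of_mem hmem, hA.roof_eq hy₀ i i' hz]
    have h1 := hA.invBranchDeriv_pos i (hA.pos_of_mem_baseI hz')
    have h2 := hA.invBranchDeriv_pos i' (hA.pos_of_mem_baseI hz)
    have h3 := hA.invBranchDeriv_le i hz'
    have h4 := hA.invBranchDeriv_le i' hz
    have hy1 := hA.fibreBranch_pos i hy₀
    have h5 := mul_pos (hA.fibreDeriv_pos i' hy1) (hA.fibreDeriv_pos i hy₀)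
    have hB1 := hA.branchBound_pos i
    have hB2 := hA.branchBound_pos i'
    have ht := hA.transBound_pos i.1
    -- The square on the first branch bound arises because `transBound` enters a second time,
    -- through g₀' at the image of the reference height. The square on the other is a waste that
    -- makes the estimate symmetric.
    have h6 : c' * (branchBound f₀ i * branchBound f₀ i') ^ 2 ≤
        fibreDeriv f₀ i' (fibreBranch f₀ i y₀) * fibreDeriv f₀ i y₀ := by
      have e1 := (hfib i' _ hy1).1
      have e2 := (hfib i y₀ hy₀).2
      have e3 := (hfib i y₀ hy₀).1
      have e4 : c * branchBound f₀ i' * (c * transBound f₀ i.1) ≤ fibreDeriv f₀ i' (fibreBranch f₀ i y₀) :=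
        le_trans (mul_le_mul_of_nonneg_left e2 (by positivity)) e1
      refine le_trans ?_ (mul_le_mul e4 e3 (by positivity) (hA.fibreDeriv_pos i' hy1).le)
      have e5 : branchBound f₀ i ≤ transBound f₀ i.1 :=
        mul_le_of_le_one_right ht.le (hA.neutralBound_le_one _)
      have e6 : branchBound f₀ i' * branchBound f₀ i' ≤ branchBound f₀ i' * 1 :=
        mul_le_mul_of_nonneg_left (hA.branchBound_le_one i') hB2.le
      calc c' * (branchBound f₀ i * branchBound f₀ i') ^ 2
          = c' * branchBound f₀ i * (branchBound f₀ i * (branchBound f₀ i' * branchBound f₀ i')) := by ring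
        _ ≤ c' * branchBound f₀ i * (transBound f₀ i.1 * (branchBound f₀ i' * 1)) := by gcongr
        _ = _ := by rw [hc']; ring
    set d := invBranchDeriv f₀ i (invBranch f₀ i' z) * invBranchDeriv f₀ i' z with hd
    set G := fibreDeriv f₀ i' (fibreBranch f₀ i y₀) * fibreDeriv f₀ i y₀ with hG
    have hd0 : 0 < d := mul_pos h1 h2
    have hdB : d ≤ branchBound f₀ i * branchBound f₀ i' := mul_le_mul h3 h4 h2.le hB1.le
    have hexp : Real.exp (e / ρ₀ * (ρ₀ * Real.log (d⁻¹ / G))) = d ^ (-e) * G ^ (-e) := by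
      rw [show e / ρ₀ * (ρ₀ * Real.log (d⁻¹ / G)) = Real.log (d⁻¹ / G) * e by field_simp,
        ← Real.rpow_def_of_pos (by positivity), Real.div_rpow (by positivity) h5.le,
        Real.rpow_neg hd0.le, Real.rpow_neg h5.le, Real.inv_rpow hd0.le, div_eq_mul_inv]
    rw [hexp, ← ENNReal.ofReal_mul h1.le, ← ENNReal.ofReal_mul h2.le,
      ← ENNReal.ofReal_mul (by positivity), ← ENNReal.ofReal_mul (by positivity)]
    refine ENNReal.ofReal_le_ofReal ?_
    have hσ1 := hσ.2
    set M := branchBound f₀ i * branchBound f₀ i' with hM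
    have hM0 : 0 < M := mul_pos hB1 hB2
    calc invBranchDeriv f₀ i' z * (invBranchDeriv f₀ i (invBranch f₀ i' z) * (d ^ (-e) * G ^ (-e)))
        = d ^ (1 - e) * G ^ (-e) := by
          rw [sub_eq_add_neg, Real.rpow_add hd0, Real.rpow_one, hd]; ring
      _ ≤ M ^ (1 - e) * (c' * M ^ 2) ^ (-e) := by
          refine mul_le_mul (Real.rpow_le_rpow hd0.le hdB (by rw [he]; linarith))
            (Real.rpow_le_rpow_of_nonpos (by positivity) h6 (by linarith)) (by positivity) (by positivity)
      _ = c' ^ (-e) * (M ^ (1 - e) * M ^ (2 * (-e))) := by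
          rw [Real.mul_rpow hc'0.le (by positivity), Real.rpow_mul hM0.le, Real.rpow_two]; ring
      _ = c' ^ (-e) * M ^ (1 - σ) := by
          rw [← Real.rpow_add hM0]; congr 2; rw [he]; ring
      _ = _ := by rw [hM, Real.mul_rpow hB1.le hB2.le]; ring
  calc transfer f₀ (transfer f₀ fun x => ENNReal.ofReal (Real.exp (e / ρ₀ *
        (tildeDelta f₀).indicator (roof f₀ ρ₀ y₀) x))) z
      ≤ ∑' i' : ℕ × ℕ, ∑' i : ℕ × ℕ, ENNReal.ofReal (c' ^ (-e)) *
        (ENNReal.ofReal (branchBound f₀ i' ^ (1 - σ)) * ENNReal.ofReal (branchBound f₀ i ^ (1 - σ))) := by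
        refine ENNReal.tsum_le_tsum fun i' => ?_
        rw [transfer, ← ENNReal.tsum_mul_left]
        exact ENNReal.tsum_le_tsum fun i => hterm i i'
    _ = _ := by simp_rw [ENNReal.tsum_mul_left, ENNReal.tsum_mul_right]; rfl

end AssumptionA

/-- The roof function, set to zero off `Δ̃` so that it is measurable. -/
def roofInd (f₀ : ℝ → ℝ) (ρ₀ y₀ : ℝ) : ℝ → ℝ := (tildeDelta f₀).indicator (roof f₀ ρ₀ y₀)

/-- Birkhoff sums of `roofInd`. -/
def roofIndSum (f₀ : ℝ → ℝ) (ρ₀ y₀ : ℝ) (n : ℕ) (x : ℝ) : ℝ :=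
  birkhoffSum (tildeF f₀) (roofInd f₀ ρ₀ y₀) n x

namespace AssumptionA

lemma measurable_roofInd (hA : AssumptionA f₀) (hy₀ : 0 < y₀) : Measurable (roofInd f₀ ρ₀ y₀) :=
  hA.measurable_indicator_roof hy₀

lemma measurable_roofIndSum (hA : AssumptionA f₀) (hm : Measurable (baseP f₀)) (hy₀ : 0 < y₀) (n : ℕ) :
    Measurable (roofIndSum f₀ ρ₀ y₀ n) := by
  change Measurable fun x => ∑ k ∈ Finset.range n, roofInd f₀ ρ₀ y₀ ((tildeF f₀)^[k] x)
  exact Finset.measurable_fun_sum _ fun k _ =>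
    (hA.measurable_roofInd hy₀).comp ((measurable_tildeF hm).iterate k)

lemma roofInd_nonneg (hA : AssumptionA f₀) (hρ₀ : 0 < ρ₀) (hy₀ : 0 < y₀) (x : ℝ) :
    0 ≤ roofInd f₀ ρ₀ y₀ x :=
  indicator_nonneg (fun _ hx => (hA.roof_lower_pos hρ₀).le.trans (hA.roof_ge hρ₀ hy₀ hx)) x

/-- Exponential moments of the Birkhoff sums of the roof function grow at most exponentially. -/
lemma exists_lintegral_exp_le (hA : AssumptionA f₀) (hB : AssumptionB f₀)
    (hm : Measurable (baseP f₀)) (hρ₀ : 0 < ρ₀) (hy₀ : 0 < y₀) :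
    ∃ η : ℝ, 0 < η ∧ ∃ K : ℝ≥0∞, K ≠ ⊤ ∧ ∀ n : ℕ,
      ∫⁻ x in baseI f₀, ENNReal.ofReal (Real.exp (η * roofIndSum f₀ ρ₀ y₀ n x)) ≤ K ^ n := by
  obtain ⟨η, hη, K, hK, hle⟩ := hA.exists_transfer_exp_le hB hρ₀ hy₀
  refine ⟨η, hη, K, hK, fun n => ?_⟩
  induction n with
  | zero =>
    have hl := hA.g0_pos one_pos
    have : volume (baseI f₀) ≤ 1 := by
      rw [baseI, Real.volume_Ioo]
      exact ENNReal.ofReal_le_one.2 (by linarith)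
    simpa [roofIndSum] using this
  | succ n ih =>
    have hv : Measurable fun x => ENNReal.ofReal (Real.exp (η * roofIndSum f₀ ρ₀ y₀ n x)) :=
      ((hA.measurable_roofIndSum hm hy₀ n).const_mul η).exp.ennreal_ofReal
    have hu : Measurable fun x => ENNReal.ofReal (Real.exp (η * roofInd f₀ ρ₀ y₀ x)) :=
      ((hA.measurable_roofInd hy₀).const_mul η).exp.ennreal_ofReal
    calc ∫⁻ x in baseI f₀, ENNReal.ofReal (Real.exp (η * roofIndSum f₀ ρ₀ y₀ (n + 1) x))
        -- The first return is split off, so that the remaining sum is a function of F̃(x) and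
        -- duality applies.
        = ∫⁻ x in baseI f₀, ENNReal.ofReal (Real.exp (η * roofInd f₀ ρ₀ y₀ x)) *
          (fun x => ENNReal.ofReal (Real.exp (η * roofIndSum f₀ ρ₀ y₀ n x))) (tildeF f₀ x) := by
          refine lintegral_congr fun x => ?_
          simp only [roofIndSum]
          rw [birkhoffSum_succ', mul_add, Real.exp_add, ENNReal.ofReal_mul (Real.exp_pos _).le]
      _ = _ := hA.lintegral_mul_comp_tildeF hm hu hv
      _ ≤ ∫⁻ x in baseI f₀, K * ENNReal.ofReal (Real.exp (η * roofIndSum f₀ ρ₀ y₀ n x)) :=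
          setLIntegral_mono' measurableSet_baseI fun z hz => mul_le_mul' (hle z hz) le_rfl
      _ = K * ∫⁻ x in baseI f₀, ENNReal.ofReal (Real.exp (η * roofIndSum f₀ ρ₀ y₀ n x)) :=
          lintegral_const_mul' _ _ hK
      _ ≤ K ^ (n + 1) := by rw [pow_succ']; exact mul_le_mul' le_rfl ih

end AssumptionA

/-! ### Invariance of the induced measure -/

/-! ### First-entry decomposition for an abstract measure-preserving map -/

section FirstReturn

variable {α : Type*}

/-- The points that enter `B` at time exactly `n`, without visiting `A` at times `0, …, n - 1`. -/
def entrySet (T : α → α) (A B : Set α) (n : ℕ) : Set α := (fun S => T ⁻¹' S \ A)^[n] B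

lemma measurableSet_entrySet [MeasurableSpace α] {T : α → α} (hT : Measurable T) {A B : Set α} (hA : MeasurableSet A)
    (hB : MeasurableSet B) (n : ℕ) : MeasurableSet (entrySet T A B n) := by
  induction n with
  | zero => exact hB
  | succ n ih => rw [entrySet, Function.iterate_succ_apply']; exact (hT ih).diff hA

lemma mem_entrySet {T : α → α} {A B : Set α} (n : ℕ) {p : α} (h1 : ∀ k < n, T^[k] p ∉ A)
    (h2 : T^[n] p ∈ B) : p ∈ entrySet T A B n := by
  induction n generalizing p with
  | zero => exact h2
  | succ n ih =>
    rw [entrySet, Function.iterate_succ_apply']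
    exact ⟨ih (fun k hk => h1 (k + 1) (by omega)) h2, h1 0 (by omega)⟩

/-- Telescoping: with E_n the entry sets, invariance gives m(E_n) = m(T⁻¹E_n ∩ A) + m(E_{n+1}), and
E_0 = B. -/
lemma tsum_measure_entrySet_le [MeasurableSpace α] {T : α → α} {m : Measure α} (hT : MeasurePreserving T m m)
    {A B : Set α} (hA : MeasurableSet A) (hB : MeasurableSet B) :
    ∑' n, m (T ⁻¹' entrySet T A B n ∩ A) ≤ m B := by
  refine ENNReal.tsum_le_of_sum_range_le fun n => ?_
  have h : ∑ k ∈ Finset.range n, m (T ⁻¹' entrySet T A B k ∩ A) + m (entrySet T A B n) = m B := by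
    induction n with
    | zero => simp [entrySet]
    | succ n ih =>
      rw [Finset.sum_range_succ, add_assoc, ← ih,
        ← hT.measure_preimage (measurableSet_entrySet hT.measurable hA hB n).nullMeasurableSet,
        ← measure_inter_add_sdiff (T ⁻¹' entrySet T A B n) hA]
      congr 3
      rw [entrySet, Function.iterate_succ_apply']
      rfl
  rw [← h]
  exact le_self_add

end FirstReturn

variable {m : Measure (ℝ × ℝ)}

namespace AssumptionA

lemma volume_baseI_diff_tildeDelta (hA : AssumptionA f₀) (hm : Measurable (baseP f₀)) :
    volume (baseI f₀ \ tildeDelta f₀) = 0 := by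
  set N := baseI f₀ \ ⋃ i, invBranch f₀ i '' baseI f₀ with hN
  have hNm : MeasurableSet N := measurableSet_baseI.diff (MeasurableSet.iUnion hA.measurableSet_image)
  have h1 : volume N = 0 := hA.volume_baseI_diff
  -- F̂ is nonsingular: duality with the constant function 1 turns the preimage of a null set into
  -- an integral over that null set.
  have h2 : volume (hatF f₀ ⁻¹' N ∩ baseI f₀) = 0 := by
    have h := hA.lintegral_mul_comp_hatF (u := fun _ => 1) (v := N.indicator 1) measurable_const
      (measurable_one.indicator hNm)
    have e : ∀ x, (1 : ℝ≥0∞) * N.indicator 1 (hatF f₀ x) = (hatF f₀ ⁻¹' N).indicator 1 x :=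
      fun x => by rw [one_mul]; rfl
    simp_rw [e] at h
    rw [lintegral_indicator_one ((measurable_hatF hm) hNm),
      Measure.restrict_apply ((measurable_hatF hm) hNm)] at h
    rw [h, ← nonpos_iff_eq_zero]
    refine (lintegral_mono' Measure.restrict_le_self le_rfl).trans (le_of_eq ?_)
    refine lintegral_eq_zero_of_ae_eq_zero ?_
    filter_upwards [measure_eq_zero_iff_ae_notMem.1 h1] with x hx
    simp [hx]
  refine measure_mono_null (fun x hx => ?_) (measure_union_null h1 h2)
  by_cases hx1 : x ∈ N
  · exact Or.inl hx1
  · right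
    obtain ⟨i, z, hz, rfl⟩ := mem_iUnion.1 (not_not.1 fun h => hx1 ⟨hx.1, h⟩)
    refine ⟨?_, hx.1⟩
    rw [mem_preimage, hA.hatF_eq i hz]
    refine ⟨hz, fun hmem => hx.2 ?_⟩
    obtain ⟨i', w, hw, rfl⟩ := mem_iUnion.1 hmem
    rw [hA.tildeDelta_eq]
    exact ⟨i, i', w, hw, rfl⟩

end AssumptionA

lemma measurable_baseP_of_ergodic (hC : AssumptionC f₀ m) : Measurable (baseP f₀) :=
  hC.ergodic.toMeasurePreserving.measurable

lemma measurableSet_strip : MeasurableSet (baseI f₀ ×ˢ Ioi (0 : ℝ)) :=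
  measurableSet_baseI.prod measurableSet_Ioi

namespace AssumptionA

lemma baseSigma_subset (hA : AssumptionA f₀) : baseSigma f₀ ⊆ baseI f₀ ×ˢ Ioi (0 : ℝ) :=
  prod_mono hA.tildeDelta_subset le_rfl

lemma measurableSet_baseSigma (hA : AssumptionA f₀) : MeasurableSet (baseSigma f₀) :=
  hA.measurableSet_tildeDelta.prod measurableSet_Ioi

lemma measure_strip_diff (hA : AssumptionA f₀) (hC : AssumptionC f₀ m) :
    m ((baseI f₀ ×ˢ Ioi (0 : ℝ)) \ baseSigma f₀) = 0 := by
  refine measure_mono_null (t := (baseI f₀ \ tildeDelta f₀) ×ˢ univ) ?_ (hC.absolutelyContinuous ?_)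
  · rintro p ⟨hp1, hp2⟩
    exact ⟨⟨hp1.1, fun h => hp2 ⟨h, hp1.2⟩⟩, trivial⟩
  · rw [Measure.volume_eq_prod, Measure.prod_prod,
      hA.volume_baseI_diff_tildeDelta (measurable_baseP_of_ergodic hC), zero_mul]

lemma restrict_baseSigma (hA : AssumptionA f₀) (hC : AssumptionC f₀ m) :
    m.restrict (baseSigma f₀) = m.restrict (baseI f₀ ×ˢ Ioi (0 : ℝ)) :=
  Measure.restrict_congr_set (hA.baseSigma_subset.eventuallyLE.antisymm
    (ae_le_set.2 (hA.measure_strip_diff hC)))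

lemma measure_baseSigma_lt_top (hA : AssumptionA f₀) (hC : AssumptionC f₀ m) :
    m (baseSigma f₀) < ⊤ :=
  (measure_mono hA.baseSigma_subset).trans_lt
    (hC.finite_strip _ _ (hA.g0_pos one_pos) hA.g0_one_lt_one)

lemma exists_of_mem_tildeDelta (hA : AssumptionA f₀) {x : ℝ} (hx : x ∈ tildeDelta f₀) :
    ∃ i, ∃ z ∈ baseI f₀, invBranch f₀ i z = x := by
  rw [hA.tildeDelta_eq] at hx
  obtain ⟨i, i', z, hz, rfl⟩ := hx
  exact ⟨i, _, hA.invBranch_mem i' hz, rfl⟩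

/-- A point of Σ whose first return to the strip takes n + 1 steps and lands in B belongs to the
n-th set of the entry decomposition. -/
lemma restrict_preimage_hatP_le (hA : AssumptionA f₀) (hC : AssumptionC f₀ m) {B : Set (ℝ × ℝ)}
    (hB : MeasurableSet B) : m.restrict (baseSigma f₀) (hatP f₀ ⁻¹' B) ≤
      m.restrict (baseSigma f₀) B := by
  have hm := measurable_baseP_of_ergodic hC
  set A := baseI f₀ ×ˢ Ioi (0 : ℝ) with hAdef
  have hsub : hatP f₀ ⁻¹' B ∩ baseSigma f₀ ⊆
      ⋃ n, baseP f₀ ⁻¹' entrySet (baseP f₀) A (B ∩ A) n ∩ A := by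
    rintro ⟨x, y⟩ ⟨hpB, hpS⟩
    obtain ⟨i, z, hz, rfl⟩ := hA.exists_of_mem_tildeDelta hpS.1
    refine mem_iUnion.2 ⟨i.1 + 1 + i.2, mem_entrySet _ (fun k hk hmem => ?_) ?_, hA.baseSigma_subset hpS⟩
    · rw [← Function.iterate_succ_apply] at hmem
      exact hA.baseP_no_return i hz y (by omega) (by omega) hmem.1
    · rw [← Function.iterate_succ_apply, show (i.1 + 1 + i.2).succ = i.1 + 2 + i.2 by omega,
        hA.baseP_return i hz y]
      refine ⟨hpB, ?_⟩
      rw [hA.hatP_eq i hz]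
      exact ⟨hz, hA.fibreBranch_pos i hpS.2⟩
  rw [Measure.restrict_apply (measurable_hatP hm hB)]
  calc m (hatP f₀ ⁻¹' B ∩ baseSigma f₀)
      ≤ ∑' n, m (baseP f₀ ⁻¹' entrySet (baseP f₀) A (B ∩ A) n ∩ A) :=
        (measure_mono hsub).trans (measure_iUnion_le _)
    _ ≤ m (B ∩ A) := tsum_measure_entrySet_le hC.ergodic.toMeasurePreserving measurableSet_strip
        (hB.inter measurableSet_strip)
    _ = _ := by rw [hA.restrict_baseSigma hC, Measure.restrict_apply hB]

/-- The inequality for B together with the one for its complement forces equality, because the total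
mass m(Σ) is finite. -/
lemma measurePreserving_hatP (hA : AssumptionA f₀) (hC : AssumptionC f₀ m) :
    MeasurePreserving (hatP f₀) (nu f₀ m) (nu f₀ m) := by
  have hm := measurable_baseP_of_ergodic hC
  have hfin : IsFiniteMeasure (m.restrict (baseSigma f₀)) :=
    ⟨by rw [Measure.restrict_apply_univ]; exact hA.measure_baseSigma_lt_top hC⟩
  refine MeasurePreserving.smul_measure (c := (m (baseSigma f₀))⁻¹) ⟨measurable_hatP hm, ?_⟩
  ext B hB
  rw [Measure.map_apply (measurable_hatP hm) hB]
  refine le_antisymm (hA.restrict_preimage_hatP_le hC hB) ?_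
  have h1 := hA.restrict_preimage_hatP_le hC hB.compl
  rw [preimage_compl, measure_compl (measurable_hatP hm hB) (measure_ne_top _ _),
    measure_compl hB (measure_ne_top _ _)] at h1
  exact (ENNReal.sub_le_sub_iff_left (measure_mono (subset_univ _)) (measure_ne_top _ _)).1 h1

lemma measurePreserving_hatF (hA : AssumptionA f₀) (hC : AssumptionC f₀ m) :
    MeasurePreserving (hatF f₀) (muHat f₀ m) (muHat f₀ m) :=
  MeasurePreserving.of_semiconj (f := Prod.fst) ⟨measurable_fst, rfl⟩ (hA.measurePreserving_hatP hC)
    (fun p => fst_hatP p) (measurable_hatF (measurable_baseP_of_ergodic hC))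

lemma measurePreserving_tildeF (hA : AssumptionA f₀) (hC : AssumptionC f₀ m) :
    MeasurePreserving (tildeF f₀) (muHat f₀ m) (muHat f₀ m) :=
  (hA.measurePreserving_hatF hC).comp (hA.measurePreserving_hatF hC)

/-- An upper bound suffices below; it also covers m(Σ) = 0, where conditioning yields the zero
measure. -/
lemma nu_univ_le_one : nu f₀ m univ ≤ 1 := by
  rw [nu, ProbabilityTheory.cond, Measure.smul_apply, Measure.restrict_apply_univ, smul_eq_mul]
  exact ENNReal.inv_mul_le_one _

lemma muHat_univ_le_one : muHat f₀ m univ ≤ 1 := by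
  rw [muHat, Measure.map_apply measurable_fst MeasurableSet.univ]
  exact nu_univ_le_one

instance : IsFiniteMeasure (nu f₀ m) := ⟨nu_univ_le_one.trans_lt ENNReal.one_lt_top⟩

instance : IsFiniteMeasure (muHat f₀ m) := ⟨muHat_univ_le_one.trans_lt ENNReal.one_lt_top⟩

lemma ae_nu_mem_baseSigma (hA : AssumptionA f₀) : ∀ᵐ p ∂(nu f₀ m), p ∈ baseSigma f₀ :=
  Measure.ae_smul_measure (ae_restrict_mem hA.measurableSet_baseSigma) _

lemma ae_muHat_mem_tildeDelta (hA : AssumptionA f₀) : ∀ᵐ x ∂(muHat f₀ m), x ∈ tildeDelta f₀ := by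
  refine (ae_map_iff measurable_fst.aemeasurable hA.measurableSet_tildeDelta).2 ?_
  filter_upwards [hA.ae_nu_mem_baseSigma] with p hp using hp.1

lemma muHat_absolutelyContinuous (hC : AssumptionC f₀ m) : muHat f₀ m ≪ volume := by
  refine Measure.AbsolutelyContinuous.mk fun s hs h0 => ?_
  rw [muHat, Measure.map_apply measurable_fst hs, nu, ProbabilityTheory.cond, Measure.smul_apply]
  have : m (Prod.fst ⁻¹' s) = 0 := hC.absolutelyContinuous (by
    rw [← prod_univ, Measure.volume_eq_prod, Measure.prod_prod, h0, zero_mul])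
  have h2 : m.restrict (baseSigma f₀) (Prod.fst ⁻¹' s) = 0 :=
    le_antisymm ((Measure.restrict_le_self _).trans this.le) zero_le
  rw [h2, smul_zero]

/-! ### The density of `μ̂` is bounded -/

/-- Integrable functions are dominated, up to a small error, by log-Lipschitz functions. -/
lemma exists_logLip_approx (hA : AssumptionA f₀) {f : ℝ → ℝ} (hf : Integrable f volume) {ε : ℝ}
    (hε : 0 < ε) : ∃ (g : ℝ → ℝ≥0∞) (u : ℝ → ℝ≥0∞) (θ : ℝ), 0 ≤ θ ∧ Measurable u ∧ LogLip f₀ θ u ∧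
      AEMeasurable g volume ∧ ∫⁻ x, g x ≤ ENNReal.ofReal ε ∧ (∀ x ∈ baseI f₀, ‖f x‖ₑ ≤ g x + u x) ∧
      ∀ x ∈ baseI f₀, u x ≤ ‖f x‖ₑ + g x + ENNReal.ofReal (2 * ε) := by
  -- f is approximated in L¹ by a continuous function, and that uniformly by a polynomial p. Then u
  -- = |p| + ε is bounded below by ε, so its logarithm is Lipschitz with constant L/ε.
  obtain ⟨g, -, hg, hgc, hgi⟩ := hf.exists_hasCompactSupport_lintegral_sub_le
    (ENNReal.ofReal_pos.2 hε).ne'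
  obtain ⟨p, hp⟩ := exists_polynomial_near_of_continuousOn (g0 f₀ 1) 1 g hgc.continuousOn ε hε
  obtain ⟨L, hL⟩ := isCompact_Icc.exists_bound_of_continuousOn (s := Icc (g0 f₀ 1) 1)
    (f := fun x => p.derivative.eval x) p.derivative.continuous.continuousOn
  have hL0 : 0 ≤ L := (norm_nonneg _).trans (hL 1 ⟨hA.g0_one_lt_one.le, le_rfl⟩)
  have hlip : ∀ z ∈ baseI f₀, ∀ w ∈ baseI f₀, |p.eval z - p.eval w| ≤ L * |z - w| := by
    intro z hz w hw
    exact (convex_Icc (g0 f₀ 1) 1).norm_image_sub_le_of_norm_hasDerivWithin_le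
      (fun x _ => (p.hasDerivAt x).hasDerivWithinAt) hL (Ioo_subset_Icc_self hw) (Ioo_subset_Icc_self hz)
  refine ⟨fun x => ‖f x - g x‖ₑ, fun x => ENNReal.ofReal (|p.eval x| + ε), L / ε, by positivity,
    (p.continuous.abs.add continuous_const).measurable.ennreal_ofReal, fun z hz w hw => ?_,
    (hf.aestronglyMeasurable.sub hgi.aestronglyMeasurable).enorm, hg, fun x hx => ?_, fun x hx => ?_⟩
  · rw [← ENNReal.ofReal_mul (Real.exp_pos _).le]
    refine ENNReal.ofReal_le_ofReal ?_
    have h1 : |p.eval z| ≤ |p.eval w| + L * |z - w| := by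
      have := abs_sub_abs_le_abs_sub (p.eval z) (p.eval w)
      linarith [hlip z hz w hw]
    have h2 := Real.add_one_le_exp (L / ε * |z - w|)
    have h3 : L * |z - w| ≤ L / ε * |z - w| * (|p.eval w| + ε) := by
      have e : L / ε * |z - w| * (|p.eval w| + ε) = L / ε * |z - w| * |p.eval w| + L * |z - w| := by
        field_simp
      rw [e]
      have : 0 ≤ L / ε * |z - w| * |p.eval w| := by positivity
      linarith
    calc |p.eval z| + ε ≤ (L / ε * |z - w| + 1) * (|p.eval w| + ε) := by linarith
      _ ≤ _ := by gcongr
  · have h1 := hp x (Ioo_subset_Icc_self hx)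
    beta_reduce
    rw [← ofReal_norm, ← ofReal_norm, ← ENNReal.ofReal_add (norm_nonneg _) (by positivity)]
    refine ENNReal.ofReal_le_ofReal ?_
    simp only [Real.norm_eq_abs]
    rw [abs_sub_comm] at h1
    have e : f x = (f x - g x) + ((g x - p.eval x) + p.eval x) := by ring
    have h2 := abs_add_le (f x - g x) ((g x - p.eval x) + p.eval x)
    have h3 := abs_add_le (g x - p.eval x) (p.eval x)
    rw [← e] at h2
    linarith
  · have h1 := hp x (Ioo_subset_Icc_self hx)
    beta_reduce
    rw [← ofReal_norm, ← ofReal_norm, ← ENNReal.ofReal_add (norm_nonneg _) (norm_nonneg _),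
      ← ENNReal.ofReal_add (by positivity) (by positivity)]
    refine ENNReal.ofReal_le_ofReal ?_
    simp only [Real.norm_eq_abs]
    have e : p.eval x = (p.eval x - g x) + (f x - (f x - g x)) := by ring
    have h2 := abs_add_le (p.eval x - g x) (f x - (f x - g x))
    have h3 := abs_sub (f x) (f x - g x)
    rw [← e] at h2
    linarith

/-- The density is dominated by g + u with g small in L¹ and u log-Lipschitz. Replacing B by its
preimage under a high iterate of F̂ does not change μ̂(B). After this g still costs at most ε, while
the transferred u is bounded by a constant that does not depend on ε. -/
lemma exists_muHat_le (hA : AssumptionA f₀) (hB : AssumptionB f₀) (hC : AssumptionC f₀ m) :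
    ∃ C : ℝ≥0∞, C ≠ ⊤ ∧ muHat f₀ m ≤ C • volume.restrict (baseI f₀) := by
  have hm := measurable_baseP_of_ergodic hC
  obtain ⟨C, hCtop, hCle⟩ := hA.exists_iterate_transfer_le hB
  refine ⟨C * 4, ENNReal.mul_ne_top hCtop (by norm_num), Measure.le_iff.2 fun B hBm => ?_⟩
  rw [Measure.smul_apply, smul_eq_mul, Measure.restrict_apply hBm]
  set φ := (muHat f₀ m).rnDeriv volume with hφ
  have hac := muHat_absolutelyContinuous (f₀ := f₀) hC
  have hmeas : ∀ S, MeasurableSet S → muHat f₀ m S = ∫⁻ x in S, φ x := fun S hS =>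
    (Measure.setLIntegral_rnDeriv hac S).symm
  have hφint : ∫⁻ x, φ x ≤ 1 := by
    rw [hφ, Measure.lintegral_rnDeriv hac]; exact muHat_univ_le_one
  have hI : volume (baseI f₀) ≤ 1 := by
    have hl := hA.g0_pos one_pos
    rw [baseI, Real.volume_Ioo]
    exact ENNReal.ofReal_le_one.2 (by linarith)
  have hφe : ∀ᵐ x ∂volume, ‖(φ x).toReal‖ₑ = φ x := by
    filter_upwards [Measure.rnDeriv_lt_top (muHat f₀ m) volume] with x hx
    rw [Real.enorm_of_nonneg ENNReal.toReal_nonneg, ENNReal.ofReal_toReal hx.ne]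
  have key : ∀ ε : ℝ, 0 < ε → ε < 1 →
      muHat f₀ m B ≤ C * 4 * volume (B ∩ baseI f₀) + ENNReal.ofReal ε := by
    intro ε hε hε1
    obtain ⟨g, u, θ, hθ, hum, hul, hgm, hgint, hfu, huf⟩ :=
      hA.exists_logLip_approx (f := fun x => (φ x).toReal) Measure.integrable_toReal_rnDeriv hε
    obtain ⟨n, hn⟩ := hCle θ hθ u hum hul
    have hεle : ENNReal.ofReal ε ≤ 1 := ENNReal.ofReal_le_one.2 hε1.le
    have huint : ∫⁻ x in baseI f₀, u x ≤ 4 := by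
      calc ∫⁻ x in baseI f₀, u x
          ≤ ∫⁻ x in baseI f₀, (‖(φ x).toReal‖ₑ + g x + ENNReal.ofReal (2 * ε)) :=
            setLIntegral_mono' measurableSet_baseI huf
        _ = (∫⁻ x in baseI f₀, ‖(φ x).toReal‖ₑ) + (∫⁻ x in baseI f₀, g x) +
            ENNReal.ofReal (2 * ε) * volume (baseI f₀) := by
            rw [lintegral_add_right _ measurable_const, lintegral_add_right' _ hgm.restrict,
              setLIntegral_const]
        _ ≤ 1 + 1 + 2 * 1 := by
            refine add_le_add (add_le_add ?_ ?_) (mul_le_mul' ?_ hI)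
            · refine (lintegral_mono' Measure.restrict_le_self le_rfl).trans ?_
              rw [lintegral_congr_ae hφe]; exact hφint
            · exact (lintegral_mono' Measure.restrict_le_self le_rfl).trans (hgint.trans hεle)
            · rw [ENNReal.ofReal_mul zero_le_two, ENNReal.ofReal_ofNat]
              exact mul_le_of_le_one_right' hεle
        _ = 4 := by norm_num
    -- The iterate n is chosen after u, hence depends on ε; invariance of μ̂ makes this harmless.
    have hpre := ((hA.measurePreserving_hatF hC).iterate n).measure_preimage hBm.nullMeasurableSet
    have hBn : MeasurableSet ((hatF f₀)^[n] ⁻¹' B) := (measurable_hatF hm).iterate n hBm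
    have hIae : muHat f₀ m ((hatF f₀)^[n] ⁻¹' B) = muHat f₀ m (baseI f₀ ∩ (hatF f₀)^[n] ⁻¹' B) := by
      refine measure_congr ?_
      filter_upwards [hA.ae_muHat_mem_tildeDelta (m := m)] with x hx
      refine propext ⟨fun h => ⟨hA.tildeDelta_subset hx, h⟩, fun h => h.2⟩
    rw [← hpre, hIae, hmeas _ (measurableSet_baseI.inter hBn)]
    calc ∫⁻ x in baseI f₀ ∩ (hatF f₀)^[n] ⁻¹' B, φ x
        ≤ ∫⁻ x in baseI f₀ ∩ (hatF f₀)^[n] ⁻¹' B, (g x + u x) := by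
          refine setLIntegral_mono_ae' (measurableSet_baseI.inter hBn) ?_
          filter_upwards [hφe] with x hx hxm
          rw [← hx]
          exact hfu x hxm.1
      _ = (∫⁻ x in baseI f₀ ∩ (hatF f₀)^[n] ⁻¹' B, g x) +
          ∫⁻ x in baseI f₀ ∩ (hatF f₀)^[n] ⁻¹' B, u x :=
          lintegral_add_right _ hum
      _ ≤ ENNReal.ofReal ε + C * 4 * volume (B ∩ baseI f₀) := by
          refine add_le_add ((lintegral_mono' Measure.restrict_le_self le_rfl).trans hgint) ?_
          have e : ∫⁻ x in baseI f₀ ∩ (hatF f₀)^[n] ⁻¹' B, u x =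
              ∫⁻ x in baseI f₀, u x * B.indicator 1 ((hatF f₀)^[n] x) := by
            rw [inter_comm, ← Measure.restrict_restrict hBn, ← lintegral_indicator hBn]
            refine lintegral_congr fun x => ?_
            by_cases hx : (hatF f₀)^[n] x ∈ B
            · rw [indicator_of_mem (show x ∈ (hatF f₀)^[n] ⁻¹' B from hx), indicator_of_mem hx]
              simp
            · rw [indicator_of_notMem (show x ∉ (hatF f₀)^[n] ⁻¹' B from hx), indicator_of_notMem hx]
              simp
          rw [e, hA.lintegral_mul_comp_iterate_hatF hm hum (measurable_one.indicator hBm) n]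
          calc ∫⁻ z in baseI f₀, (transfer f₀)^[n] u z * B.indicator 1 z
              ≤ ∫⁻ z in baseI f₀, (C * 4) * B.indicator 1 z :=
                setLIntegral_mono' measurableSet_baseI fun z hz =>
                  mul_le_mul' ((hn z hz).trans (mul_le_mul' le_rfl huint)) le_rfl
            _ = _ := by
                rw [lintegral_const_mul _ (measurable_one.indicator hBm), lintegral_indicator_one hBm,
                  Measure.restrict_apply hBm]
      _ = _ := add_comm _ _
  refine ENNReal.le_of_forall_pos_le_add fun ε hε _ => ?_
  have h := key (min ε (1 / 2)) (lt_min (by exact_mod_cast hε) (by norm_num))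
    ((min_le_right _ _).trans_lt (by norm_num))
  refine h.trans (add_le_add le_rfl ?_)
  rw [← ENNReal.ofReal_coe_nnreal]
  exact ENNReal.ofReal_le_ofReal (min_le_left _ _)

end AssumptionA

/-! ### The suspension flow along full orbits -/

/-- The points whose full forward `F̃`-orbit stays in `Δ̃`. -/
def fullOrbit (f₀ : ℝ → ℝ) : Set ℝ := {x | ∀ n, (tildeF f₀)^[n] x ∈ tildeDelta f₀}

/-- The least number of returns after height `u`, computed with `roofIndSum`. -/
def lapInd (f₀ : ℝ → ℝ) (ρ₀ y₀ x u : ℝ) : ℕ := sInf {n : ℕ | u < roofIndSum f₀ ρ₀ y₀ (n + 1) x}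

/-- The suspension flow, computed with `roofIndSum`. -/
def flowInd (f₀ : ℝ → ℝ) (ρ₀ y₀ t : ℝ) (p : (ℝ × ℝ) × ℝ) : (ℝ × ℝ) × ℝ :=
  ((tildeP f₀)^[lapInd f₀ ρ₀ y₀ p.1.1 (p.2 + t)] p.1,
    p.2 + t - roofIndSum f₀ ρ₀ y₀ (lapInd f₀ ρ₀ y₀ p.1.1 (p.2 + t)) p.1.1)

/-- The suspension semiflow, computed with `roofIndSum`. -/
def semiflowInd (f₀ : ℝ → ℝ) (ρ₀ y₀ t : ℝ) (p : ℝ × ℝ) : ℝ × ℝ :=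
  ((tildeF f₀)^[lapInd f₀ ρ₀ y₀ p.1 (p.2 + t)] p.1,
    p.2 + t - roofIndSum f₀ ρ₀ y₀ (lapInd f₀ ρ₀ y₀ p.1 (p.2 + t)) p.1)

lemma iterate_mem_fullOrbit {x : ℝ} (hx : x ∈ fullOrbit f₀) (n : ℕ) :
    (tildeF f₀)^[n] x ∈ fullOrbit f₀ := fun k => by
  rw [← Function.iterate_add_apply]; exact hx _

lemma mem_tildeDelta_of_mem_fullOrbit {x : ℝ} (hx : x ∈ fullOrbit f₀) : x ∈ tildeDelta f₀ := hx 0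

lemma roofInd_eq {x : ℝ} (hx : x ∈ tildeDelta f₀) : roofInd f₀ ρ₀ y₀ x = roof f₀ ρ₀ y₀ x :=
  indicator_of_mem hx _

/-- Off Δ̃ the formula for the roof gives irrelevant values. Along full orbits, which are μ̂-almost
all, it may be replaced by its nonnegative measurable version, and likewise in the lap number and
both flows. -/
lemma roofSum_eq {x : ℝ} (hx : x ∈ fullOrbit f₀) (n : ℕ) :
    roofSum f₀ ρ₀ y₀ n x = roofIndSum f₀ ρ₀ y₀ n x := by
  change ∑ k ∈ Finset.range n, roof f₀ ρ₀ y₀ ((tildeF f₀)^[k] x) =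
    ∑ k ∈ Finset.range n, roofInd f₀ ρ₀ y₀ ((tildeF f₀)^[k] x)
  exact Finset.sum_congr rfl fun k _ => (roofInd_eq (hx k)).symm

lemma lapNumber_eq {x : ℝ} (hx : x ∈ fullOrbit f₀) (u : ℝ) :
    lapNumber f₀ ρ₀ y₀ x u = lapInd f₀ ρ₀ y₀ x u := by
  simp only [lapNumber, lapInd, roofSum_eq hx]

lemma flow_eq {p : (ℝ × ℝ) × ℝ} (hx : p.1.1 ∈ fullOrbit f₀) (t : ℝ) :
    flow f₀ ρ₀ y₀ t p = flowInd f₀ ρ₀ y₀ t p := by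
  simp only [flow, flowInd, roofSum_eq hx, lapNumber_eq hx]

lemma semiflow_eq {p : ℝ × ℝ} (hx : p.1 ∈ fullOrbit f₀) (t : ℝ) :
    semiflow f₀ ρ₀ y₀ t p = semiflowInd f₀ ρ₀ y₀ t p := by
  simp only [semiflow, semiflowInd, roofSum_eq hx, lapNumber_eq hx]

lemma roofIndSum_succ (n : ℕ) (x : ℝ) : roofIndSum f₀ ρ₀ y₀ (n + 1) x =
    roofIndSum f₀ ρ₀ y₀ n x + roofInd f₀ ρ₀ y₀ ((tildeF f₀)^[n] x) := birkhoffSum_succ _ _ _ _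

lemma roofIndSum_add (n k : ℕ) (x : ℝ) : roofIndSum f₀ ρ₀ y₀ (n + k) x =
    roofIndSum f₀ ρ₀ y₀ n x + roofIndSum f₀ ρ₀ y₀ k ((tildeF f₀)^[n] x) := birkhoffSum_add _ _ _ _ _

namespace AssumptionA

lemma roofIndSum_mono (hA : AssumptionA f₀) (hρ₀ : 0 < ρ₀) (hy₀ : 0 < y₀) (x : ℝ) :
    Monotone fun n => roofIndSum f₀ ρ₀ y₀ n x := monotone_nat_of_le_succ fun n => by
  rw [roofIndSum_succ]; linarith [hA.roofInd_nonneg hρ₀ hy₀ ((tildeF f₀)^[n] x)]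

lemma le_roofInd (hA : AssumptionA f₀) (hρ₀ : 0 < ρ₀) (hy₀ : 0 < y₀) {x : ℝ}
    (hx : x ∈ tildeDelta f₀) : ρ₀ * Real.log (deriv (g0 f₀) 1)⁻¹ ≤ roofInd f₀ ρ₀ y₀ x := by
  rw [roofInd_eq hx]; exact hA.roof_ge hρ₀ hy₀ hx

lemma le_roofIndSum (hA : AssumptionA f₀) (hρ₀ : 0 < ρ₀) (hy₀ : 0 < y₀) {x : ℝ}
    (hx : x ∈ fullOrbit f₀) (n : ℕ) :
    n * (ρ₀ * Real.log (deriv (g0 f₀) 1)⁻¹) ≤ roofIndSum f₀ ρ₀ y₀ n x := by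
  have h := Finset.card_nsmul_le_sum (Finset.range n) (fun k => roofInd f₀ ρ₀ y₀ ((tildeF f₀)^[k] x))
    (ρ₀ * Real.log (deriv (g0 f₀) 1)⁻¹) fun k _ => hA.le_roofInd hρ₀ hy₀ (hx k)
  rwa [Finset.card_range, nsmul_eq_mul] at h

lemma lapInd_spec (hA : AssumptionA f₀) (hρ₀ : 0 < ρ₀) (hy₀ : 0 < y₀) {x : ℝ}
    (hx : x ∈ fullOrbit f₀) {u : ℝ} (hu : 0 ≤ u) :
    roofIndSum f₀ ρ₀ y₀ (lapInd f₀ ρ₀ y₀ x u) x ≤ u ∧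
      u < roofIndSum f₀ ρ₀ y₀ (lapInd f₀ ρ₀ y₀ x u + 1) x := by
  have hne : {n : ℕ | u < roofIndSum f₀ ρ₀ y₀ (n + 1) x}.Nonempty := by
    have hc := hA.roof_lower_pos hρ₀
    obtain ⟨n, hn⟩ := exists_nat_gt (u / (ρ₀ * Real.log (deriv (g0 f₀) 1)⁻¹))
    rw [div_lt_iff₀ hc] at hn
    refine ⟨n, hn.trans_le ((hA.le_roofIndSum hρ₀ hy₀ hx n).trans ?_)⟩
    exact hA.roofIndSum_mono hρ₀ hy₀ x (Nat.le_succ n)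
  refine ⟨?_, Nat.sInf_mem hne⟩
  rcases Nat.eq_zero_or_pos (lapInd f₀ ρ₀ y₀ x u) with h | h
  · rw [h]; simpa [roofIndSum] using hu
  · obtain ⟨n, hn⟩ := Nat.exists_eq_succ_of_ne_zero h.ne'
    rw [hn]
    refine not_lt.1 fun hlt => ?_
    have hlt' : n < sInf {n : ℕ | u < roofIndSum f₀ ρ₀ y₀ (n + 1) x} := by
      change n < lapInd f₀ ρ₀ y₀ x u
      omega
    exact Nat.notMem_of_lt_sInf hlt' hlt

lemma lapInd_eq (hA : AssumptionA f₀) (hρ₀ : 0 < ρ₀) (hy₀ : 0 < y₀) {x u : ℝ} {n : ℕ}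
    (h1 : roofIndSum f₀ ρ₀ y₀ n x ≤ u) (h2 : u < roofIndSum f₀ ρ₀ y₀ (n + 1) x) :
    lapInd f₀ ρ₀ y₀ x u = n :=
  sInf_eq_of_mem_of_le h2 fun j hj => by
    by_contra! hlt
    exact absurd (lt_of_lt_of_le hj (hA.roofIndSum_mono hρ₀ hy₀ x (by omega : j + 1 ≤ n))) h1.not_gt

/-- The remaining height after flowing stays below the roof. -/
lemma semiflowInd_mem (hA : AssumptionA f₀) (hρ₀ : 0 < ρ₀) (hy₀ : 0 < y₀) {x a t : ℝ}
    (hx : x ∈ fullOrbit f₀) (hu : 0 ≤ a + t) : (semiflowInd f₀ ρ₀ y₀ t (x, a)).1 ∈ fullOrbit f₀ ∧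
      0 ≤ (semiflowInd f₀ ρ₀ y₀ t (x, a)).2 ∧
      (semiflowInd f₀ ρ₀ y₀ t (x, a)).2 < roofInd f₀ ρ₀ y₀ (semiflowInd f₀ ρ₀ y₀ t (x, a)).1 := by
  obtain ⟨h1, h2⟩ := hA.lapInd_spec hρ₀ hy₀ hx hu
  rw [roofIndSum_succ] at h2
  exact ⟨iterate_mem_fullOrbit hx _, by simp only [semiflowInd]; linarith,
    by simp only [semiflowInd]; linarith⟩

lemma flowInd_fst (p : (ℝ × ℝ) × ℝ) (t : ℝ) : (flowInd f₀ ρ₀ y₀ t p).1.1 =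
    (semiflowInd f₀ ρ₀ y₀ t (projR p)).1 := fst_tildeP_iterate _ _

lemma snd_tildeP_pos (hA : AssumptionA f₀) {x y : ℝ} (hx : x ∈ tildeDelta f₀) (hy : 0 < y) :
    0 < (tildeP f₀ (x, y)).2 := by
  rw [hA.tildeDelta_eq] at hx
  obtain ⟨i, i', z, hz, rfl⟩ := hx
  rw [hA.tildeP_eq i i' hz]
  exact hA.fibreBranch_pos i' (hA.fibreBranch_pos i hy)

lemma tildeP_mk (x y : ℝ) : tildeP f₀ (x, y) = (tildeF f₀ x, (tildeP f₀ (x, y)).2) :=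
  Prod.ext (fst_tildeP _) rfl

lemma snd_iterate_pos (hA : AssumptionA f₀) {x y : ℝ} (hx : x ∈ fullOrbit f₀) (hy : 0 < y) (n : ℕ) :
    0 < ((tildeP f₀)^[n] (x, y)).2 := by
  induction n generalizing x y with
  | zero => exact hy
  | succ n ih =>
    rw [Function.iterate_succ_apply, tildeP_mk]
    exact ih (iterate_mem_fullOrbit hx 1) (hA.snd_tildeP_pos (mem_tildeDelta_of_mem_fullOrbit hx) hy)

lemma flowInd_mem (hA : AssumptionA f₀) (hρ₀ : 0 < ρ₀) (hy₀ : 0 < y₀) {p : (ℝ × ℝ) × ℝ} {t : ℝ}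
    (hx : p.1.1 ∈ fullOrbit f₀) (hy : 0 < p.1.2) (hu : 0 ≤ p.2 + t) :
    flowInd f₀ ρ₀ y₀ t p ∈ sigmaR f₀ ρ₀ y₀ := by
  obtain ⟨h1, h2, h3⟩ := hA.semiflowInd_mem hρ₀ hy₀ (a := p.2) hx hu
  have h4 := mem_tildeDelta_of_mem_fullOrbit h1
  have e := flowInd_fst (f₀ := f₀) (ρ₀ := ρ₀) (y₀ := y₀) p t
  refine ⟨⟨?_, hA.snd_iterate_pos hx hy _⟩, h2, ?_⟩
  · rw [e]; exact h4
  · rw [e]; exact (roofInd_eq h4) ▸ h3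

/-- The flow property along full orbits. -/
lemma flowInd_flowInd (hA : AssumptionA f₀) (hρ₀ : 0 < ρ₀) (hy₀ : 0 < y₀) {p : (ℝ × ℝ) × ℝ} {t : ℝ}
    (hx : p.1.1 ∈ fullOrbit f₀) (ha : 0 ≤ p.2) (ht : 0 ≤ t) :
    flowInd f₀ ρ₀ y₀ t (flowInd f₀ ρ₀ y₀ t p) = flowInd f₀ ρ₀ y₀ (2 * t) p := by
  set n := lapInd f₀ ρ₀ y₀ p.1.1 (p.2 + t) with hn
  obtain ⟨h1, h2, h3⟩ := hA.semiflowInd_mem hρ₀ hy₀ (a := p.2) hx (by positivity : 0 ≤ p.2 + t)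
  have h2' : 0 ≤ p.2 + t - roofIndSum f₀ ρ₀ y₀ n p.1.1 := h2
  set k := lapInd f₀ ρ₀ y₀ ((tildeF f₀)^[n] p.1.1) (p.2 + t - roofIndSum f₀ ρ₀ y₀ n p.1.1 + t) with hk
  obtain ⟨h4, h5⟩ := hA.lapInd_spec hρ₀ hy₀ h1
    (by linarith : 0 ≤ p.2 + t - roofIndSum f₀ ρ₀ y₀ n p.1.1 + t)
  have h4' : roofIndSum f₀ ρ₀ y₀ k ((tildeF f₀)^[n] p.1.1) ≤ p.2 + t - roofIndSum f₀ ρ₀ y₀ n p.1.1 + t := h4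
  have h5' : p.2 + t - roofIndSum f₀ ρ₀ y₀ n p.1.1 + t <
    roofIndSum f₀ ρ₀ y₀ (k + 1) ((tildeF f₀)^[n] p.1.1) := h5
  -- Laps add: n returns up to time t, then k more from the point reached.
  have hlap : lapInd f₀ ρ₀ y₀ p.1.1 (p.2 + 2 * t) = n + k := by
    refine hA.lapInd_eq hρ₀ hy₀ ?_ ?_
    · rw [roofIndSum_add]; linarith
    · rw [add_assoc, roofIndSum_add]; linarith
  have e1 : ((tildeP f₀)^[n] p.1).1 = (tildeF f₀)^[n] p.1.1 := fst_tildeP_iterate _ _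
  have e2 : flowInd f₀ ρ₀ y₀ t p = ((tildeP f₀)^[n] p.1, p.2 + t - roofIndSum f₀ ρ₀ y₀ n p.1.1) := rfl
  rw [e2]
  simp only [flowInd]
  rw [hlap, e1, ← hk, roofIndSum_add]
  refine Prod.ext ?_ ?_
  · simp only
    rw [← Function.iterate_add_apply, add_comm]
  · simp only
    ring

/-! ### Contraction along the fibres -/

lemma abs_iter_sub_le_self (hA : AssumptionA f₀) (j : ℕ) {u v : ℝ} (hu : 0 < u) (hv : 0 < v) :
    |(g0 f₀)^[j] u - (g0 f₀)^[j] v| ≤ |u - v| := by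
  have h := (convex_Ioi (0 : ℝ)).norm_image_sub_le_of_norm_hasDerivWithin_le (C := 1)
    (fun x hx => (hA.hasStrictDerivAt_iter j hx).hasDerivAt.hasDerivWithinAt)
    (fun x hx => ?_) (mem_Ioi.2 hv) (mem_Ioi.2 hu)
  · simpa using h
  · rw [Real.norm_of_nonneg (Finset.prod_nonneg fun i _ => (hA.deriv_g0_pos (hA.iter_pos i hx)).le)]
    exact Finset.prod_le_one (fun i _ => (hA.deriv_g0_pos (hA.iter_pos i hx)).le)
      fun i _ => (hA.deriv_g0_lt_one (hA.iter_pos i hx)).le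

/-- g₀ maps the whole half-line into (0,1), and the translation and further iterates do not increase
distances. Thus one step collapses the unbounded fibre to diameter at most 1. -/
lemma abs_fibreBranch_sub_le_one (hA : AssumptionA f₀) (i : ℕ × ℕ) {y y' : ℝ} (hy : 0 < y)
    (hy' : 0 < y') : |fibreBranch f₀ i y - fibreBranch f₀ i y'| ≤ 1 := by
  have h1 := hA.g0_mem hy
  have h2 := hA.g0_mem hy'
  have hk := Nat.cast_nonneg (α := ℝ) i.1
  refine (hA.abs_iter_sub_le_self i.2 (by linarith [h1.1]) (by linarith [h2.1])).trans ?_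
  rw [add_sub_add_left_eq_sub]
  exact abs_le.2 ⟨by linarith [h1.1, h2.2], by linarith [h1.2, h2.1]⟩

lemma abs_snd_tildeP_sub_le (hA : AssumptionA f₀) {x y y' : ℝ} (hx : x ∈ tildeDelta f₀) (hy : 0 < y)
    (hy' : 0 < y') : |(tildeP f₀ (x, y)).2 - (tildeP f₀ (x, y')).2| ≤ deriv (g0 f₀) 1 * |y - y'| ∧
      |(tildeP f₀ (x, y)).2 - (tildeP f₀ (x, y')).2| ≤ 1 := by
  rw [hA.tildeDelta_eq] at hx
  obtain ⟨i, i', z, hz, rfl⟩ := hx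
  rw [hA.tildeP_eq i i' hz, hA.tildeP_eq i i' hz]
  refine ⟨?_, hA.abs_fibreBranch_sub_le_one i' (hA.fibreBranch_pos i hy) (hA.fibreBranch_pos i hy')⟩
  refine (convex_Ioi (0 : ℝ)).norm_image_sub_le_of_norm_hasDerivWithin_le
    (f := fun y => fibreBranch f₀ i' (fibreBranch f₀ i y))
    (fun w hw => ((hA.hasDerivAt_fibreBranch i' (hA.fibreBranch_pos i hw)).comp w
      (hA.hasDerivAt_fibreBranch i hw)).hasDerivWithinAt)
    (fun w hw => ?_) (mem_Ioi.2 hy') (mem_Ioi.2 hy)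
  rw [Real.norm_of_nonneg (mul_pos (hA.fibreDeriv_pos i' (hA.fibreBranch_pos i hw))
    (hA.fibreDeriv_pos i hw)).le]
  exact hA.fibreDeriv_mul_le i i' hw

lemma abs_snd_iterate_sub_le (hA : AssumptionA f₀) {x y y' : ℝ} (hx : x ∈ fullOrbit f₀) (hy : 0 < y)
    (hy' : 0 < y') (n : ℕ) : |((tildeP f₀)^[n] (x, y)).2 - ((tildeP f₀)^[n] (x, y')).2| ≤
      deriv (g0 f₀) 1 ^ n * |y - y'| := by
  have hl := hA.deriv_g0_pos one_pos
  induction n generalizing x y y' with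
  | zero => simp
  | succ n ih =>
    have hx0 := mem_tildeDelta_of_mem_fullOrbit hx
    rw [Function.iterate_succ_apply, Function.iterate_succ_apply, tildeP_mk x y, tildeP_mk x y']
    refine (ih (iterate_mem_fullOrbit hx 1) (hA.snd_tildeP_pos hx0 hy) (hA.snd_tildeP_pos hx0 hy')).trans ?_
    rw [pow_succ, mul_assoc]
    exact mul_le_mul_of_nonneg_left (hA.abs_snd_tildeP_sub_le hx0 hy hy').1 (by positivity)

/-- A bound free of the initial distance: the first return is used up to reach distance 1 and only
the remaining n contract. -/
lemma abs_snd_iterate_succ_sub_le (hA : AssumptionA f₀) {x y y' : ℝ} (hx : x ∈ fullOrbit f₀)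
    (hy : 0 < y) (hy' : 0 < y') (n : ℕ) :
    |((tildeP f₀)^[n + 1] (x, y)).2 - ((tildeP f₀)^[n + 1] (x, y')).2| ≤ deriv (g0 f₀) 1 ^ n := by
  have hl := hA.deriv_g0_pos one_pos
  have hx0 := mem_tildeDelta_of_mem_fullOrbit hx
  rw [Function.iterate_succ_apply, Function.iterate_succ_apply, tildeP_mk x y, tildeP_mk x y']
  refine (hA.abs_snd_iterate_sub_le (iterate_mem_fullOrbit hx 1) (hA.snd_tildeP_pos hx0 hy)
    (hA.snd_tildeP_pos hx0 hy') n).trans ?_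
  exact mul_le_of_le_one_right (by positivity) (hA.abs_snd_tildeP_sub_le hx0 hy hy').2

/-- Mean value inequality along a vertical segment, which stays in Σ_r because the roof depends on x
only. -/
lemma abs_sub_le_of_isC1bStar {V : (ℝ × ℝ) × ℝ → ℝ} (hV : IsC1bStar (sigmaR f₀ ρ₀ y₀) V) {M : ℝ}
    (hM : ∀ p ∈ sigmaR f₀ ρ₀ y₀, ‖fderivWithin ℝ V (sigmaR f₀ ρ₀ y₀) p‖ ≤ M) {x s y y' : ℝ}
    (hx : x ∈ tildeDelta f₀) (hs : 0 ≤ s) (hs' : s < roof f₀ ρ₀ y₀ x) (hy : 0 < y) (hy' : 0 < y') :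
    |V ((x, y), s) - V ((x, y'), s)| ≤ M * |y - y'| := by
  set L : ℝ →L[ℝ] (ℝ × ℝ) × ℝ := (ContinuousLinearMap.inl ℝ (ℝ × ℝ) ℝ).comp
    (ContinuousLinearMap.inr ℝ ℝ ℝ) with hL
  have hmem : ∀ w ∈ Ioi (0 : ℝ), ((x, w), s) ∈ sigmaR f₀ ρ₀ y₀ := fun w hw => ⟨⟨hx, hw⟩, hs, hs'⟩
  have hder : ∀ w ∈ Ioi (0 : ℝ), HasDerivWithinAt (fun w => V ((x, w), s))
      (fderivWithin ℝ V (sigmaR f₀ ρ₀ y₀) ((x, w), s) ((0, 1), 0)) (Ioi 0) w := by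
    intro w hw
    have h1 := ((hV.contDiffOn.differentiableOn one_ne_zero) _ (hmem w hw)).hasFDerivWithinAt
    have h2 : HasDerivWithinAt (fun w : ℝ => ((x, w), s)) (((0 : ℝ), (1 : ℝ)), (0 : ℝ)) (Ioi 0) w :=
      (((hasDerivAt_const w x).prodMk (hasDerivAt_id w)).prodMk
        (hasDerivAt_const w s)).hasDerivWithinAt
    exact h1.comp_hasDerivWithinAt w h2 hmem
  refine (convex_Ioi (0 : ℝ)).norm_image_sub_le_of_norm_hasDerivWithin_le hder (fun w hw => ?_)
    (mem_Ioi.2 hy') (mem_Ioi.2 hy)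
  refine (ContinuousLinearMap.le_opNorm _ _).trans ?_
  have : ‖(((0 : ℝ), (1 : ℝ)), (0 : ℝ))‖ = 1 := by simp [Prod.norm_def]
  rw [this, mul_one]
  exact hM _ (hmem w hw)

/-- Along a fibre, observables composed with the flow differ by a power of the contraction rate. -/
lemma exists_abs_flowInd_sub_le (hA : AssumptionA f₀) (hρ₀ : 0 < ρ₀) (hy₀ : 0 < y₀)
    {V : (ℝ × ℝ) × ℝ → ℝ} (hV : IsC1bStar (sigmaR f₀ ρ₀ y₀) V) :
    ∃ C : ℝ, 0 < C ∧ ∀ x ∈ fullOrbit f₀, ∀ y y' a t : ℝ, 0 < y → 0 < y' → 0 ≤ a + t →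
      |V (flowInd f₀ ρ₀ y₀ t ((x, y), a)) - V (flowInd f₀ ρ₀ y₀ t ((x, y'), a))| ≤
        C * deriv (g0 f₀) 1 ^ lapInd f₀ ρ₀ y₀ x (a + t) := by
  obtain ⟨B, hB⟩ := hV.bounded
  obtain ⟨M, hM⟩ := hV.bounded_deriv
  have hl := hA.deriv_g0_pos one_pos
  -- With zero laps only boundedness of V is available. With n ≥ 1 laps the exponent n - 1 costs the
  -- factor g₀'(1)⁻¹.
  refine ⟨2 * |B| + |M| * (deriv (g0 f₀) 1)⁻¹ + 1, by positivity, fun x hx y y' a t hy hy' hu => ?_⟩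
  have hm1 := hA.flowInd_mem hρ₀ hy₀ (p := ((x, y), a)) hx hy hu
  have hm2 := hA.flowInd_mem hρ₀ hy₀ (p := ((x, y'), a)) hx hy' hu
  obtain ⟨g1, g2, g3⟩ := hA.semiflowInd_mem hρ₀ hy₀ (a := a) hx hu
  rw [roofInd_eq (mem_tildeDelta_of_mem_fullOrbit g1)] at g3
  set n := lapInd f₀ ρ₀ y₀ x (a + t) with hn
  rcases Nat.eq_zero_or_pos n with h0 | h0
  · rw [h0, pow_zero, mul_one]
    have h1 := abs_sub (V (flowInd f₀ ρ₀ y₀ t ((x, y), a))) (V (flowInd f₀ ρ₀ y₀ t ((x, y'), a)))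
    have h2 := (hB _ hm1).trans (le_abs_self B)
    have h3 := (hB _ hm2).trans (le_abs_self B)
    have h4 : 0 ≤ |M| * (deriv (g0 f₀) 1)⁻¹ := by positivity
    linarith
  · obtain ⟨k, hk⟩ := Nat.exists_eq_succ_of_ne_zero h0.ne'
    -- The flowed points differ in y alone, since lap number and remaining height are functions of
    -- (x, a).
    have e : ∀ w, flowInd f₀ ρ₀ y₀ t ((x, w), a) =
        (((semiflowInd f₀ ρ₀ y₀ t (x, a)).1, ((tildeP f₀)^[n] (x, w)).2),
          (semiflowInd f₀ ρ₀ y₀ t (x, a)).2) := fun w =>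
      Prod.ext (Prod.ext (flowInd_fst _ _) rfl) rfl
    rw [e y, e y']
    have h1 := abs_sub_le_of_isC1bStar hV (M := |M|) (fun p hp => (hM p hp).trans (le_abs_self M))
      (mem_tildeDelta_of_mem_fullOrbit g1) g2 g3 (hA.snd_iterate_pos hx hy n) (hA.snd_iterate_pos hx hy' n)
    refine h1.trans ?_
    rw [hk]
    have h2 := hA.abs_snd_iterate_succ_sub_le hx hy hy' k
    have h3 : deriv (g0 f₀) 1 ^ k = (deriv (g0 f₀) 1)⁻¹ * deriv (g0 f₀) 1 ^ (k + 1) := by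
      rw [pow_succ]; field_simp
    calc |M| * |((tildeP f₀)^[k + 1] (x, y)).2 - ((tildeP f₀)^[k + 1] (x, y')).2|
        ≤ |M| * ((deriv (g0 f₀) 1)⁻¹ * deriv (g0 f₀) 1 ^ (k + 1)) := by rw [← h3]; gcongr
      _ = (|M| * (deriv (g0 f₀) 1)⁻¹) * deriv (g0 f₀) 1 ^ (k + 1) := by ring
      _ ≤ _ := by
        refine mul_le_mul_of_nonneg_right ?_ (by positivity)
        have := abs_nonneg B
        linarith

end AssumptionA

/-! ### Measurability of the flow -/

namespace AssumptionA

lemma measurable_lapInd (hA : AssumptionA f₀) (hm : Measurable (baseP f₀)) (hy₀ : 0 < y₀) :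
    Measurable fun q : ℝ × ℝ => lapInd f₀ ρ₀ y₀ q.1 q.2 :=
  measurable_sInf_nat fun n => measurableSet_lt measurable_snd
    ((hA.measurable_roofIndSum hm hy₀ (n + 1)).comp measurable_fst)

lemma measurable_roofIndSum_comp (hA : AssumptionA f₀) (hm : Measurable (baseP f₀)) (hy₀ : 0 < y₀)
    {β : Type*} [MeasurableSpace β] {N : β → ℕ} (hN : Measurable N) {g : β → ℝ} (hg : Measurable g) :
    Measurable fun x => roofIndSum f₀ ρ₀ y₀ (N x) (g x) := by
  have h : Measurable fun q : ℕ × ℝ => roofIndSum f₀ ρ₀ y₀ q.1 q.2 :=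
    measurable_from_prod_countable_right fun n => hA.measurable_roofIndSum hm hy₀ n
  exact h.comp (hN.prodMk hg)

lemma measurable_flowInd (hA : AssumptionA f₀) (hm : Measurable (baseP f₀)) (hy₀ : 0 < y₀) (t : ℝ) :
    Measurable (flowInd f₀ ρ₀ y₀ t) := by
  have hN : Measurable fun p : (ℝ × ℝ) × ℝ => lapInd f₀ ρ₀ y₀ p.1.1 (p.2 + t) :=
    (hA.measurable_lapInd hm hy₀).comp (measurable_fst.fst.prodMk (measurable_snd.add_const t))
  exact (measurable_iterate_comp (measurable_tildeP hm) hN measurable_fst).prodMk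
    ((measurable_snd.add_const t).sub (hA.measurable_roofIndSum_comp hm hy₀ hN measurable_fst.fst))

lemma measurable_semiflowInd (hA : AssumptionA f₀) (hm : Measurable (baseP f₀)) (hy₀ : 0 < y₀)
    (t : ℝ) : Measurable (semiflowInd f₀ ρ₀ y₀ t) := by
  have hN : Measurable fun p : ℝ × ℝ => lapInd f₀ ρ₀ y₀ p.1 (p.2 + t) :=
    (hA.measurable_lapInd hm hy₀).comp (measurable_fst.prodMk (measurable_snd.add_const t))
  exact (measurable_iterate_comp (measurable_tildeF hm) hN measurable_fst).prodMk
    ((measurable_snd.add_const t).sub (hA.measurable_roofIndSum_comp hm hy₀ hN measurable_fst))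

lemma measurableSet_sigmaR (hA : AssumptionA f₀) (hy₀ : 0 < y₀) :
    MeasurableSet (sigmaR f₀ ρ₀ y₀) := by
  have h : sigmaR f₀ ρ₀ y₀ = (Prod.fst ⁻¹' baseSigma f₀) ∩
      ({p | (0 : ℝ) ≤ p.2} ∩ {p | p.2 < roofInd f₀ ρ₀ y₀ p.1.1}) := by
    ext p
    constructor
    · rintro ⟨h1, h2, h3⟩
      exact ⟨h1, h2, by rw [mem_ofPred_eq, roofInd_eq h1.1]; exact h3⟩
    · rintro ⟨h1, h2, h3⟩
      exact ⟨h1, h2, by rw [mem_ofPred_eq, roofInd_eq h1.1] at h3; exact h3⟩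
  rw [h]
  exact (measurable_fst hA.measurableSet_baseSigma).inter
    ((measurableSet_le measurable_const measurable_snd).inter
      (measurableSet_lt measurable_snd ((hA.measurable_roofInd hy₀).comp measurable_fst.fst)))

lemma ae_muHat_mem_fullOrbit (hA : AssumptionA f₀) (hC : AssumptionC f₀ m) :
    ∀ᵐ x ∂(muHat f₀ m), x ∈ fullOrbit f₀ := by
  refine ae_all_iff.2 fun n => ?_
  exact ((hA.measurePreserving_tildeF hC).iterate n).quasiMeasurePreserving.ae hA.ae_muHat_mem_tildeDelta

/-- Exponential moments of the Birkhoff sums of the roof with respect to `μ̂`. -/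
lemma exists_moment (hA : AssumptionA f₀) (hB : AssumptionB f₀) (hC : AssumptionC f₀ m)
    (hρ₀ : 0 < ρ₀) (hy₀ : 0 < y₀) : ∃ η C K : ℝ, 0 < η ∧ 0 ≤ C ∧ 1 ≤ K ∧ ∀ n : ℕ,
      ∫⁻ x, ENNReal.ofReal (Real.exp (η * roofIndSum f₀ ρ₀ y₀ n x)) ∂(muHat f₀ m) ≤
        ENNReal.ofReal (C * K ^ n) := by
  obtain ⟨η, hη, K, hK, hle⟩ := hA.exists_lintegral_exp_le (ρ₀ := ρ₀) hB (measurable_baseP_of_ergodic hC) hρ₀ hy₀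
  obtain ⟨C, hCtop, hmu⟩ := hA.exists_muHat_le hB hC
  refine ⟨η, C.toReal, max 1 K.toReal, hη, ENNReal.toReal_nonneg, le_max_left _ _, fun n => ?_⟩
  calc ∫⁻ x, ENNReal.ofReal (Real.exp (η * roofIndSum f₀ ρ₀ y₀ n x)) ∂(muHat f₀ m)
      ≤ ∫⁻ x, ENNReal.ofReal (Real.exp (η * roofIndSum f₀ ρ₀ y₀ n x)) ∂(C • volume.restrict (baseI f₀)) :=
        lintegral_mono' hmu le_rfl
    _ = C * ∫⁻ x in baseI f₀, ENNReal.ofReal (Real.exp (η * roofIndSum f₀ ρ₀ y₀ n x)) :=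
        lintegral_smul_measure _ _
    _ ≤ C * K ^ n := mul_le_mul' le_rfl (hle n)
    _ ≤ _ := by
        rw [ENNReal.ofReal_mul ENNReal.toReal_nonneg, ENNReal.ofReal_toReal hCtop,
          ENNReal.ofReal_pow (zero_le_one.trans (le_max_left _ _))]
        refine mul_le_mul' le_rfl (pow_le_pow_left' ?_ n)
        rw [← ENNReal.ofReal_toReal hK, ENNReal.toReal_ofReal ENNReal.toReal_nonneg]
        exact ENNReal.ofReal_le_ofReal (le_max_right _ _)

/-- Fubini: the vertical segment over x has length r(x), which becomes a weight on the base. -/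
lemma lintegral_sigmaR_le (hA : AssumptionA f₀) (hy₀ : 0 < y₀) {Θ : ℝ → ℝ≥0∞} (hΘ : Measurable Θ) :
    ∫⁻ p in sigmaR f₀ ρ₀ y₀, Θ p.1.1 ∂((nu f₀ m).prod volume) ≤
      ∫⁻ x, Θ x * ENNReal.ofReal (roofInd f₀ ρ₀ y₀ x) ∂(muHat f₀ m) := by
  set S : Set ((ℝ × ℝ) × ℝ) := {p | (0 : ℝ) ≤ p.2} ∩ {p | p.2 < roofInd f₀ ρ₀ y₀ p.1.1} with hS
  have hSm : MeasurableSet S := (measurableSet_le measurable_const measurable_snd).inter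
      (measurableSet_lt measurable_snd ((hA.measurable_roofInd hy₀).comp measurable_fst.fst))
  have hsub : sigmaR f₀ ρ₀ y₀ ⊆ S := by
    rintro p ⟨h1, h2, h3⟩
    exact ⟨h2, by rw [mem_ofPred_eq, roofInd_eq h1.1]; exact h3⟩
  have hmeas : Measurable fun p : (ℝ × ℝ) × ℝ => Θ p.1.1 := hΘ.comp measurable_fst.fst
  calc ∫⁻ p in sigmaR f₀ ρ₀ y₀, Θ p.1.1 ∂((nu f₀ m).prod volume)
      ≤ ∫⁻ p in S, Θ p.1.1 ∂((nu f₀ m).prod volume) := lintegral_mono_set hsub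
    _ = ∫⁻ p, S.indicator (fun p => Θ p.1.1) p ∂((nu f₀ m).prod volume) := (lintegral_indicator hSm _).symm
    _ = ∫⁻ z, (∫⁻ s : ℝ, S.indicator (fun p => Θ p.1.1) (z, s)) ∂(nu f₀ m) :=
        lintegral_prod _ (hmeas.indicator hSm).aemeasurable
    _ = ∫⁻ z, Θ z.1 * ENNReal.ofReal (roofInd f₀ ρ₀ y₀ z.1) ∂(nu f₀ m) := by
        refine lintegral_congr fun z => ?_
        have e : ∀ s : ℝ, S.indicator (fun p => Θ p.1.1) (z, s) =
            (Ico 0 (roofInd f₀ ρ₀ y₀ z.1)).indicator (fun _ => Θ z.1) s := fun s => rfl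
        simp_rw [e]
        rw [lintegral_indicator measurableSet_Ico, setLIntegral_const, Real.volume_Ico, sub_zero]
    _ = _ := by
        have hmeas' : Measurable fun x => Θ x * ENNReal.ofReal (roofInd f₀ ρ₀ y₀ x) :=
          hΘ.mul (hA.measurable_roofInd hy₀).ennreal_ofReal
        rw [muHat, lintegral_map hmeas' measurable_fst]

end AssumptionA

/-- Optimizing the number of laps in the large deviation estimate. -/
lemma exists_exponential_rate {l K η c A : ℝ} (hl : 0 < l) (hl1 : l < 1) (hK : 1 ≤ K) (hη : 0 < η)
    (hc : 0 < c) (hA : 0 ≤ A) : ∃ δ C : ℝ, 0 < δ ∧ 0 ≤ C ∧ ∀ t : ℝ, 0 ≤ t → ∃ N : ℕ,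
      A * (l ^ N + (⌊t / c⌋₊ + 2 : ℕ) * (Real.exp (-η * t) * (1 + K ^ N))) ≤ C * Real.exp (-δ * t) := by
  have hlogK : 0 ≤ Real.log K := Real.log_nonneg hK
  have hK0 : 0 < K := one_pos.trans_le hK
  have hlog : 0 < -Real.log l := neg_pos.2 (Real.log_neg hl hl1)
  -- With N = ⌊εt⌋ the growth K^N is at most exp(ηt/2), and the linear number of terms costs another
  -- exp(ηt/4). A factor exp(-ηt/4) is left, against λ^N of order exp(-ε|log λ|t).
  set ε := η / (2 * (Real.log K + 1)) with hε
  have hε0 : 0 < ε := by positivity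
  set δ := min (η / 4) (ε * -Real.log l) with hδ
  have hδ0 : 0 < δ := lt_min (by positivity) (by positivity)
  refine ⟨δ, A * (l⁻¹ + (4 / (η * c) + 2) * 2), hδ0, by positivity, fun t ht => ⟨⌊ε * t⌋₊, ?_⟩⟩
  set N := ⌊ε * t⌋₊ with hN
  have hN1 : (N : ℝ) ≤ ε * t := Nat.floor_le (by positivity)
  have hN2 : ε * t < N + 1 := Nat.lt_floor_add_one _
  have h1 : l ^ N ≤ l⁻¹ * Real.exp (-δ * t) := by
    have e : l ^ N = l⁻¹ * l ^ (N + 1) := by rw [pow_succ]; field_simp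
    rw [e]
    refine mul_le_mul_of_nonneg_left ?_ (by positivity)
    rw [← Real.exp_log (pow_pos hl (N + 1)), Real.log_pow, Real.exp_le_exp]
    push_cast
    have h2 : δ ≤ ε * -Real.log l := min_le_right _ _
    have h3 : δ * t ≤ ε * -Real.log l * t := mul_le_mul_of_nonneg_right h2 ht
    nlinarith
  have h2 : K ^ N ≤ Real.exp (η / 2 * t) := by
    rw [← Real.exp_log (pow_pos hK0 N), Real.log_pow, Real.exp_le_exp]
    have h3 : ε * (Real.log K + 1) = η / 2 := by rw [hε]; field_simp
    calc N * Real.log K ≤ ε * t * Real.log K := mul_le_mul_of_nonneg_right hN1 hlogK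
      _ ≤ ε * t * (Real.log K + 1) := by gcongr; linarith
      _ = η / 2 * t := by rw [← h3]; ring
  have h3 : 1 + K ^ N ≤ 2 * Real.exp (η / 2 * t) := by
    have := Real.one_le_exp (show 0 ≤ η / 2 * t by positivity)
    linarith
  have h4 : ((⌊t / c⌋₊ + 2 : ℕ) : ℝ) ≤ (4 / (η * c) + 2) * Real.exp (η / 4 * t) := by
    have e1 := Nat.floor_le (show 0 ≤ t / c by positivity)
    have e2 := Real.add_one_le_exp (η / 4 * t)
    have e3 := Real.one_le_exp (show 0 ≤ η / 4 * t by positivity)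
    have e4 : t / c = 4 / (η * c) * (η / 4 * t) := by field_simp
    have e5 : 4 / (η * c) * (η / 4 * t) ≤ 4 / (η * c) * Real.exp (η / 4 * t) :=
      mul_le_mul_of_nonneg_left (by linarith) (by positivity)
    push_cast
    rw [add_mul]
    linarith
  rw [mul_assoc]
  refine mul_le_mul_of_nonneg_left ?_ hA
  rw [add_mul]
  refine add_le_add h1 ?_
  calc ((⌊t / c⌋₊ + 2 : ℕ) : ℝ) * (Real.exp (-η * t) * (1 + K ^ N))
      ≤ (4 / (η * c) + 2) * Real.exp (η / 4 * t) * (Real.exp (-η * t) * (2 * Real.exp (η / 2 * t))) := by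
        gcongr
    _ = (4 / (η * c) + 2) * 2 * (Real.exp (η / 4 * t) * Real.exp (-η * t) * Real.exp (η / 2 * t)) := by ring
    _ = (4 / (η * c) + 2) * 2 * Real.exp (-(η / 4) * t) := by
        rw [← Real.exp_add, ← Real.exp_add]; congr 2; ring
    _ ≤ _ := by
        refine mul_le_mul_of_nonneg_left (Real.exp_le_exp.2 ?_) (by positivity)
        have : δ ≤ η / 4 := min_le_left _ _
        nlinarith

/-! ### Large deviations for the number of laps -/

namespace AssumptionA

/-- The number of laps completed between times `t` and `2 t`. -/
def laterLaps (f₀ : ℝ → ℝ) (ρ₀ y₀ t : ℝ) (q : ℝ × ℝ) : ℕ :=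
  lapInd f₀ ρ₀ y₀ (semiflowInd f₀ ρ₀ y₀ t q).1 ((semiflowInd f₀ ρ₀ y₀ t q).2 + t)

/-- Either at least N later laps occur, or r^{(N)} at the point reached at time t exceeds t, so that
exp(η(r^{(N)} - t)) ≥ 1. Summing over all possible lap counts at time t removes the dependence on
the starting height. -/
lemma pow_laterLaps_le (hA : AssumptionA f₀) (hρ₀ : 0 < ρ₀) (hy₀ : 0 < y₀) {η : ℝ} (hη : 0 < η) (N : ℕ)
    {x a t : ℝ} (hx : x ∈ fullOrbit f₀) (ha : 0 ≤ a) (ha' : a < roofInd f₀ ρ₀ y₀ x) (ht : 0 ≤ t) :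
    deriv (g0 f₀) 1 ^ laterLaps f₀ ρ₀ y₀ t (x, a) ≤ deriv (g0 f₀) 1 ^ N +
      ∑ k ∈ Finset.range (⌊t / (ρ₀ * Real.log (deriv (g0 f₀) 1)⁻¹)⌋₊ + 2),
        Real.exp (-η * t) * Real.exp (η * roofIndSum f₀ ρ₀ y₀ N ((tildeF f₀)^[k] x)) := by
  have hl := hA.deriv_g0_pos one_pos
  have hl1 := hA.deriv_g0_lt_one one_pos
  have hc := hA.roof_lower_pos hρ₀
  set c := ρ₀ * Real.log (deriv (g0 f₀) 1)⁻¹ with hcdef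
  have hsum0 : 0 ≤ ∑ k ∈ Finset.range (⌊t / c⌋₊ + 2),
      Real.exp (-η * t) * Real.exp (η * roofIndSum f₀ ρ₀ y₀ N ((tildeF f₀)^[k] x)) :=
    Finset.sum_nonneg fun _ _ => by positivity
  rcases le_or_gt N (laterLaps f₀ ρ₀ y₀ t (x, a)) with h | h
  · have := pow_le_pow_of_le_one hl.le hl1.le h
    linarith
  · obtain ⟨g1, g2, g3⟩ := hA.semiflowInd_mem hρ₀ hy₀ (a := a) hx (by positivity : 0 ≤ a + t)
    obtain ⟨-, h2⟩ := hA.lapInd_spec hρ₀ hy₀ g1 (add_nonneg g2 ht)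
    have h3 : t < roofIndSum f₀ ρ₀ y₀ N (semiflowInd f₀ ρ₀ y₀ t (x, a)).1 :=
      (le_add_of_nonneg_left g2).trans_lt (h2.trans_le (hA.roofIndSum_mono hρ₀ hy₀ _ h))
    obtain ⟨h4, -⟩ := hA.lapInd_spec hρ₀ hy₀ hx (by positivity : 0 ≤ a + t)
    -- The first lap may take arbitrarily little time, as a can be close to r(x). Only the laps
    -- after it cost at least c each, so the lap count is at most ⌊t/c⌋ + 1.
    have hn : lapInd f₀ ρ₀ y₀ x (a + t) < ⌊t / c⌋₊ + 2 := by
      by_contra! hge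
      obtain ⟨n, hn⟩ : ∃ n, lapInd f₀ ρ₀ y₀ x (a + t) = 1 + n :=
        ⟨lapInd f₀ ρ₀ y₀ x (a + t) - 1, by omega⟩
      rw [hn, roofIndSum_add] at h4
      have e1 : roofIndSum f₀ ρ₀ y₀ 1 x = roofInd f₀ ρ₀ y₀ x := birkhoffSum_one _ _ _
      have e2 := hA.le_roofIndSum hρ₀ hy₀ (iterate_mem_fullOrbit hx 1) n
      have e3 : (n : ℝ) * c ≤ t := by linarith
      have e4 : n ≤ ⌊t / c⌋₊ := Nat.le_floor ((le_div_iff₀ hc).2 e3)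
      omega
    have h5 : (1 : ℝ) ≤ Real.exp (-η * t) * Real.exp (η * roofIndSum f₀ ρ₀ y₀ N
        ((tildeF f₀)^[lapInd f₀ ρ₀ y₀ x (a + t)] x)) := by
      rw [← Real.exp_add]
      refine Real.one_le_exp ?_
      have h6 : t < roofIndSum f₀ ρ₀ y₀ N ((tildeF f₀)^[lapInd f₀ ρ₀ y₀ x (a + t)] x) := h3
      nlinarith
    have h6 := Finset.single_le_sum (f := fun k => Real.exp (-η * t) *
      Real.exp (η * roofIndSum f₀ ρ₀ y₀ N ((tildeF f₀)^[k] x)))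
      (fun _ _ => by positivity) (Finset.mem_range.2 hn)
    have h7 : deriv (g0 f₀) 1 ^ laterLaps f₀ ρ₀ y₀ t (x, a) ≤ 1 := pow_le_one₀ hl.le hl1.le
    have h8 : 0 ≤ deriv (g0 f₀) 1 ^ N := by positivity
    linarith [h5.trans h6]

lemma lintegral_roofInd_le {η C K : ℝ} (hη : 0 < η)
    (hmom : ∀ n : ℕ, ∫⁻ x, ENNReal.ofReal (Real.exp (η * roofIndSum f₀ ρ₀ y₀ n x)) ∂(muHat f₀ m) ≤
        ENNReal.ofReal (C * K ^ n)) :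
    ∫⁻ x, ENNReal.ofReal (roofInd f₀ ρ₀ y₀ x) ∂(muHat f₀ m) ≤ ENNReal.ofReal (η⁻¹ * (C * K)) := by
  calc ∫⁻ x, ENNReal.ofReal (roofInd f₀ ρ₀ y₀ x) ∂(muHat f₀ m)
      ≤ ∫⁻ x, ENNReal.ofReal η⁻¹ * ENNReal.ofReal (Real.exp (η * roofIndSum f₀ ρ₀ y₀ 1 x)) ∂(muHat f₀ m) := by
        refine lintegral_mono fun x => ?_
        rw [← ENNReal.ofReal_mul (by positivity)]
        refine ENNReal.ofReal_le_ofReal ?_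
        have e1 : roofIndSum f₀ ρ₀ y₀ 1 x = roofInd f₀ ρ₀ y₀ x := birkhoffSum_one _ _ _
        rw [e1, inv_mul_eq_div, le_div_iff₀ hη]
        linarith [Real.add_one_le_exp (η * roofInd f₀ ρ₀ y₀ x)]
    _ = ENNReal.ofReal η⁻¹ * ∫⁻ x, ENNReal.ofReal (Real.exp (η * roofIndSum f₀ ρ₀ y₀ 1 x)) ∂(muHat f₀ m) :=
        lintegral_const_mul' _ _ ENNReal.ofReal_ne_top
    _ ≤ _ := by
        rw [ENNReal.ofReal_mul (by positivity)]
        refine mul_le_mul' le_rfl ?_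
        have := hmom 1
        rwa [pow_one] at this

/-- The contraction accumulated between times `t` and `2 t` is exponentially small on average. -/
lemma exists_lintegral_pow_laterLaps_le (hA : AssumptionA f₀) (hB : AssumptionB f₀)
    (hC : AssumptionC f₀ m) (hρ₀ : 0 < ρ₀) (hy₀ : 0 < y₀) : ∃ δ C : ℝ, 0 < δ ∧ 0 ≤ C ∧ ∀ t : ℝ, 0 ≤ t →
      ∫⁻ p in sigmaR f₀ ρ₀ y₀, ENNReal.ofReal (deriv (g0 f₀) 1 ^ laterLaps f₀ ρ₀ y₀ t (projR p))
        ∂((nu f₀ m).prod volume) ≤ ENNReal.ofReal (C * Real.exp (-δ * t)) := by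
  obtain ⟨η₀, C, K, hη₀, hC0, hK, hmom⟩ := hA.exists_moment (ρ₀ := ρ₀) (m := m) hB hC hρ₀ hy₀
  have hm := measurable_baseP_of_ergodic hC
  -- Half of the exponent is kept in reserve: the integrand also carries the weight r(x) ≤ η⁻¹exp(η
  -- r(x)), and the resulting product of two exponentials is bounded by the sum of their squares.
  set η := η₀ / 2 with hη
  have hη0 : 0 < η := by positivity
  have hl := hA.deriv_g0_pos one_pos
  have hl1 := hA.deriv_g0_lt_one one_pos
  have hc := hA.roof_lower_pos hρ₀
  set c := ρ₀ * Real.log (deriv (g0 f₀) 1)⁻¹ with hcdef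
  have hK0 : 0 < K := one_pos.trans_le hK
  obtain ⟨δ, C', hδ, hC', hrate⟩ := exists_exponential_rate hl hl1 hK hη0 hc
    (show 0 ≤ η⁻¹ * (C * K) by positivity)
  refine ⟨δ, C', hδ, hC', fun t ht => ?_⟩
  obtain ⟨N, hN⟩ := hrate t ht
  refine le_trans ?_ (ENNReal.ofReal_le_ofReal hN)
  set Q := ⌊t / c⌋₊ + 2 with hQ
  set Θ : ℝ → ℝ≥0∞ := fun x => ENNReal.ofReal (deriv (g0 f₀) 1 ^ N) + ∑ k ∈ Finset.range Q,
    ENNReal.ofReal (Real.exp (-η * t) * Real.exp (η * roofIndSum f₀ ρ₀ y₀ N ((tildeF f₀)^[k] x))) with hΘ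
  have hterm : ∀ k, Measurable fun x =>
      ENNReal.ofReal (Real.exp (-η * t) * Real.exp (η * roofIndSum f₀ ρ₀ y₀ N ((tildeF f₀)^[k] x))) :=
    fun k => ((((hA.measurable_roofIndSum hm hy₀ N).comp ((measurable_tildeF hm).iterate k)).const_mul
      η).exp.const_mul _).ennreal_ofReal
  have hΘm : Measurable Θ := measurable_const.add (Finset.measurable_fun_sum _ fun k _ => hterm k)
  have hRm : Measurable fun x => ENNReal.ofReal (roofInd f₀ ρ₀ y₀ x) :=
    (hA.measurable_roofInd hy₀).ennreal_ofReal
  have hae : ∀ᵐ p ∂(((nu f₀ m).prod volume).restrict (sigmaR f₀ ρ₀ y₀)),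
      p ∈ sigmaR f₀ ρ₀ y₀ ∧ p.1.1 ∈ fullOrbit f₀ := by
    refine (ae_restrict_mem (hA.measurableSet_sigmaR hy₀)).and (ae_restrict_of_ae ?_)
    exact Measure.quasiMeasurePreserving_fst.ae
      (ae_of_ae_map measurable_fst.aemeasurable (hA.ae_muHat_mem_fullOrbit hC))
  have hk : ∀ k, ∫⁻ x, ENNReal.ofReal (Real.exp (-η * t) *
      Real.exp (η * roofIndSum f₀ ρ₀ y₀ N ((tildeF f₀)^[k] x))) * ENNReal.ofReal (roofInd f₀ ρ₀ y₀ x)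
        ∂(muHat f₀ m) ≤ ENNReal.ofReal (Real.exp (-η * t) * (η⁻¹ * (C * K)) * (1 + K ^ N)) := by
    intro k
    calc ∫⁻ x, ENNReal.ofReal (Real.exp (-η * t) *
      Real.exp (η * roofIndSum f₀ ρ₀ y₀ N ((tildeF f₀)^[k] x))) * ENNReal.ofReal (roofInd f₀ ρ₀ y₀ x)
        ∂(muHat f₀ m) ≤ ∫⁻ x, ENNReal.ofReal (Real.exp (-η * t) * η⁻¹) *
          (ENNReal.ofReal (Real.exp (η₀ * roofIndSum f₀ ρ₀ y₀ 1 x)) +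
            ENNReal.ofReal (Real.exp (η₀ * roofIndSum f₀ ρ₀ y₀ N ((tildeF f₀)^[k] x)))) ∂(muHat f₀ m) := by
          refine lintegral_mono fun x => ?_
          rw [← ENNReal.ofReal_mul (by positivity), ← ENNReal.ofReal_add (by positivity) (by positivity),
            ← ENNReal.ofReal_mul (by positivity)]
          refine ENNReal.ofReal_le_ofReal ?_
          have e1 : roofIndSum f₀ ρ₀ y₀ 1 x = roofInd f₀ ρ₀ y₀ x := birkhoffSum_one _ _ _
          rw [e1]
          set R := roofInd f₀ ρ₀ y₀ x
          set Y := roofIndSum f₀ ρ₀ y₀ N ((tildeF f₀)^[k] x)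
          have e2 : R ≤ η⁻¹ * Real.exp (η * R) := by
            rw [inv_mul_eq_div, le_div_iff₀ hη0]
            linarith [Real.add_one_le_exp (η * R)]
          have e3 : Real.exp (η₀ * R) = Real.exp (η * R) ^ 2 := by
            rw [← Real.exp_nat_mul]; congr 1; rw [hη]; push_cast; ring
          have e4 : Real.exp (η₀ * Y) = Real.exp (η * Y) ^ 2 := by
            rw [← Real.exp_nat_mul]; congr 1; rw [hη]; push_cast; ring
          rw [e3, e4]
          calc Real.exp (-η * t) * Real.exp (η * Y) * R
              ≤ Real.exp (-η * t) * Real.exp (η * Y) * (η⁻¹ * Real.exp (η * R)) := by gcongr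
            _ = Real.exp (-η * t) * η⁻¹ * (Real.exp (η * Y) * Real.exp (η * R)) := by ring
            _ ≤ _ := by
              gcongr
              nlinarith [sq_nonneg (Real.exp (η * Y) - Real.exp (η * R)),
                sq_nonneg (Real.exp (η * Y)), sq_nonneg (Real.exp (η * R))]
      _ = ENNReal.ofReal (Real.exp (-η * t) * η⁻¹) *
          (∫⁻ x, ENNReal.ofReal (Real.exp (η₀ * roofIndSum f₀ ρ₀ y₀ 1 x)) ∂(muHat f₀ m) +
            ∫⁻ x, ENNReal.ofReal (Real.exp (η₀ * roofIndSum f₀ ρ₀ y₀ N x)) ∂(muHat f₀ m)) := by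
          have hmeas : ∀ n, Measurable fun x => ENNReal.ofReal (Real.exp (η₀ * roofIndSum f₀ ρ₀ y₀ n x)) :=
            fun n => ((hA.measurable_roofIndSum hm hy₀ n).const_mul η₀).exp.ennreal_ofReal
          rw [lintegral_const_mul' _ _ ENNReal.ofReal_ne_top, lintegral_add_left (hmeas 1)]
          rw [← ((hA.measurePreserving_tildeF hC).iterate k).lintegral_comp (hmeas N)]
      _ ≤ ENNReal.ofReal (Real.exp (-η * t) * η⁻¹) *
          (ENNReal.ofReal (C * K ^ 1) + ENNReal.ofReal (C * K ^ N)) :=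
          mul_le_mul' le_rfl (add_le_add (hmom 1) (hmom N))
      _ ≤ _ := by
          rw [← ENNReal.ofReal_add (by positivity) (by positivity), ← ENNReal.ofReal_mul (by positivity)]
          refine ENNReal.ofReal_le_ofReal ?_
          have e1 : K ^ N ≤ K * K ^ N := le_mul_of_one_le_left (by positivity) hK
          calc Real.exp (-η * t) * η⁻¹ * (C * K ^ 1 + C * K ^ N)
              ≤ Real.exp (-η * t) * η⁻¹ * (C * K ^ 1 + C * (K * K ^ N)) := by gcongr
            _ = _ := by ring
  have hR : ∫⁻ x, ENNReal.ofReal (roofInd f₀ ρ₀ y₀ x) ∂(muHat f₀ m) ≤ ENNReal.ofReal (η⁻¹ * (C * K)) := by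
    refine (lintegral_roofInd_le hη₀ hmom).trans (ENNReal.ofReal_le_ofReal ?_)
    refine mul_le_mul_of_nonneg_right (inv_anti₀ hη0 ?_) (by positivity)
    rw [hη]; linarith
  calc ∫⁻ p in sigmaR f₀ ρ₀ y₀, ENNReal.ofReal (deriv (g0 f₀) 1 ^ laterLaps f₀ ρ₀ y₀ t (projR p))
        ∂((nu f₀ m).prod volume)
      ≤ ∫⁻ p in sigmaR f₀ ρ₀ y₀, Θ p.1.1 ∂((nu f₀ m).prod volume) := by
        refine lintegral_mono_ae ?_
        filter_upwards [hae] with p hp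
        have h3 : p.2 < roofInd f₀ ρ₀ y₀ p.1.1 := by rw [roofInd_eq hp.1.1.1]; exact hp.1.2.2
        have h1 := hA.pow_laterLaps_le hρ₀ hy₀ hη0 N hp.2 hp.1.2.1 h3 ht
        refine (ENNReal.ofReal_le_ofReal h1).trans (le_of_eq ?_)
        rw [ENNReal.ofReal_add (by positivity) (Finset.sum_nonneg fun _ _ => by positivity),
          ENNReal.ofReal_sum_of_nonneg fun _ _ => by positivity]
    _ ≤ ∫⁻ x, Θ x * ENNReal.ofReal (roofInd f₀ ρ₀ y₀ x) ∂(muHat f₀ m) := hA.lintegral_sigmaR_le hy₀ hΘm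
    _ = ENNReal.ofReal (deriv (g0 f₀) 1 ^ N) * ∫⁻ x, ENNReal.ofReal (roofInd f₀ ρ₀ y₀ x) ∂(muHat f₀ m) +
        ∑ k ∈ Finset.range Q, ∫⁻ x, ENNReal.ofReal (Real.exp (-η * t) *
          Real.exp (η * roofIndSum f₀ ρ₀ y₀ N ((tildeF f₀)^[k] x))) *
            ENNReal.ofReal (roofInd f₀ ρ₀ y₀ x) ∂(muHat f₀ m) := by
        simp only [hΘ, add_mul, Finset.sum_mul]
        have hmul : ∀ k, Measurable fun x => ENNReal.ofReal (Real.exp (-η * t) *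
            Real.exp (η * roofIndSum f₀ ρ₀ y₀ N ((tildeF f₀)^[k] x))) *
              ENNReal.ofReal (roofInd f₀ ρ₀ y₀ x) := fun k => (hterm k).mul hRm
        rw [lintegral_add_left (hRm.const_mul _), lintegral_const_mul _ hRm,
          lintegral_finsetSum _ fun k _ => hmul k]
    _ ≤ ENNReal.ofReal (deriv (g0 f₀) 1 ^ N) * ENNReal.ofReal (η⁻¹ * (C * K)) +
        ∑ k ∈ Finset.range Q, ENNReal.ofReal (Real.exp (-η * t) * (η⁻¹ * (C * K)) * (1 + K ^ N)) :=
        add_le_add (mul_le_mul' le_rfl hR) (Finset.sum_le_sum fun k _ => hk k)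
    _ = _ := by
        rw [Finset.sum_const, Finset.card_range, nsmul_eq_mul, ← ENNReal.ofReal_mul (by positivity),
          ← ENNReal.ofReal_natCast, ← ENNReal.ofReal_mul (by positivity),
          ← ENNReal.ofReal_add (by positivity) (by positivity)]
        congr 1
        ring

end AssumptionA

/-! ### Comparison of the correlation integrals -/

namespace AssumptionA

lemma measurable_indicator_of_isC1bStar (hA : AssumptionA f₀) (hy₀ : 0 < y₀)
    {V : (ℝ × ℝ) × ℝ → ℝ} (hV : IsC1bStar (sigmaR f₀ ρ₀ y₀) V) :
    Measurable ((sigmaR f₀ ρ₀ y₀).indicator V) := by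
  classical
  rw [← piecewise_eq_indicator]
  exact hV.contDiffOn.continuousOn.measurable_piecewise continuousOn_const (hA.measurableSet_sigmaR hy₀)

lemma lintegral_sigmaR_one_lt_top (hA : AssumptionA f₀) (hB : AssumptionB f₀)
    (hC : AssumptionC f₀ m) (hρ₀ : 0 < ρ₀) (hy₀ : 0 < y₀) :
    (((nu f₀ m).prod volume).restrict (sigmaR f₀ ρ₀ y₀)) univ < ⊤ := by
  obtain ⟨η, C, K, hη, -, -, hmom⟩ := hA.exists_moment (ρ₀ := ρ₀) (m := m) hB hC hρ₀ hy₀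
  have h := hA.lintegral_sigmaR_le (m := m) (ρ₀ := ρ₀) hy₀ (Θ := fun _ => 1) measurable_const
  simp only [one_mul, lintegral_const] at h
  exact h.trans_lt ((lintegral_roofInd_le hη hmom).trans_lt ENNReal.ofReal_lt_top)

/-- The normalizing factor is finite because r is bounded below by a positive constant. If ν = 0
that factor would be 0⁻¹ = ∞, but it then multiplies the zero measure. -/
lemma exists_nuR_eq_smul (hA : AssumptionA f₀) (hρ₀ : 0 < ρ₀) (hy₀ : 0 < y₀) : ∃ c : ℝ≥0∞, c ≠ ⊤ ∧
    nuR f₀ ρ₀ y₀ m = c • ((nu f₀ m).prod volume).restrict (sigmaR f₀ ρ₀ y₀) := by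
  by_cases h0 : nu f₀ m = 0
  · exact ⟨0, ENNReal.zero_ne_top, by rw [nuR, h0]; simp⟩
  · refine ⟨_, ENNReal.inv_ne_top.2 (ne_of_gt ?_), rfl⟩
    have hc := hA.roof_lower_pos (ρ₀ := ρ₀) hρ₀
    have h1 : ∫⁻ _, ENNReal.ofReal (ρ₀ * Real.log (deriv (g0 f₀) 1)⁻¹) ∂(nu f₀ m) ≤
        ∫⁻ z, ENNReal.ofReal (roof f₀ ρ₀ y₀ z.1) ∂(nu f₀ m) := by
      refine lintegral_mono_ae ?_
      filter_upwards [hA.ae_nu_mem_baseSigma (m := m)] with z hz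
      exact ENNReal.ofReal_le_ofReal (hA.roof_ge hρ₀ hy₀ hz.1)
    refine lt_of_lt_of_le ?_ h1
    rw [lintegral_const]
    exact ENNReal.mul_pos (ENNReal.ofReal_pos.2 hc).ne' (Measure.measure_univ_ne_zero.2 h0)

/-- The fibre average is evaluated at a later orbit point, so ν_x must be carried by ℝ⁺ along the
whole orbit; invariance of μ̂ transports the almost sure statement. -/
lemma ae_nuR_good (hA : AssumptionA f₀) (hC : AssumptionC f₀ m) (hy₀ : 0 < y₀) (κ : Kernel ℝ ℝ)
    [IsMarkovKernel κ] (hκ : (muHat f₀ m).compProd κ = nu f₀ m) :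
    ∀ᵐ p ∂(((nu f₀ m).prod volume).restrict (sigmaR f₀ ρ₀ y₀)), p ∈ sigmaR f₀ ρ₀ y₀ ∧
      p.1.1 ∈ fullOrbit f₀ ∧ ∀ n, ∀ᵐ y ∂(κ ((tildeF f₀)^[n] p.1.1)), y ∈ Ioi (0 : ℝ) := by
  have h1 : ∀ᵐ z ∂((muHat f₀ m).compProd κ), z.2 ∈ Ioi (0 : ℝ) := by
    rw [hκ]
    filter_upwards [hA.ae_nu_mem_baseSigma (m := m)] with z hz using hz.2
  have h2 := Measure.ae_ae_of_ae_compProd h1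
  have h3 : ∀ᵐ x ∂(muHat f₀ m), ∀ n, ∀ᵐ y ∂(κ ((tildeF f₀)^[n] x)), y ∈ Ioi (0 : ℝ) :=
    ae_all_iff.2 fun n => ((hA.measurePreserving_tildeF hC).iterate n).quasiMeasurePreserving.ae h2
  refine (ae_restrict_mem (hA.measurableSet_sigmaR hy₀)).and (ae_restrict_of_ae ?_)
  exact Measure.quasiMeasurePreserving_fst.ae (ae_of_ae_map measurable_fst.aemeasurable
    ((hA.ae_muHat_mem_fullOrbit hC).and h3))

/-- `fibreAverage`, computed with measurable modifications of the observable and of the flow. -/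
def fibreAverageInd (f₀ : ℝ → ℝ) (ρ₀ y₀ : ℝ) (κ : Kernel ℝ ℝ) (V : (ℝ × ℝ) × ℝ → ℝ) (t : ℝ)
    (q : ℝ × ℝ) : ℝ :=
  ∫ y in Ioi (0 : ℝ), (sigmaR f₀ ρ₀ y₀).indicator V (flowInd f₀ ρ₀ y₀ t ((q.1, y), q.2)) ∂(κ q.1)

lemma stronglyMeasurable_fibreAverageInd (hA : AssumptionA f₀) (hm : Measurable (baseP f₀))
    (hy₀ : 0 < y₀) (κ : Kernel ℝ ℝ) [IsMarkovKernel κ] {V : (ℝ × ℝ) × ℝ → ℝ}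
    (hV : IsC1bStar (sigmaR f₀ ρ₀ y₀) V) (t : ℝ) :
    StronglyMeasurable (fibreAverageInd f₀ ρ₀ y₀ κ V t) := by
  have h1 : Measurable fun w : (ℝ × ℝ) × ℝ =>
      (sigmaR f₀ ρ₀ y₀).indicator V (flowInd f₀ ρ₀ y₀ t ((w.1.1, w.2), w.1.2)) :=
    (hA.measurable_indicator_of_isC1bStar hy₀ hV).comp ((hA.measurable_flowInd hm hy₀ t).comp
      ((measurable_fst.fst.prodMk measurable_snd).prodMk measurable_fst.snd))
  have h2 : Measurable ((Prod.snd ⁻¹' Ioi (0 : ℝ)).indicator fun w : (ℝ × ℝ) × ℝ =>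
      (sigmaR f₀ ρ₀ y₀).indicator V (flowInd f₀ ρ₀ y₀ t ((w.1.1, w.2), w.1.2))) :=
    h1.indicator (measurable_snd measurableSet_Ioi)
  have h3 := StronglyMeasurable.integral_kernel_prod_right'
    (κ := κ.comap (Prod.fst : ℝ × ℝ → ℝ) measurable_fst) h2.stronglyMeasurable
  convert h3 using 1
  ext q
  rw [fibreAverageInd, ← integral_indicator measurableSet_Ioi, Kernel.comap_apply]
  rfl

lemma abs_indicator_le {S : Set ((ℝ × ℝ) × ℝ)} {V : (ℝ × ℝ) × ℝ → ℝ} {B : ℝ}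
    (hB : ∀ p ∈ S, |V p| ≤ B) (p : (ℝ × ℝ) × ℝ) : |S.indicator V p| ≤ |B| := by
  by_cases hp : p ∈ S
  · rw [indicator_of_mem hp]; exact (hB p hp).trans (le_abs_self B)
  · rw [indicator_of_notMem hp, abs_zero]; exact abs_nonneg B

lemma abs_fibreAverageInd_le (κ : Kernel ℝ ℝ) [IsMarkovKernel κ] {V : (ℝ × ℝ) × ℝ → ℝ} {B : ℝ}
    (hB : ∀ p ∈ sigmaR f₀ ρ₀ y₀, |V p| ≤ B) (t : ℝ) (q : ℝ × ℝ) :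
    |fibreAverageInd f₀ ρ₀ y₀ κ V t q| ≤ |B| := by
  refine (norm_integral_le_of_norm_le_const (C := |B|) (μ := (κ q.1).restrict (Ioi 0))
    (f := fun y => (sigmaR f₀ ρ₀ y₀).indicator V (flowInd f₀ ρ₀ y₀ t ((q.1, y), q.2)))
    (Eventually.of_forall fun y => abs_indicator_le hB _)).trans ?_
  refine mul_le_of_le_one_right (abs_nonneg _) ?_
  rw [measureReal_restrict_apply_univ]
  exact measureReal_le_one

lemma fibreAverage_eq (hA : AssumptionA f₀) (hρ₀ : 0 < ρ₀) (hy₀ : 0 < y₀) (κ : Kernel ℝ ℝ)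
    (V : (ℝ × ℝ) × ℝ → ℝ) {t : ℝ} {q : ℝ × ℝ} (hq : q.1 ∈ fullOrbit f₀) (hu : 0 ≤ q.2 + t) :
    fibreAverage f₀ ρ₀ y₀ κ V t q = fibreAverageInd f₀ ρ₀ y₀ κ V t q := by
  refine setIntegral_congr_fun measurableSet_Ioi fun y hy => ?_
  have hmem := hA.flowInd_mem hρ₀ hy₀ (p := ((q.1, y), q.2)) hq hy hu
  rw [indicator_of_mem hmem, flow_eq hq]

/-- A value on the fibre differs from the fibre average by at most the oscillation. -/
lemma abs_sub_fibreAverageInd_le (hA : AssumptionA f₀) (hm : Measurable (baseP f₀)) (hρ₀ : 0 < ρ₀)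
    (hy₀ : 0 < y₀) (κ : Kernel ℝ ℝ) [IsMarkovKernel κ] {V : (ℝ × ℝ) × ℝ → ℝ}
    (hV : IsC1bStar (sigmaR f₀ ρ₀ y₀) V) {t D v : ℝ} {q : ℝ × ℝ} (hq : q.1 ∈ fullOrbit f₀)
    (hu : 0 ≤ q.2 + t) (hκq : ∀ᵐ y ∂(κ q.1), y ∈ Ioi (0 : ℝ))
    (hD : ∀ y : ℝ, 0 < y → |v - V (flowInd f₀ ρ₀ y₀ t ((q.1, y), q.2))| ≤ D) :
    |v - fibreAverageInd f₀ ρ₀ y₀ κ V t q| ≤ D := by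
  obtain ⟨B, hB⟩ := hV.bounded
  rw [fibreAverageInd, Measure.restrict_eq_self_of_ae_mem hκq]
  have hmeas : Measurable fun y : ℝ =>
      (sigmaR f₀ ρ₀ y₀).indicator V (flowInd f₀ ρ₀ y₀ t ((q.1, y), q.2)) :=
    (hA.measurable_indicator_of_isC1bStar hy₀ hV).comp ((hA.measurable_flowInd hm hy₀ t).comp
      ((measurable_const.prodMk measurable_id).prodMk measurable_const))
  have hint : Integrable (fun y : ℝ =>
      (sigmaR f₀ ρ₀ y₀).indicator V (flowInd f₀ ρ₀ y₀ t ((q.1, y), q.2))) (κ q.1) :=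
    Integrable.of_bound hmeas.aestronglyMeasurable |B| (Eventually.of_forall fun y => abs_indicator_le hB _)
  have e : v - ∫ y, (sigmaR f₀ ρ₀ y₀).indicator V (flowInd f₀ ρ₀ y₀ t ((q.1, y), q.2)) ∂(κ q.1) =
      ∫ y, (v - (sigmaR f₀ ρ₀ y₀).indicator V (flowInd f₀ ρ₀ y₀ t ((q.1, y), q.2))) ∂(κ q.1) := by
    rw [integral_sub (integrable_const v) hint]
    simp
  rw [e]
  have h := norm_integral_le_of_norm_le_const (μ := κ q.1) (C := D)
    (f := fun y => v - (sigmaR f₀ ρ₀ y₀).indicator V (flowInd f₀ ρ₀ y₀ t ((q.1, y), q.2))) (by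
      filter_upwards [hκq] with y hy
      rw [indicator_of_mem (hA.flowInd_mem hρ₀ hy₀ (p := ((q.1, y), q.2)) hq hy hu)]
      exact hD y hy)
  simpa using h

end AssumptionA

end InducedFlow

end

/-! ### Assembly of the estimate -/

theorem proposition6p3
    (f₀ : ℝ → ℝ) (m : Measure (ℝ × ℝ)) (ρ₀ y₀ : ℝ)
    (hA : InducedFlow.AssumptionA f₀) (hB : InducedFlow.AssumptionB f₀)
    (hC : InducedFlow.AssumptionC f₀ m)
    (hρ₀ : 0 < ρ₀) (hD : InducedFlow.AssumptionD f₀ ρ₀ m) (hy₀ : 0 < y₀)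
    -- a disintegration `x ↦ ν_x` of `ν` over `μ̂`
    (κ : Kernel ℝ ℝ) [IsMarkovKernel κ]
    (hκ : (InducedFlow.muHat f₀ m).compProd κ = InducedFlow.nu f₀ m) :
    ∃ δ : ℝ, 0 < δ ∧
      ∀ U V : (ℝ × ℝ) × ℝ → ℝ,
        InducedFlow.IsC1bStar (InducedFlow.sigmaR f₀ ρ₀ y₀) U →
        InducedFlow.IsC1bStar (InducedFlow.sigmaR f₀ ρ₀ y₀) V →
        ∫ p, U p ∂(InducedFlow.nuR f₀ ρ₀ y₀ m) = 0 →
        ∃ C : ℝ, 0 < C ∧ ∀ t : ℝ, 0 ≤ t →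
          Integrable (fun p => U p * V (InducedFlow.flow f₀ ρ₀ y₀ (2 * t) p))
            (InducedFlow.nuR f₀ ρ₀ y₀ m) ∧
          Integrable (fun p => U p * InducedFlow.fibreAverage f₀ ρ₀ y₀ κ V t
            (InducedFlow.semiflow f₀ ρ₀ y₀ t (InducedFlow.projR p)))
            (InducedFlow.nuR f₀ ρ₀ y₀ m) ∧
          |(∫ p, U p * V (InducedFlow.flow f₀ ρ₀ y₀ (2 * t) p) ∂(InducedFlow.nuR f₀ ρ₀ y₀ m)) -
            ∫ p, U p * InducedFlow.fibreAverage f₀ ρ₀ y₀ κ V t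
              (InducedFlow.semiflow f₀ ρ₀ y₀ t (InducedFlow.projR p))
              ∂(InducedFlow.nuR f₀ ρ₀ y₀ m)| ≤ C * Real.exp (-δ * t) := by
  open InducedFlow AssumptionA in
  obtain ⟨δ, C₀, hδ, hC₀, hest⟩ :=
    hA.exists_lintegral_pow_laterLaps_le (ρ₀ := ρ₀) (m := m) hB hC hρ₀ hy₀
  have hm := measurable_baseP_of_ergodic hC
  obtain ⟨c, hc, hnuR⟩ := hA.exists_nuR_eq_smul (m := m) hρ₀ hy₀
  have hl := hA.deriv_g0_pos one_pos
  refine ⟨δ, hδ, fun U V hU hV _ => ?_⟩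
  obtain ⟨BU, hBU⟩ := hU.bounded
  obtain ⟨BV, hBV⟩ := hV.bounded
  obtain ⟨CV, hCV, hosc⟩ := hA.exists_abs_flowInd_sub_le hρ₀ hy₀ hV
  refine ⟨c.toReal * (|BU| * CV * C₀) + 1, by positivity, fun t ht => ?_⟩
  rw [hnuR]
  set base := ((nu f₀ m).prod volume).restrict (sigmaR f₀ ρ₀ y₀) with hbase
  have hfin : IsFiniteMeasure (c • base) := by
    refine ⟨?_⟩
    rw [Measure.smul_apply, smul_eq_mul]
    exact ENNReal.mul_lt_top hc.lt_top (hA.lintegral_sigmaR_one_lt_top hB hC hρ₀ hy₀)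
  have hgood := hA.ae_nuR_good (ρ₀ := ρ₀) hC hy₀ κ hκ
  have hUm := hA.measurable_indicator_of_isC1bStar hy₀ hU
  have hVm := hA.measurable_indicator_of_isC1bStar hy₀ hV
  have hΦm := hA.stronglyMeasurable_fibreAverageInd hm hy₀ κ hV t
  have hprojm : Measurable projR := measurable_fst.fst.prodMk measurable_snd
  have e1 : (fun p => U p * V (flow f₀ ρ₀ y₀ (2 * t) p)) =ᵐ[base] fun p =>
      (sigmaR f₀ ρ₀ y₀).indicator U p *
        (sigmaR f₀ ρ₀ y₀).indicator V (flowInd f₀ ρ₀ y₀ (2 * t) p) := by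
    filter_upwards [hgood] with p hp
    have h0 : 0 ≤ p.2 := hp.1.2.1
    rw [indicator_of_mem hp.1, flow_eq hp.2.1,
      indicator_of_mem (hA.flowInd_mem hρ₀ hy₀ hp.2.1 hp.1.1.2 (by positivity))]
  have e2 : (fun p => U p * fibreAverage f₀ ρ₀ y₀ κ V t (semiflow f₀ ρ₀ y₀ t (projR p))) =ᵐ[base]
      fun p => (sigmaR f₀ ρ₀ y₀).indicator U p *
        fibreAverageInd f₀ ρ₀ y₀ κ V t (semiflowInd f₀ ρ₀ y₀ t (projR p)) := by
    filter_upwards [hgood] with p hp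
    have h0 : 0 ≤ p.2 := hp.1.2.1
    obtain ⟨g1, g2, -⟩ := hA.semiflowInd_mem hρ₀ hy₀ (a := p.2) hp.2.1 (by positivity : 0 ≤ p.2 + t)
    rw [indicator_of_mem hp.1, semiflow_eq (p := projR p) hp.2.1,
      hA.fibreAverage_eq hρ₀ hy₀ κ V (q := semiflowInd f₀ ρ₀ y₀ t (projR p)) g1 (add_nonneg g2 ht)]
  have e1' := Measure.ae_smul_measure e1 c
  have e2' := Measure.ae_smul_measure e2 c
  have i1 : Integrable (fun p => (sigmaR f₀ ρ₀ y₀).indicator U p *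
      (sigmaR f₀ ρ₀ y₀).indicator V (flowInd f₀ ρ₀ y₀ (2 * t) p)) (c • base) := by
    refine Integrable.of_bound (hUm.mul (hVm.comp
      (hA.measurable_flowInd hm hy₀ (2 * t)))).aestronglyMeasurable (|BU| * |BV|)
      (Eventually.of_forall fun p => ?_)
    rw [Real.norm_eq_abs, abs_mul]
    exact mul_le_mul (abs_indicator_le hBU p) (abs_indicator_le hBV _) (abs_nonneg _) (abs_nonneg _)
  have i2 : Integrable (fun p => (sigmaR f₀ ρ₀ y₀).indicator U p *
      fibreAverageInd f₀ ρ₀ y₀ κ V t (semiflowInd f₀ ρ₀ y₀ t (projR p))) (c • base) := by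
    refine Integrable.of_bound (hUm.mul (hΦm.measurable.comp
      ((hA.measurable_semiflowInd hm hy₀ t).comp hprojm))).aestronglyMeasurable (|BU| * |BV|)
      (Eventually.of_forall fun p => ?_)
    rw [Real.norm_eq_abs, abs_mul]
    exact mul_le_mul (abs_indicator_le hBU p) (abs_fibreAverageInd_le κ hBV t _) (abs_nonneg _)
      (abs_nonneg _)
  refine ⟨i1.congr (ae_eq_symm e1'), i2.congr (ae_eq_symm e2'), ?_⟩
  rw [integral_congr_ae e1', integral_congr_ae e2', ← integral_sub i1 i2]
  have hpt : ∀ᵐ p ∂base, ENNReal.ofReal ‖(sigmaR f₀ ρ₀ y₀).indicator U p *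
      (sigmaR f₀ ρ₀ y₀).indicator V (flowInd f₀ ρ₀ y₀ (2 * t) p) -
      (sigmaR f₀ ρ₀ y₀).indicator U p *
        fibreAverageInd f₀ ρ₀ y₀ κ V t (semiflowInd f₀ ρ₀ y₀ t (projR p))‖ ≤
      ENNReal.ofReal (|BU| * CV) *
        ENNReal.ofReal (deriv (g0 f₀) 1 ^ laterLaps f₀ ρ₀ y₀ t (projR p)) := by
    filter_upwards [hgood] with p hp
    have h0 : 0 ≤ p.2 := hp.1.2.1
    obtain ⟨g1, g2, -⟩ := hA.semiflowInd_mem hρ₀ hy₀ (a := p.2) hp.2.1 (by positivity : 0 ≤ p.2 + t)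
    rw [← ENNReal.ofReal_mul (by positivity)]
    refine ENNReal.ofReal_le_ofReal ?_
    rw [← mul_sub, Real.norm_eq_abs, abs_mul, mul_assoc]
    refine mul_le_mul (abs_indicator_le hBU p) ?_ (abs_nonneg _) (abs_nonneg _)
    -- Writing the flow of time 2t as two flows of time t shows that V is evaluated at the flow of
    -- P̃_t p, a point of the very fibre being averaged.
    rw [indicator_of_mem (hA.flowInd_mem hρ₀ hy₀ hp.2.1 hp.1.1.2 (by positivity)),
      ← hA.flowInd_flowInd hρ₀ hy₀ hp.2.1 h0 ht]
    have eq1 : flowInd f₀ ρ₀ y₀ t p = (((semiflowInd f₀ ρ₀ y₀ t (projR p)).1,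
        (flowInd f₀ ρ₀ y₀ t p).1.2), (semiflowInd f₀ ρ₀ y₀ t (projR p)).2) :=
      Prod.ext (Prod.ext (flowInd_fst p t) rfl) rfl
    have hy : 0 < (flowInd f₀ ρ₀ y₀ t p).1.2 :=
      (hA.flowInd_mem hρ₀ hy₀ hp.2.1 hp.1.1.2 (by positivity)).1.2
    refine hA.abs_sub_fibreAverageInd_le hm hρ₀ hy₀ κ hV g1 (add_nonneg g2 ht) (hp.2.2 _) fun y hy' => ?_
    rw [eq1]
    exact hosc _ g1 _ _ _ _ hy hy' (add_nonneg g2 ht)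
  have hbound : ∫⁻ p, ENNReal.ofReal ‖(sigmaR f₀ ρ₀ y₀).indicator U p *
      (sigmaR f₀ ρ₀ y₀).indicator V (flowInd f₀ ρ₀ y₀ (2 * t) p) -
      (sigmaR f₀ ρ₀ y₀).indicator U p *
        fibreAverageInd f₀ ρ₀ y₀ κ V t (semiflowInd f₀ ρ₀ y₀ t (projR p))‖ ∂(c • base) ≤
      ENNReal.ofReal (c.toReal * (|BU| * CV * C₀) * Real.exp (-δ * t)) := by
    rw [lintegral_smul_measure, smul_eq_mul]
    refine (mul_le_mul' le_rfl ((lintegral_mono_ae hpt).trans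
      ((lintegral_const_mul' _ _ ENNReal.ofReal_ne_top).trans_le (mul_le_mul' le_rfl (hest t ht))))).trans
      (le_of_eq ?_)
    rw [← ENNReal.ofReal_mul (by positivity)]
    conv_lhs => rw [← ENNReal.ofReal_toReal hc]
    rw [← ENNReal.ofReal_mul ENNReal.toReal_nonneg]
    congr 1
    ring
  have hfinal := (norm_integral_le_lintegral_norm _).trans
    (ENNReal.toReal_le_of_le_ofReal (by positivity) hbound)
  rw [Real.norm_eq_abs] at hfinal
  refine hfinal.trans (mul_le_mul_of_nonneg_right (by linarith) (Real.exp_pos _).le)
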